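/- Let $k$ be an algebraically closed field of characteristic $0$. Let $A$ be an associative conformal algebra over $k$: a $k[\partial]$-module with a $k$-bilinear product $A\times A\to A[\lambda]$, $(a,b)\mapsto a_{\lambda}b$, such that $(\partial a)_\lambda b=-\lambda\, a_\lambda b$, $a_\lambda(\partial b)=(\partial+\lambda)(a_\lambda b)$ and $(a_\lambda b)_{\lambda+\mu}c=a_\lambda(b_\mu c)$ for all $a,b,c\in A$. **Cochains.** Let $C^0=A/\partial A$ and, for $n\ge1$, let $C^n$ be the space of conformal sesquilinear maps, i.e. $k$-multilinear maps $\varphi:A^{n}\to A[\lambda_1,\dots,\lambda_{n-1}]$ with $$\varphi_{\lambda_1,\dots,\lambda_{n-1}}(a_1,\dots,\partial a_i,\dots,a_n)=-\lambda_i\,\varphi_{\lambda_1,\dots,\lambda_{n-1}}(a_1,\dots,a_n)\quad(1\le i\le n-1),$$ $$\varphi_{\lambda_1,\dots,\lambda_{n-1}}(a_1,\dots,a_{n-1},\partial a_n)=(\partial+\lambda_1+\dots+\lambda_{n-1})\,\varphi_{\lambda_1,\dots,\lambda_{n-1}}(a_1,\dots,a_n)$$ (so $C^1=\mathrm{Hom}_{k[\partial]}(A,A)$).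 The differential is $d_0(b)(a)=a_{-\partial}b-b_0a$ and, for $n\ge1$, $$d_n(\varphi)_{\lambda_1,\dots,\lambda_n}(a_1,\dots,a_{n+1})=a_1{}_{\lambda_1}\varphi_{\lambda_2,\dots,\lambda_n}(a_2,\dots,a_{n+1})$$ $$+\sum_{i=1}^n(-1)^i\varphi_{\lambda_1,\dots,\lambda_i+\lambda_{i+1},\dots,\lambda_n}(a_1,\dots,a_i{}_{\lambda_i}a_{i+1},\dots,a_{n+1})+(-1)^{n+1}\varphi_{\lambda_1,\dots,\lambda_{n-1}}(a_1,\dots,a_n)_{\lambda_1+\dots+\lambda_n}a_{n+1}.$$ **Cup product.** For $f\in C^m$, $g\in C^n$ with $m,n\ge1$, and $b,b'\in C^0$, $$(f\sqcup g)_{\lambda_1,\dots,\lambda_{m+n-1}}(a_1,\dots,a_{m+n})=f_{\lambda_1,\dots,\lambda_{m-1}}(a_1,\dots,a_m)_{\lambda_1+\dots+\lambda_m}\,g_{\lambda_{m+1},\dots,\lambda_{m+n-1}}(a_{m+1},\dots,a_{m+n}),$$ $b\sqcup g=b_0\,g(\cdots)$, $f\sqcup b=f(\cdots)_{-\partial}b$,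 and $b\sqcup b'=b_0b'$ modulo $\partial A$. **Bracket.** For $f\in C^m$, $g\in C^n$ let $f\bullet g=\sum_{i=1}^m(-1)^{(n-1)(i-1)}f\bullet_ig$. For $m,n\ge1$, the map $f\bullet_i g\in C^{m+n-1}$ is obtained by inserting $g_{\lambda_i,\dots,\lambda_{i+n-2}}(a_i,\dots,a_{i+n-1})$ into the $i$-th argument of $f$, where, if $i<m$, the $i$-th parameter of $f$ is $\lambda_i+\dots+\lambda_{i+n-1}$; the other parameters of $f$ are those of its other arguments. For $b\in C^0$, $f\bullet_ib$ is $$f_{\lambda_1,\dots,\lambda_{i-1},0,\lambda_i,\dots,\lambda_{m-2}}(a_1,\dots,a_{i-1},b,a_i,\dots,a_{m-1})\quad(i<m),$$ $$f_{\lambda_1,\dots,\lambda_{m-2},\,-\partial-\lambda_1-\dots-\lambda_{m-2}}(a_1,\dots,a_{m-1},b)\quad(i=m),$$ which for $m=1$ is read as the class of $f(b)$ in $A/\partial A$; and $b\bullet f=0$. Let $[f,g]=f\bullet g-(-1)^{(m-1)(n-1)}g\bullet f\in C^{m+n-1}$ (so $[C^0,C^0]=0$). **Theorem.** One has $d_{n+1}d_n=0$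 for all $n\ge 0$. Let $HH^n(A)=\ker d_n/\operatorname{im}d_{n-1}$ for $n\ge0$ (with $\operatorname{im}d_{-1}=0$). The operations $\sqcup$ and $[-,-]$ map cocycles to cocycles and induce bilinear operations on $\bigoplus_{n\ge0}HH^n(A)$, and with these $\Big(\bigoplus_{n\ge0}HH^n(A),\sqcup,[-,-]\Big)$ is a Gerstenhaber algebra. That is, for all classes $f,g,h$ of degrees $m,n,p\ge 0$: * $\sqcup$ is associative, has degree $0$, and $f\sqcup g=(-1)^{mn}g\sqcup f$; * $[-,-]$ has degree $-1$, $[f,g]=-(-1)^{(m-1)(n-1)}[g,f]$, and $[f,[g,h]]=[[f,g],h]+(-1)^{(m-1)(n-1)}[g,[f,h]]$; * $[f\sqcup g,h]=[f,h]\sqcup g+(-1)^{m(p-1)}f\sqcup[g,h]$. -/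

import Mathlib

open scoped TensorProduct DirectSum

namespace ConformalHochschild

noncomputable section

section Polynomials

variable {k : Type*} [Field k] {A : Type*} [AddCommGroup A] [Module k A]

/-- `A[x₀, …, x_{n-1}]`: polynomials in `n` variables with coefficients in the vector space `A`. -/
abbrev LPoly (k : Type*) [Field k] (A : Type*) [AddCommGroup A] [Module k A] (n : ℕ) :=
  MvPolynomial (Fin n) k ⊗[k] A

/-- Parameters which may be substituted for a variable: polynomials in `x₀, …, x_{n-1}` and `∂`;
the `Polynomial` variable `X` stands for `∂`. -/
abbrev Param (k : Type*) [Field k] (n : ℕ) := Polynomial (MvPolynomial (Fin n) k)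

/-- The coefficientwise extension of `∂` to `A[x₀, …, x_{n-1}]`. -/
def extDer (der : A →ₗ[k] A) (n : ℕ) :
    LPoly k A n →ₗ[MvPolynomial (Fin n) k] LPoly k A n :=
  der.baseChange (MvPolynomial (Fin n) k)

/-- The action of the parameters `k[x₀, …, x_{n-1}][∂]` on `A[x₀, …, x_{n-1}]`. -/
def act (der : A →ₗ[k] A) (n : ℕ) :
    Param k n →ₐ[MvPolynomial (Fin n) k] Module.End (MvPolynomial (Fin n) k) (LPoly k A n) :=
  Polynomial.aeval (extDer der n)

/-- Substitution: `A[x₀, …, x_{m-1}] → A[x₀, …, x_{n-1}]`, `p ⊗ a ↦ p(r₀, …, r_{m-1}) a`.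
Where a parameter `r j` contains `∂`, this `∂` acts on the coefficient `a`. -/
def substPoly (der : A →ₗ[k] A) {m n : ℕ} (r : Fin m → Param k n) :
    LPoly k A m →ₗ[k] LPoly k A n :=
  TensorProduct.lift (LinearMap.mk₂ k
    (fun p a => act der n (MvPolynomial.aeval r p) (1 ⊗ₜ[k] a))
    (fun p q a => by simp)
    (fun c p a => by
      rw [map_smul, show act der n (c • MvPolynomial.aeval r p) = c • act der n _ from
        LinearMap.map_smul_of_tower (act der n).toLinearMap c _, LinearMap.smul_apply])
    (fun p a b => by simp [TensorProduct.tmul_add]) (fun c p a => by simp))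

@[simp] lemma extDer_tmul (der : A →ₗ[k] A) (n : ℕ) (p : MvPolynomial (Fin n) k) (a : A) :
    extDer der n (p ⊗ₜ a) = p ⊗ₜ der a := by simp [extDer]

@[simp] lemma subst_tmul (der : A →ₗ[k] A) {m n : ℕ} (r : Fin m → Param k n)
    (p : MvPolynomial (Fin m) k) (a : A) :
    substPoly der r (p ⊗ₜ a) = act der n (MvPolynomial.aeval r p) (1 ⊗ₜ[k] a) := by simp [substPoly]

lemma act_C (der : A →ₗ[k] A) (n : ℕ) (p : MvPolynomial (Fin n) k) (w : LPoly k A n) :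
    act der n (Polynomial.C p) w = p • w := by
  simp [act, Module.algebraMap_end_apply]

lemma act_X (der : A →ₗ[k] A) (n : ℕ) (w : LPoly k A n) :
    act der n Polynomial.X w = extDer der n w := by
  simp [act]

lemma act_mul (der : A →ₗ[k] A) (n : ℕ) (q q' : Param k n) (w : LPoly k A n) :
    act der n (q * q') w = act der n q (act der n q' w) := by
  simp [map_mul]

lemma subst_smul (der : A →ₗ[k] A) {m n : ℕ} (r : Fin m → Param k n)
    (p : MvPolynomial (Fin m) k) (w : LPoly k A m) :
    substPoly der r (p • w) = act der n (MvPolynomial.aeval r p) (substPoly der r w) := by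
  induction w using TensorProduct.induction_on with
  | zero => simp
  | add x y hx hy => simp only [smul_add, map_add, hx, hy]
  | tmul q a => simp [TensorProduct.smul_tmul']

lemma subst_extDer (der : A →ₗ[k] A) {m n : ℕ} (r : Fin m → Param k n) (w : LPoly k A m) :
    substPoly der r (extDer der m w) = act der n Polynomial.X (substPoly der r w) := by
  induction w using TensorProduct.induction_on with
  | zero => simp
  | add x y hx hy => simp only [map_add, hx, hy]
  | tmul q a =>
    rw [extDer_tmul, subst_tmul, subst_tmul, ← act_mul, mul_comm, act_mul, act_X, extDer_tmul]

end Polynomials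

/-- A conformal algebra: a vector space `A` with an endomorphism `∂` (that is, a `k[∂]`-module)
and a bilinear `λ`-product `A × A → A[λ]`, where `λ` is the variable `x₀`, such that
`(∂a)_λ b = -λ (a_λ b)` and `a_λ (∂b) = (∂ + λ)(a_λ b)`. -/
structure ConformalAlgebra (k : Type*) [Field k] (A : Type*) [AddCommGroup A] [Module k A] where
  /-- the endomorphism `∂` -/
  der : A →ₗ[k] A
  /-- the `λ`-product -/
  mul : A →ₗ[k] A →ₗ[k] LPoly k A 1
  mul_der_left : ∀ a b, mul (der a) b = -((MvPolynomial.X 0 : MvPolynomial (Fin 1) k) • mul a b)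
  mul_der_right : ∀ a b, mul a (der b) =
    extDer der 1 (mul a b) + (MvPolynomial.X 0 : MvPolynomial (Fin 1) k) • mul a b

section

variable {k : Type*} [Field k] {A : Type*} [AddCommGroup A] [Module k A]

/-- For a parameter `r`, the product `(u, v) ↦ u_r v` on `A[x₀, …, x_{n-1}]`: it is bilinear over
`k[x₀, …, x_{n-1}]`, and `a_r b` for `a b : A` is the value of `a_λ b` at `λ = r`. -/
def ConformalAlgebra.mulAt (S : ConformalAlgebra k A) {n : ℕ} (r : Param k n) :
    LPoly k A n →ₗ[MvPolynomial (Fin n) k]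
      LPoly k A n →ₗ[MvPolynomial (Fin n) k] LPoly k A n :=
  LinearMap.liftBaseChange (MvPolynomial (Fin n) k)
    (((LinearMap.liftBaseChangeEquiv (MvPolynomial (Fin n) k)).restrictScalars k).toLinearMap ∘ₗ
      S.mul.compr₂ (substPoly S.der fun _ : Fin 1 => r))

lemma ConformalAlgebra.mulAt_tmul (S : ConformalAlgebra k A) {n : ℕ} (r : Param k n)
    (p q : MvPolynomial (Fin n) k) (a b : A) :
    S.mulAt r (p ⊗ₜ a) (q ⊗ₜ b) = (p * q) • substPoly S.der (fun _ : Fin 1 => r) (S.mul a b) := by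
  simp [mulAt, mul_smul]

end

/-- An associative conformal algebra: a conformal algebra such that
`(a_λ b)_{λ+μ} c = a_λ (b_μ c)` in `A[λ, μ]`, with `λ = x₀` and `μ = x₁`. -/
structure AssocConformalAlgebra (k : Type*) [Field k] (A : Type*) [AddCommGroup A] [Module k A]
    extends ConformalAlgebra k A where
  mul_assoc : ∀ a b c : A,
    toConformalAlgebra.mulAt (n := 2) (Polynomial.C (MvPolynomial.X 0 + MvPolynomial.X 1))
        (substPoly der (fun _ => Polynomial.C (MvPolynomial.X 0)) (mul a b)) (1 ⊗ₜ c) =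
      toConformalAlgebra.mulAt (n := 2) (Polynomial.C (MvPolynomial.X 0)) (1 ⊗ₜ a)
        (substPoly der (fun _ => Polynomial.C (MvPolynomial.X 1)) (mul b c))

section Cochains

variable {k : Type*} [Field k] {A : Type*} [AddCommGroup A] [Module k A]

/-- The parameter attached to the argument number `l` (counted from `0`) of a map
`A^{N+1} → A[x₀, …, x_{N-1}]`: it is `x_l` for `l < N`, and `-∂ - x₀ - … - x_{N-1}` for the last
argument `l = N`. -/
def lam (k : Type*) [Field k] (N l : ℕ) : Param k N :=
  if h : l < N then Polynomial.C (MvPolynomial.X ⟨l, h⟩)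
  else -Polynomial.X - ∑ j : Fin N, Polynomial.C (MvPolynomial.X j)

/-- The space of conformal sesquilinear maps `A^{⊗(n+1)} → A[x₀, …, x_{n-1}]`. For `n = 0` these
are the `k[∂]`-linear maps `A → A`. -/
def sesq (der : A →ₗ[k] A) (n : ℕ) :
    Submodule k (MultilinearMap k (fun _ : Fin (n + 1) => A) (LPoly k A n)) where
  carrier := {φ |
    (∀ (a : Fin (n + 1) → A) (i : Fin n),
      φ (Function.update a i.castSucc (der (a i.castSucc))) =
        -((MvPolynomial.X i : MvPolynomial (Fin n) k) • φ a)) ∧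
    (∀ a : Fin (n + 1) → A,
      φ (Function.update a (Fin.last n) (der (a (Fin.last n)))) =
        extDer der n (φ a) + (∑ i, MvPolynomial.X i : MvPolynomial (Fin n) k) • φ a)}
  zero_mem' := by simp
  add_mem' := by
    rintro φ ψ ⟨h₁, h₂⟩ ⟨h₃, h₄⟩
    refine ⟨fun a i => ?_, fun a => ?_⟩
    · simp only [add_apply, h₁, h₃, smul_add, neg_add]
    · simp only [add_apply, h₂, h₄, smul_add, map_add]; abel
  smul_mem' := by
    rintro c φ ⟨h₁, h₂⟩
    refine ⟨fun a i => ?_, fun a => ?_⟩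
    · simp only [smul_apply, h₁, smul_neg, smul_comm c]
    · simp only [smul_apply, h₂, smul_add, smul_comm c,
        LinearMap.map_smul_of_tower]

instance (der : A →ₗ[k] A) (n : ℕ) : AddCommGroup (sesq der n) :=
  Module.addCommMonoidToAddCommGroup k

lemma mem_sesq_iff (der : A →ₗ[k] A) {n : ℕ}
    {φ : MultilinearMap k (fun _ : Fin (n + 1) => A) (LPoly k A n)} :
    φ ∈ sesq der n ↔ ∀ (a : Fin (n + 1) → A) (j : Fin (n + 1)) (x : A),
      φ (Function.update a j (der x)) = -act der n (lam k n j) (φ (Function.update a j x)) := by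
  have e₁ : ∀ (w : LPoly k A n) (i : Fin n), act der n (lam k n i.castSucc) w =
      (MvPolynomial.X i : MvPolynomial (Fin n) k) • w := fun w i => by
    simp only [lam, Fin.val_castSucc, i.2, dif_pos, act_C, Fin.eta]
  have e₂ : ∀ w : LPoly k A n, -act der n (lam k n (Fin.last n)) w =
      extDer der n w + (∑ i, MvPolynomial.X i : MvPolynomial (Fin n) k) • w := fun w => by
    simp only [lam, Fin.val_last, lt_irrefl, dif_neg, not_false_eq_true, map_sub, map_neg,
      LinearMap.sub_apply, LinearMap.neg_apply, act_X, ← map_sum, act_C]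
    abel
  constructor
  · rintro ⟨h₁, h₂⟩ a j x
    induction j using Fin.lastCases with
    | last =>
      rw [e₂]
      simpa using h₂ (Function.update a (Fin.last n) x)
    | cast i =>
      rw [e₁]
      simpa using h₁ (Function.update a i.castSucc x) i
  · intro h
    refine ⟨fun a i => ?_, fun a => ?_⟩
    · rw [h, Function.update_eq_self, e₁]
    · rw [h, Function.update_eq_self, e₂]

lemma sum_lam (N : ℕ) : ∑ l ∈ Finset.range (N + 1), lam k N l = -Polynomial.X := by
  rw [Finset.sum_range_succ, Finset.sum_range]
  simp [lam]

lemma subst_sesq (der : A →ₗ[k] A) {m N : ℕ} {f : MultilinearMap k (fun _ => A) (LPoly k A m)}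
    (hf : f ∈ sesq der m) (r : ℕ → Param k N)
    (hr : ∑ l ∈ Finset.range (m + 1), r l = -Polynomial.X) (a : Fin (m + 1) → A)
    (j : Fin (m + 1)) (x : A) :
    substPoly der (fun l : Fin m => r l) (f (Function.update a j (der x))) =
      -act der N (r j) (substPoly der (fun l : Fin m => r l) (f (Function.update a j x))) := by
  induction j using Fin.lastCases with
  | last =>
    have := hf.2 (Function.update a (Fin.last m) x)
    simp only [Function.update_idem, Function.update_self] at this
    rw [this, map_add, subst_extDer, subst_smul]
    have hr' : r m = -Polynomial.X - ∑ l : Fin m, r l := by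
      rw [← hr, Finset.sum_range_succ, Finset.sum_range]; abel
    simp only [Fin.val_last, hr', map_sum, MvPolynomial.aeval_X, map_sub, map_neg,
      LinearMap.sub_apply, LinearMap.neg_apply]
    abel
  | cast i =>
    have := hf.1 (Function.update a i.castSucc x) i
    simp only [Function.update_idem, Function.update_self] at this
    rw [this, map_neg, subst_smul]
    simp

/-- For `u ∈ A[x₀, …, x_{N-1}]`, extended linearly over `k[x₀, …, x_{N-1}]`, the value
`f_{r₀, …, r_{m-1}}(e₀, …, e_{i-1}, u, e_{i+1}, …, e_m)`. -/
def insertAt (der : A →ₗ[k] A) {m N : ℕ} (f : MultilinearMap k (fun _ : Fin (m + 1) => A)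
    (LPoly k A m)) (r : Fin m → Param k N) (i : Fin (m + 1)) (e : Fin (m + 1) → A) :
    LPoly k A N →ₗ[MvPolynomial (Fin N) k] LPoly k A N :=
  LinearMap.liftBaseChange (MvPolynomial (Fin N) k) (substPoly der r ∘ₗ f.toLinearMap e i)

lemma insertAt_tmul (der : A →ₗ[k] A) {m N : ℕ} (f : MultilinearMap k (fun _ => A) (LPoly k A m))
    (r : Fin m → Param k N) (i : Fin (m + 1)) (e : Fin (m + 1) → A)
    (p : MvPolynomial (Fin N) k) (c : A) :
    insertAt der f r i e (p ⊗ₜ c) = p • substPoly der r (f (Function.update e i c)) := by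
  simp [insertAt]

lemma insertAt_congr (der : A →ₗ[k] A) {m N : ℕ} (f : MultilinearMap k (fun _ => A) (LPoly k A m))
    (r : Fin m → Param k N) (i : Fin (m + 1)) {e e' : Fin (m + 1) → A}
    (h : ∀ j, j ≠ i → e j = e' j) : insertAt der f r i e = insertAt der f r i e' := by
  have : ∀ c, Function.update e i c = Function.update e' i c := fun c => by
    funext j
    by_cases hj : j = i
    · subst hj; simp
    · simp [hj, h j hj]
  ext w
  simp [insertAt, this]

lemma insertAt_update_add (der : A →ₗ[k] A) {m N : ℕ}
    (f : MultilinearMap k (fun _ => A) (LPoly k A m))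
    (r : Fin m → Param k N) {i j : Fin (m + 1)} (hij : j ≠ i) (e : Fin (m + 1) → A) (x y : A)
    (w : LPoly k A N) :
    insertAt der f r i (Function.update e j (x + y)) w =
      insertAt der f r i (Function.update e j x) w +
        insertAt der f r i (Function.update e j y) w := by
  induction w using TensorProduct.induction_on with
  | zero => simp
  | add u v hu hv => simp only [map_add, hu, hv]; abel
  | tmul p c => simp only [insertAt_tmul, Function.update_comm hij, MultilinearMap.map_update_add,
      map_add, smul_add]

lemma insertAt_update_smul (der : A →ₗ[k] A) {m N : ℕ}
    (f : MultilinearMap k (fun _ => A) (LPoly k A m))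
    (r : Fin m → Param k N) {i j : Fin (m + 1)} (hij : j ≠ i) (e : Fin (m + 1) → A) (t : k) (x : A)
    (w : LPoly k A N) :
    insertAt der f r i (Function.update e j (t • x)) w =
      t • insertAt der f r i (Function.update e j x) w := by
  induction w using TensorProduct.induction_on with
  | zero => simp
  | add u v hu hv => simp only [map_add, hu, hv, smul_add]
  | tmul p c => simp only [insertAt_tmul, Function.update_comm hij, MultilinearMap.map_update_smul,
      map_smul, smul_comm t]

lemma act_smul (der : A →ₗ[k] A) {N : ℕ} (q : Param k N) (p : MvPolynomial (Fin N) k)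
    (w : LPoly k A N) : act der N q (p • w) = p • act der N q w := map_smul _ _ _

lemma insertAt_update_der (der : A →ₗ[k] A) {m N : ℕ}
    {f : MultilinearMap k (fun _ => A) (LPoly k A m)} (hf : f ∈ sesq der m) (r : ℕ → Param k N)
    (hr : ∑ l ∈ Finset.range (m + 1), r l = -Polynomial.X)
    {i j : Fin (m + 1)} (hij : j ≠ i) (e : Fin (m + 1) → A) (x : A)
    (w : LPoly k A N) :
    insertAt der f (fun l => r l) i (Function.update e j (der x)) w =
      -act der N (r j) (insertAt der f (fun l => r l) i (Function.update e j x) w) := by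
  induction w using TensorProduct.induction_on with
  | zero => simp
  | add u v hu hv => simp only [map_add, hu, hv]; abel
  | tmul p c =>
    simp only [insertAt_tmul, Function.update_comm hij, subst_sesq der hf r hr, act_smul, smul_neg]

lemma insertAt_extDer (der : A →ₗ[k] A) {m N : ℕ}
    {f : MultilinearMap k (fun _ => A) (LPoly k A m)} (hf : f ∈ sesq der m) (r : ℕ → Param k N)
    (hr : ∑ l ∈ Finset.range (m + 1), r l = -Polynomial.X)
    (i : Fin (m + 1)) (e : Fin (m + 1) → A) (w : LPoly k A N) :
    insertAt der f (fun l => r l) i e (extDer der N w) =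
      -act der N (r i) (insertAt der f (fun l => r l) i e w) := by
  induction w using TensorProduct.induction_on with
  | zero => simp
  | add u v hu hv => simp only [map_add, hu, hv]; abel
  | tmul p c =>
    simp only [extDer_tmul, insertAt_tmul, subst_sesq der hf r hr, act_smul, smul_neg]

/-- The parameters of an outer map whose slot `i` receives `n'` of the `N + 1` arguments:
`λ₀, …, λ_{i-1}, λ_i + ⋯ + λ_{i+n'-1}, λ_{i+n'}, …`, where `λ_l = lam k N l`. If `n' ≥ 1`, the outer
map only needs its first `m = N + 1 - n'` parameters, and these involve no `∂`. -/
def blockParam (k : Type*) [Field k] (N i n' j : ℕ) : Param k N :=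
  if j < i then lam k N j
  else if j = i then ∑ l ∈ Finset.range n', lam k N (i + l)
  else lam k N (j + n' - 1)

lemma sum_blockParam_aux (N i n' t : ℕ) :
    ∑ j ∈ Finset.range t, blockParam k N i n' j =
      if t ≤ i then ∑ l ∈ Finset.range t, lam k N l
      else ∑ l ∈ Finset.range (t + n' - 1), lam k N l := by
  induction t with
  | zero => simp
  | succ t ih =>
    rw [Finset.sum_range_succ, ih, blockParam]
    rcases lt_trichotomy t i with h | h | h
    · rw [if_pos h.le, if_pos h, if_pos (by omega), Finset.sum_range_succ]
    · subst h
      rw [if_pos le_rfl, if_neg (lt_irrefl _), if_pos rfl, if_neg (by omega),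
        show t + 1 + n' - 1 = t + n' by omega, Finset.sum_range_add]
    · rw [if_neg (by omega), if_neg (by omega), if_neg (by omega), if_neg (by omega),
        show t + 1 + n' - 1 = t + n' - 1 + 1 by omega, Finset.sum_range_succ]

lemma sum_blockParam {N m n' : ℕ} (h : m + n' = N + 1) (i : Fin (m + 1)) :
    ∑ j ∈ Finset.range (m + 1), blockParam k N i n' j = -Polynomial.X := by
  rw [sum_blockParam_aux, if_neg (by omega), show m + 1 + n' - 1 = N + 1 by omega, sum_lam]

/-- The arguments of the outer map: `a₀, …, a_{i-1}`, slot `i` (to be overwritten),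
`a_{i+n'}, …, a_N`. -/
def outerArgs {N m n' : ℕ} (h : m + n' = N + 1) (i : Fin (m + 1)) (a : Fin (N + 1) → A) :
    Fin (m + 1) → A :=
  fun j => a ⟨if (j : ℕ) < i then j else j + n' - 1, by split <;> omega⟩

/-- The arguments of the inner map: `a_i, …, a_{i+n'-1}`. -/
def innerArgs {N m n' : ℕ} (h : m + n' = N + 1) (i : Fin (m + 1)) (a : Fin (N + 1) → A) :
    Fin n' → A :=
  fun l => a ⟨i + l, by omega⟩

set_option linter.unusedSectionVars false in
lemma args_update {N m n' : ℕ} (h : m + n' = N + 1) (i : Fin (m + 1)) (a : Fin (N + 1) → A)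
    (s : Fin (N + 1)) :
    (∃ j : Fin (m + 1), j ≠ i ∧ blockParam k N i n' j = lam k N s ∧ ∀ x : A,
      (∀ j', j' ≠ i →
        outerArgs h i (Function.update a s x) j' = Function.update (outerArgs h i a) j x j') ∧
      innerArgs h i (Function.update a s x) = innerArgs h i a) ∨
    (∃ l : Fin n', (s : ℕ) = i + l ∧ ∀ x : A,
      (∀ j', j' ≠ i → outerArgs h i (Function.update a s x) j' = outerArgs h i a j') ∧
      innerArgs h i (Function.update a s x) = Function.update (innerArgs h i a) l x) := by
  by_cases h₁ : (s : ℕ) < i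
  · left
    refine ⟨⟨s, by omega⟩, by simp [Fin.ext_iff]; omega, by simp [blockParam, h₁],
      fun x => ⟨fun j' hj' => ?_, ?_⟩⟩
    · simp only [outerArgs, Function.update_apply, Fin.ext_iff]
      have : (j' : ℕ) ≠ i := fun hh => hj' (Fin.ext hh)
      congr 1
      split <;> simp <;> omega
    · funext l
      simp only [innerArgs, Function.update_apply, Fin.ext_iff]
      rw [if_neg (by omega)]
  · by_cases h₂ : (s : ℕ) < i + n'
    · right
      refine ⟨⟨s - i, by omega⟩, by simp; omega, fun x => ⟨fun j' hj' => ?_, ?_⟩⟩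
      · simp only [outerArgs, Function.update_apply, Fin.ext_iff]
        have : (j' : ℕ) ≠ i := fun hh => hj' (Fin.ext hh)
        rw [if_neg]
        split <;> omega
      · funext l
        simp only [innerArgs, Function.update_apply, Fin.ext_iff]
        congr 1
        simp; omega
    · left
      refine ⟨⟨s + 1 - n', by omega⟩, by simp [Fin.ext_iff]; omega, ?_,
        fun x => ⟨fun j' hj' => ?_, ?_⟩⟩
      · rw [blockParam, if_neg (by simp; omega), if_neg (by simp; omega)]
        simp only
        rw [show (s : ℕ) + 1 - n' + n' - 1 = s by omega]
      · simp only [outerArgs, Function.update_apply, Fin.ext_iff]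
        have : (j' : ℕ) ≠ i := fun hh => hj' (Fin.ext hh)
        congr 1
        split <;> simp <;> omega
      · funext l
        simp only [innerArgs, Function.update_apply, Fin.ext_iff]
        rw [if_neg (by omega)]

/-- The multilinear map `a ↦ f(a₀, …, a_{i-1}, G(a_i, …, a_{i+n'-1}), a_{i+n'}, …, a_N)`, the
parameters of `f` being given by `blockParam`. -/
def compAt (der : A →ₗ[k] A) {N m n' : ℕ} (h : m + n' = N + 1)
    (f : MultilinearMap k (fun _ : Fin (m + 1) => A) (LPoly k A m)) (i : Fin (m + 1))
    (G : MultilinearMap k (fun _ : Fin n' => A) (LPoly k A N)) :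
    MultilinearMap k (fun _ : Fin (N + 1) => A) (LPoly k A N) :=
  MultilinearMap.mk'
    (fun a => insertAt der f (fun j => blockParam k N i n' j) i (outerArgs h i a)
      (G (innerArgs h i a)))
    (fun a s x y => by
      rcases args_update (k := k) h i a s with ⟨j, hj, -, hx⟩ | ⟨l, -, hx⟩
      · rw [insertAt_congr _ _ _ _ (hx (x + y)).1, insertAt_congr _ _ _ _ (hx x).1,
          insertAt_congr _ _ _ _ (hx y).1, (hx (x + y)).2, (hx x).2, (hx y).2,
          insertAt_update_add _ _ _ hj]
      · rw [insertAt_congr _ _ _ _ (hx (x + y)).1, insertAt_congr _ _ _ _ (hx x).1,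
          insertAt_congr _ _ _ _ (hx y).1, (hx (x + y)).2, (hx x).2, (hx y).2,
          MultilinearMap.map_update_add, map_add])
    (fun a s t x => by
      rcases args_update (k := k) h i a s with ⟨j, hj, -, hx⟩ | ⟨l, -, hx⟩
      · rw [insertAt_congr _ _ _ _ (hx (t • x)).1, insertAt_congr _ _ _ _ (hx x).1,
          (hx (t • x)).2, (hx x).2, insertAt_update_smul _ _ _ hj]
      · rw [insertAt_congr _ _ _ _ (hx (t • x)).1, insertAt_congr _ _ _ _ (hx x).1,
          (hx (t • x)).2, (hx x).2, MultilinearMap.map_update_smul,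
          LinearMap.map_smul_of_tower])

lemma compAt_apply (der : A →ₗ[k] A) {N m n' : ℕ} (h : m + n' = N + 1)
    (f : MultilinearMap k (fun _ : Fin (m + 1) => A) (LPoly k A m)) (i : Fin (m + 1))
    (G : MultilinearMap k (fun _ : Fin n' => A) (LPoly k A N)) (a : Fin (N + 1) → A) :
    compAt der h f i G a = insertAt der f (fun j => blockParam k N i n' j) i (outerArgs h i a)
      (G (innerArgs h i a)) := rfl

lemma compAt_mem (der : A →ₗ[k] A) {N m n' : ℕ} (h : m + n' = N + 1)
    {f : MultilinearMap k (fun _ : Fin (m + 1) => A) (LPoly k A m)} (hf : f ∈ sesq der m)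
    (i : Fin (m + 1)) (G : MultilinearMap k (fun _ : Fin n' => A) (LPoly k A N))
    (hG : ∀ (e : Fin (m + 1) → A) (v : Fin n' → A) (l : Fin n') (x : A),
      insertAt der f (fun j => blockParam k N i n' j) i e (G (Function.update v l (der x))) =
        -act der N (lam k N (i + l))
          (insertAt der f (fun j => blockParam k N i n' j) i e (G (Function.update v l x)))) :
    compAt der h f i G ∈ sesq der N := by
  rw [mem_sesq_iff]
  intro a s x
  simp only [compAt_apply]
  rcases args_update (k := k) h i a s with ⟨j, hj, hs, hx⟩ | ⟨l, hs, hx⟩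
  · rw [insertAt_congr _ _ _ _ (hx (der x)).1, insertAt_congr _ _ _ _ (hx x).1,
      (hx (der x)).2, (hx x).2, insertAt_update_der der hf _ (sum_blockParam h i) hj,
      hs]
  · rw [insertAt_congr _ _ _ _ (hx (der x)).1, insertAt_congr _ _ _ _ (hx x).1,
      (hx (der x)).2, (hx x).2, hG, hs]

lemma lam_of_lt {N l : ℕ} (h : l < N) :
    lam k N l = Polynomial.C (MvPolynomial.X ⟨l, h⟩) := by simp [lam, h]

lemma subst_lam_mem (der : A →ₗ[k] A) {n N : ℕ}
    {g : MultilinearMap k (fun _ : Fin (n + 1) => A) (LPoly k A n)} (hg : g ∈ sesq der n) (i : ℕ)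
    (v : Fin (n + 1) → A) (l : Fin (n + 1)) (x : A) :
    substPoly der (fun l : Fin n => lam k N (i + l)) (g (Function.update v l (der x))) =
      if (l : ℕ) < n then
        -act der N (lam k N (i + l))
          (substPoly der (fun l : Fin n => lam k N (i + l)) (g (Function.update v l x)))
      else
        extDer der N (substPoly der (fun l : Fin n => lam k N (i + l)) (g (Function.update v l x))) +
        act der N (∑ l ∈ Finset.range n, lam k N (i + l))
          (substPoly der (fun l : Fin n => lam k N (i + l)) (g (Function.update v l x))) := by
  induction l using Fin.lastCases with
  | last =>
    have := hg.2 (Function.update v (Fin.last n) x)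
    simp only [Function.update_idem, Function.update_self] at this
    rw [this, map_add, subst_extDer, subst_smul, Finset.sum_range, act_X]
    simp
  | cast j =>
    have := hg.1 (Function.update v j.castSucc x) j
    simp only [Function.update_idem, Function.update_self] at this
    rw [this, map_neg, subst_smul]
    simp

/-- The map `A^{n+1} → A[x₀, …, x_{N-1}]`, `v ↦ g_{λ_i, …, λ_{i+n-1}}(v)`, where
`λ_l = lam k N l`, that is, `λ_l = x_l` for `l < N`. -/
def shiftMap (der : A →ₗ[k] A) {n : ℕ} (N i : ℕ)
    (g : MultilinearMap k (fun _ : Fin (n + 1) => A) (LPoly k A n)) :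
    MultilinearMap k (fun _ : Fin (n + 1) => A) (LPoly k A N) :=
  (substPoly der fun l : Fin n => lam k N (i + l)).compMultilinearMap g

lemma shiftMap_apply (der : A →ₗ[k] A) {n : ℕ} (N i : ℕ)
    (g : MultilinearMap k (fun _ : Fin (n + 1) => A) (LPoly k A n)) (v : Fin (n + 1) → A) :
    shiftMap der N i g v = substPoly der (fun l : Fin n => lam k N (i + l)) (g v) := rfl

/-- The partial composition `f •ᵢ g` of sesquilinear maps, `m + n = N`:
`(f •ᵢ g)_{λ₀, …, λ_{m+n-1}}(a₀, …, a_{m+n})` is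
`f_{λ₀, …, λ_{i-1}, λ_i + ⋯ + λ_{i+n}, λ_{i+n+1}, …}(a₀, …, a_{i-1},
g_{λ_i, …, λ_{i+n-1}}(a_i, …, a_{i+n}), a_{i+n+1}, …, a_{m+n})`. -/
def partialComp (der : A →ₗ[k] A) {m n N : ℕ} (h : m + (n + 1) = N + 1) (f : sesq der m)
    (g : sesq der n) (i : Fin (m + 1)) : sesq der N :=
  ⟨compAt der h f i (shiftMap der N i g), compAt_mem der h f.2 i _ fun e v l x => by
    have hC : ∀ (c : ℕ) (w : LPoly k A N), c < n →
        insertAt der f.1 (fun j => blockParam k N i (n + 1) j) i e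
            (act der N (lam k N (i + c)) w) =
          act der N (lam k N (i + c))
            (insertAt der f.1 (fun j => blockParam k N i (n + 1) j) i e w) := by
      intro c w hc
      rw [lam_of_lt (by omega), act_C, act_C, map_smul]
    rw [shiftMap_apply, shiftMap_apply, subst_lam_mem der g.2]
    split
    · next hl => rw [map_neg, hC _ _ hl]
    · next hl =>
      rw [map_add, insertAt_extDer der f.2 _ (sum_blockParam h i), map_sum,
        LinearMap.sum_apply, map_sum,
        Finset.sum_congr rfl fun c hc => hC c _ (Finset.mem_range.1 hc),
        ← LinearMap.sum_apply, ← map_sum]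
      rw [blockParam, if_neg (lt_irrefl _), if_pos rfl, Finset.sum_range_succ,
        show (l : ℕ) = n by omega, map_add, LinearMap.add_apply]
      abel⟩

/-- The space of `0`-cochains `A / ∂A`, where `A` is written as the space of polynomials in no
variables. -/
abbrev ZeroCochain (der : A →ₗ[k] A) :=
  LPoly k A 0 ⧸ LinearMap.range ((extDer der 0).restrictScalars k)

/-- The map `A → A[x₀, …, x_{N-1}]`, `b ↦ b`. -/
def constPoly (der : A →ₗ[k] A) (N : ℕ) : LPoly k A 0 →ₗ[k] LPoly k A N :=
  substPoly der fun l : Fin 0 => l.elim0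

lemma constPoly_extDer (der : A →ₗ[k] A) (N : ℕ) (b : LPoly k A 0) :
    constPoly der N (extDer der 0 b) = extDer der N (constPoly der N b) := by
  rw [constPoly, subst_extDer, act_X]

/-- The map `b ↦ f(…, b, …)` on representatives `b ∈ A`, see `insertZero`. -/
def insertZeroAux (der : A →ₗ[k] A) {m N : ℕ} (h : m + 0 = N + 1) (f : sesq der m)
    (i : Fin (m + 1)) : LPoly k A 0 →ₗ[k] sesq der N :=
  { toFun := fun b => ⟨compAt der h f i (MultilinearMap.constOfIsEmpty k _ (constPoly der N b)),
      compAt_mem der h f.2 i _ fun _ _ l => l.elim0⟩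
    map_add' := fun b b' => by ext a; simp [compAt_apply]
    map_smul' := fun c b => by ext a; simp [compAt_apply] }

/-- Insertion of `b ∈ A / ∂A` in the slot `i` of a sesquilinear map `f`, where `m = N + 1`:
`f_{λ₀, …, λ_{i-1}, 0, λ_i, …, λ_{N-1}}(a₀, …, a_{i-1}, b, a_i, …, a_N)` if `i < m`, and
`f_{λ₀, …, λ_{N-1}, -∂-λ₀-…-λ_{N-1}}(a₀, …, a_N, b)` if `i = m` is the last slot. -/
def insertZero (der : A →ₗ[k] A) {m N : ℕ} (h : m + 0 = N + 1) (f : sesq der m)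
    (i : Fin (m + 1)) : ZeroCochain der →ₗ[k] sesq der N :=
  Submodule.liftQ (LinearMap.range ((extDer der 0).restrictScalars k))
    (insertZeroAux der h f i)
    (by
      rintro _ ⟨b, rfl⟩
      refine LinearMap.mem_ker.2 (Subtype.ext (MultilinearMap.ext fun a => ?_))
      simp only [insertZeroAux, LinearMap.coe_mk, AddHom.coe_mk, compAt_apply, LinearMap.coe_restrictScalars,
        MultilinearMap.constOfIsEmpty_apply, Function.const_apply, constPoly_extDer]
      rw [insertAt_extDer der f.2 _ (sum_blockParam h i)]
      simp [blockParam])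

/-- The map `A / ∂A → A / ∂A`, `b ↦ f(b)`, for a `k[∂]`-linear map `f : A → A`. -/
def evalZero (der : A →ₗ[k] A) (f : sesq der 0) : ZeroCochain der →ₗ[k] ZeroCochain der :=
  Submodule.mapQ _ _
    ((insertAt der f.1 (fun l : Fin 0 => l.elim0) 0 (fun _ => 0)).restrictScalars k)
    (by
      rintro _ ⟨b, rfl⟩
      refine ⟨insertAt der f.1 (fun l : Fin 0 => l.elim0) 0 (fun _ => 0) b, ?_⟩
      have := insertAt_extDer der f.2 (N := 0) (fun _ => -Polynomial.X) (by simp) 0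
        (fun _ => 0) b
      simp only [map_neg, LinearMap.neg_apply, neg_neg, act_X] at this
      rw [show (fun l : Fin 0 => (l.elim0 : Param k 0)) = fun _ => -Polynomial.X from
        funext fun l => l.elim0]
      exact this.symm)

end Cochains

section Products

variable {k : Type*} [Field k] {A : Type*} [AddCommGroup A] [Module k A]
  (S : AssocConformalAlgebra k A)

lemma mulAt_extDer_left {N : ℕ} (r : Param k N) (u v : LPoly k A N) :
    S.mulAt r (extDer S.der N u) v = -act S.der N r (S.mulAt r u v) := by
  induction u using TensorProduct.induction_on with
  | zero => simp
  | add x y hx hy => simp only [map_add, LinearMap.add_apply, hx, hy]; abel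
  | tmul p a =>
    induction v using TensorProduct.induction_on with
    | zero => simp
    | add x y hx hy => simp only [map_add, hx, hy]; abel
    | tmul q b =>
      simp only [extDer_tmul, ConformalAlgebra.mulAt_tmul, S.mul_der_left, map_neg, subst_smul,
        MvPolynomial.aeval_X, act_smul, smul_neg]

lemma mulAt_extDer_right {N : ℕ} (r : Param k N) (u v : LPoly k A N) :
    S.mulAt r u (extDer S.der N v) =
      extDer S.der N (S.mulAt r u v) + act S.der N r (S.mulAt r u v) := by
  induction u using TensorProduct.induction_on with
  | zero => simp
  | add x y hx hy => simp only [map_add, LinearMap.add_apply, hx, hy]; abel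
  | tmul p a =>
    induction v using TensorProduct.induction_on with
    | zero => simp
    | add x y hx hy => simp only [map_add, hx, hy]; abel
    | tmul q b =>
      simp only [extDer_tmul, ConformalAlgebra.mulAt_tmul, S.mul_der_right, map_add, subst_smul,
        MvPolynomial.aeval_X, smul_add, subst_extDer, act_X, map_smul]

set_option linter.unusedSectionVars false in
lemma prod_args_update {m' n' N : ℕ} (h : m' + n' = N + 1) (a : Fin (N + 1) → A)
    (s : Fin (N + 1)) :
    (∃ l : Fin m', (s : ℕ) = l ∧ ∀ x,
      ((fun j : Fin m' => Function.update a s x ⟨j, by omega⟩) =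
        Function.update (fun j : Fin m' => a ⟨j, by omega⟩) l x) ∧
      ((fun j : Fin n' => Function.update a s x ⟨m' + j, by omega⟩) =
        fun j : Fin n' => a ⟨m' + j, by omega⟩)) ∨
    (∃ l : Fin n', (s : ℕ) = m' + l ∧ ∀ x,
      ((fun j : Fin m' => Function.update a s x ⟨j, by omega⟩) =
        (fun j : Fin m' => a ⟨j, by omega⟩)) ∧
      ((fun j : Fin n' => Function.update a s x ⟨m' + j, by omega⟩) =
        Function.update (fun j : Fin n' => a ⟨m' + j, by omega⟩) l x)) := by
  by_cases hs : (s : ℕ) < m'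
  · left
    refine ⟨⟨s, hs⟩, rfl, fun x => ⟨?_, ?_⟩⟩
    · funext j
      simp only [Function.update_apply, Fin.ext_iff]
    · funext j
      simp only [Function.update_apply, Fin.ext_iff]
      rw [if_neg (by omega)]
  · right
    refine ⟨⟨s - m', by omega⟩, by simp; omega, fun x => ⟨?_, ?_⟩⟩
    · funext j
      simp only [Function.update_apply, Fin.ext_iff]
      rw [if_neg (by omega)]
    · funext j
      simp only [Function.update_apply, Fin.ext_iff]
      congr 1
      simp; omega

/-- The multilinear map `a ↦ F(a₀, …, a_{m'-1})_r G(a_{m'}, …, a_N)`, where `m' + n' = N + 1` and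
`r = λ₀ + ⋯ + λ_{m'-1}`. Here `r = 0` if `m' = 0`, and `r = -∂` if `n' = 0`. -/
def prodAt {m' n' N : ℕ} (h : m' + n' = N + 1)
    (F : MultilinearMap k (fun _ : Fin m' => A) (LPoly k A N))
    (G : MultilinearMap k (fun _ : Fin n' => A) (LPoly k A N)) :
    MultilinearMap k (fun _ : Fin (N + 1) => A) (LPoly k A N) :=
  MultilinearMap.mk'
    (fun a => S.mulAt (∑ l ∈ Finset.range m', lam k N l)
      (F fun j => a ⟨j, by omega⟩) (G fun j => a ⟨m' + j, by omega⟩))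
    (fun a s x y => by
      rcases prod_args_update h a s with ⟨l, -, hx⟩ | ⟨l, -, hx⟩
      · simp only [(hx _).1, (hx _).2, MultilinearMap.map_update_add, map_add,
          LinearMap.add_apply]
      · simp only [(hx _).1, (hx _).2, MultilinearMap.map_update_add, map_add])
    (fun a s c x => by
      rcases prod_args_update h a s with ⟨l, -, hx⟩ | ⟨l, -, hx⟩
      · simp only [(hx _).1, (hx _).2, MultilinearMap.map_update_smul,
          LinearMap.map_smul_of_tower, LinearMap.smul_apply]
      · simp only [(hx _).1, (hx _).2, MultilinearMap.map_update_smul,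
          LinearMap.map_smul_of_tower])

lemma prodAt_apply {m' n' N : ℕ} (h : m' + n' = N + 1)
    (F : MultilinearMap k (fun _ : Fin m' => A) (LPoly k A N))
    (G : MultilinearMap k (fun _ : Fin n' => A) (LPoly k A N)) (a : Fin (N + 1) → A) :
    prodAt S h F G a = S.mulAt (∑ l ∈ Finset.range m', lam k N l)
      (F fun j => a ⟨j, by omega⟩) (G fun j => a ⟨m' + j, by omega⟩) := rfl

lemma prodAt_mem {m' n' N : ℕ} (h : m' + n' = N + 1)
    (F : MultilinearMap k (fun _ : Fin m' => A) (LPoly k A N))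
    (G : MultilinearMap k (fun _ : Fin n' => A) (LPoly k A N))
    (hF : ∀ v l x w, S.mulAt (∑ l ∈ Finset.range m', lam k N l)
        (F (Function.update v l (S.der x))) w =
      -act S.der N (lam k N l) (S.mulAt (∑ l ∈ Finset.range m', lam k N l)
        (F (Function.update v l x)) w))
    (hG : ∀ u v l x, S.mulAt (∑ l ∈ Finset.range m', lam k N l) u
        (G (Function.update v l (S.der x))) =
      -act S.der N (lam k N (m' + l)) (S.mulAt (∑ l ∈ Finset.range m', lam k N l) u
        (G (Function.update v l x)))) :
    prodAt S h F G ∈ sesq S.der N := by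
  rw [mem_sesq_iff]
  intro a s x
  simp only [prodAt_apply]
  rcases prod_args_update h a s with ⟨l, hs, hx⟩ | ⟨l, hs, hx⟩
  · rw [(hx _).1, (hx _).2, (hx _).1, (hx _).2, hF, hs]
  · rw [(hx _).1, (hx _).2, (hx _).1, (hx _).2, hG, hs]

lemma mulAt_shift_left {m N : ℕ} (hm : m ≤ N) {f : MultilinearMap k (fun _ => A) (LPoly k A m)}
    (hf : f ∈ sesq S.der m) (v : Fin (m + 1) → A) (l : Fin (m + 1)) (x : A) (w : LPoly k A N) :
    S.mulAt (∑ l ∈ Finset.range (m + 1), lam k N l)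
        (shiftMap S.der N 0 f (Function.update v l (S.der x))) w =
      -act S.der N (lam k N l) (S.mulAt (∑ l ∈ Finset.range (m + 1), lam k N l)
        (shiftMap S.der N 0 f (Function.update v l x)) w) := by
  obtain ⟨r, hr⟩ : ∃ r, r = ∑ l ∈ Finset.range (m + 1), lam k N l := ⟨_, rfl⟩
  rw [← hr]
  have hC : ∀ (c : ℕ) (u : LPoly k A N), c < m →
      S.mulAt r (act S.der N (lam k N (0 + c)) u) w =
        act S.der N (lam k N (0 + c)) (S.mulAt r u w) := by
    intro c u hc
    rw [lam_of_lt (by omega), act_C, act_C, map_smul, LinearMap.smul_apply]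
  have hs : ∀ u : LPoly k A N,
      S.mulAt r (act S.der N (∑ l ∈ Finset.range m, lam k N (0 + l)) u) w =
        act S.der N (∑ l ∈ Finset.range m, lam k N (0 + l)) (S.mulAt r u w) := fun u => by
    simp only [map_sum, LinearMap.sum_apply]
    exact Finset.sum_congr rfl fun c hc => hC c _ (Finset.mem_range.1 hc)
  rw [shiftMap_apply, shiftMap_apply, subst_lam_mem S.der hf]
  split
  · next hl => rw [map_neg, LinearMap.neg_apply, hC _ _ hl, zero_add]
  · next hl =>
    rw [map_add, LinearMap.add_apply, mulAt_extDer_left, hs, show (l : ℕ) = m by omega]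
    simp only [zero_add]
    rw [show lam k N m = r - ∑ l ∈ Finset.range m, lam k N l by
      rw [hr, Finset.sum_range_succ]; abel, map_sub, LinearMap.sub_apply]
    abel

lemma mulAt_shift_right {m' n N : ℕ} (h : m' + n = N)
    {g : MultilinearMap k (fun _ => A) (LPoly k A n)}
    (hg : g ∈ sesq S.der n) (u : LPoly k A N) (v : Fin (n + 1) → A) (l : Fin (n + 1)) (x : A) :
    S.mulAt (∑ l ∈ Finset.range m', lam k N l) u
        (shiftMap S.der N m' g (Function.update v l (S.der x))) =
      -act S.der N (lam k N (m' + l)) (S.mulAt (∑ l ∈ Finset.range m', lam k N l) u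
        (shiftMap S.der N m' g (Function.update v l x))) := by
  obtain ⟨r, hr⟩ : ∃ r, r = ∑ l ∈ Finset.range m', lam k N l := ⟨_, rfl⟩
  rw [← hr]
  have hC : ∀ (c : ℕ) (w : LPoly k A N), c < n →
      S.mulAt r u (act S.der N (lam k N (m' + c)) w) =
        act S.der N (lam k N (m' + c)) (S.mulAt r u w) := by
    intro c w hc
    rw [lam_of_lt (by omega), act_C, act_C, map_smul]
  have hs : ∀ w : LPoly k A N,
      S.mulAt r u (act S.der N (∑ l ∈ Finset.range n, lam k N (m' + l)) w) =
        act S.der N (∑ l ∈ Finset.range n, lam k N (m' + l)) (S.mulAt r u w) := fun w => by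
    simp only [map_sum, LinearMap.sum_apply]
    exact Finset.sum_congr rfl fun c hc => hC c _ (Finset.mem_range.1 hc)
  rw [shiftMap_apply, shiftMap_apply, subst_lam_mem S.der hg]
  split
  · next hl => rw [map_neg, hC _ _ hl]
  · next hl =>
    rw [map_add, mulAt_extDer_right, hs, show (l : ℕ) = n by omega]
    have : (Polynomial.X : Param k N) = -(r + ∑ l ∈ Finset.range n, lam k N (m' + l) +
        lam k N (m' + n)) := by
      rw [hr, ← Finset.sum_range_add, ← Finset.sum_range_succ, h, sum_lam, neg_neg]
    rw [← act_X, this, map_neg, map_add, map_add]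
    simp only [LinearMap.neg_apply, LinearMap.add_apply]
    abel

/-- The cup product of sesquilinear maps, `m + n + 1 = N`:
`(f ⊔ g)(a₀, …, a_N) = f_{λ₀, …, λ_{m-1}}(a₀, …, a_m)_{λ₀ + ⋯ + λ_m}
g_{λ_{m+1}, …, λ_{N-1}}(a_{m+1}, …, a_N)`. -/
def cupSesq {m n N : ℕ} (h : (m + 1) + (n + 1) = N + 1) (f : sesq S.der m) (g : sesq S.der n) :
    sesq S.der N :=
  ⟨prodAt S h (shiftMap S.der N 0 f) (shiftMap S.der N (m + 1) g),
    prodAt_mem S h _ _ (mulAt_shift_left S (by omega) f.2) (mulAt_shift_right S (by omega) g.2)⟩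

/-- The map `b ↦ f ⊔ b` on representatives `b ∈ A`, see `cupRight`. -/
def cupRightAux {m N : ℕ} (h : (m + 1) + 0 = N + 1) (f : sesq S.der m) :
    LPoly k A 0 →ₗ[k] sesq S.der N :=
  { toFun := fun b => ⟨prodAt S h (shiftMap S.der N 0 f)
        (MultilinearMap.constOfIsEmpty k _ (constPoly S.der N b)),
      prodAt_mem S h _ _ (mulAt_shift_left S (by omega) f.2) fun _ _ l => l.elim0⟩
    map_add' := fun b b' => by ext a; simp [prodAt_apply]
    map_smul' := fun c b => by
      ext a
      simp [prodAt_apply, LinearMap.map_smul_of_tower] }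

/-- The cup product `(f ⊔ b)(a₀, …, a_m) = f_{λ₀, …, λ_{m-1}}(a₀, …, a_m)_{-∂} b` of a
sesquilinear map and an element of `A / ∂A`. -/
def cupRight {m N : ℕ} (h : (m + 1) + 0 = N + 1) (f : sesq S.der m) :
    ZeroCochain S.der →ₗ[k] sesq S.der N :=
  Submodule.liftQ (LinearMap.range ((extDer S.der 0).restrictScalars k))
    (cupRightAux S h f)
    (by
      rintro _ ⟨b, rfl⟩
      refine LinearMap.mem_ker.2 (Subtype.ext (MultilinearMap.ext fun a => ?_))
      simp only [cupRightAux, LinearMap.coe_mk, AddHom.coe_mk, prodAt_apply, LinearMap.coe_restrictScalars,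
        MultilinearMap.constOfIsEmpty_apply, Function.const_apply, constPoly_extDer]
      obtain rfl : m = N := by omega
      rw [mulAt_extDer_right, sum_lam, ← act_X, map_neg]
      simp)

/-- The map `b ↦ b ⊔ g` on representatives `b ∈ A`, see `cupLeft`. -/
def cupLeftAux {n N : ℕ} (h : 0 + (n + 1) = N + 1) (g : sesq S.der n) :
    LPoly k A 0 →ₗ[k] sesq S.der N :=
  { toFun := fun b => ⟨prodAt S h (MultilinearMap.constOfIsEmpty k _ (constPoly S.der N b))
        (shiftMap S.der N 0 g),
      prodAt_mem S h _ _ (fun _ l => l.elim0) (mulAt_shift_right S (by omega) g.2)⟩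
    map_add' := fun b b' => by ext a; simp [prodAt_apply]
    map_smul' := fun c b => by
      ext a
      simp [prodAt_apply, LinearMap.map_smul_of_tower] }

/-- The cup product `(b ⊔ g)(a₀, …, a_n) = b_0 g_{λ₀, …, λ_{n-1}}(a₀, …, a_n)` of an element of
`A / ∂A` and a sesquilinear map. -/
def cupLeft {n N : ℕ} (h : 0 + (n + 1) = N + 1) (g : sesq S.der n) :
    ZeroCochain S.der →ₗ[k] sesq S.der N :=
  Submodule.liftQ (LinearMap.range ((extDer S.der 0).restrictScalars k))
    (cupLeftAux S h g)
    (by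
      rintro _ ⟨b, rfl⟩
      refine LinearMap.mem_ker.2 (Subtype.ext (MultilinearMap.ext fun a => ?_))
      simp only [cupLeftAux, LinearMap.coe_mk, AddHom.coe_mk, prodAt_apply, LinearMap.coe_restrictScalars,
        MultilinearMap.constOfIsEmpty_apply, Function.const_apply, constPoly_extDer]
      rw [mulAt_extDer_left]
      simp)

/-- The cup product `b ⊔ b' = b_0 b'` of two elements of `A / ∂A`. -/
def cupZero : ZeroCochain S.der →ₗ[k] ZeroCochain S.der →ₗ[k] ZeroCochain S.der :=
  Submodule.liftQ (LinearMap.range ((extDer S.der 0).restrictScalars k))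
    { toFun := fun b => Submodule.mapQ _ _
        ((S.mulAt (n := 0) 0 b).restrictScalars k) (by
          rintro _ ⟨b', rfl⟩
          refine ⟨S.mulAt 0 b b', ?_⟩
          simp [mulAt_extDer_right])
      map_add' := fun b b' => by ext; simp
      map_smul' := fun c b => by ext; simp [LinearMap.map_smul_of_tower] }
    (by
      rintro _ ⟨b, rfl⟩
      rw [LinearMap.mem_ker]
      ext b'
      simp [mulAt_extDer_left])

/-- The identity map of `A`, as a `1`-cochain. -/
def idSesq (der : A →ₗ[k] A) : sesq der 0 :=
  ⟨MultilinearMap.ofSubsingleton k A _ (0 : Fin 1) (TensorProduct.mk k _ A 1),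
    fun _ i => i.elim0, fun a => by simp⟩

/-- The `λ`-product of `A`, as a `2`-cochain. -/
def mulSesq : sesq S.der 1 :=
  ⟨MultilinearMap.mk' (fun a : Fin 2 → A => S.mul (a 0) (a 1))
    (fun a i x y => by fin_cases i <;> simp) (fun a i c x => by fin_cases i <;> simp),
    fun a i => by
      fin_cases i
      simpa using S.mul_der_left (a 0) (a 1),
    fun a => by simpa using S.mul_der_right (a 0) (a 1)⟩

lemma insertAt_add_left (der : A →ₗ[k] A) {m N : ℕ}
    (f g : MultilinearMap k (fun _ : Fin (m + 1) => A) (LPoly k A m)) (r : Fin m → Param k N)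
    (i : Fin (m + 1)) (e : Fin (m + 1) → A) (w : LPoly k A N) :
    insertAt der (f + g) r i e w = insertAt der f r i e w + insertAt der g r i e w := by
  induction w using TensorProduct.induction_on with
  | zero => simp
  | add u v hu hv => simp only [map_add, hu, hv]; abel
  | tmul p c => simp only [insertAt_tmul, add_apply, map_add, smul_add]

lemma insertAt_smul_left (der : A →ₗ[k] A) {m N : ℕ} (t : k)
    (f : MultilinearMap k (fun _ : Fin (m + 1) => A) (LPoly k A m)) (r : Fin m → Param k N)
    (i : Fin (m + 1)) (e : Fin (m + 1) → A) (w : LPoly k A N) :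
    insertAt der (t • f) r i e w = t • insertAt der f r i e w := by
  induction w using TensorProduct.induction_on with
  | zero => simp
  | add u v hu hv => simp only [map_add, hu, hv, smul_add]
  | tmul p c => simp only [insertAt_tmul, smul_apply, map_smul, smul_comm t]

lemma partialComp_add_left (der : A →ₗ[k] A) {m n N : ℕ} (h : m + (n + 1) = N + 1)
    (f f' : sesq der m) (g : sesq der n) (i : Fin (m + 1)) :
    partialComp der h (f + f') g i = partialComp der h f g i + partialComp der h f' g i := by
  refine Subtype.ext (MultilinearMap.ext fun a => ?_)
  simp [partialComp, compAt_apply, insertAt_add_left]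

lemma partialComp_smul_left (der : A →ₗ[k] A) {m n N : ℕ} (h : m + (n + 1) = N + 1) (t : k)
    (f : sesq der m) (g : sesq der n) (i : Fin (m + 1)) :
    partialComp der h (t • f) g i = t • partialComp der h f g i := by
  refine Subtype.ext (MultilinearMap.ext fun a => ?_)
  simp [partialComp, compAt_apply, insertAt_smul_left]

lemma cupSesq_add_left {m n N : ℕ} (h : (m + 1) + (n + 1) = N + 1) (f f' : sesq S.der m)
    (g : sesq S.der n) : cupSesq S h (f + f') g = cupSesq S h f g + cupSesq S h f' g := by
  refine Subtype.ext (MultilinearMap.ext fun a => ?_)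
  simp [cupSesq, prodAt_apply, shiftMap_apply]

lemma cupSesq_add_right {m n N : ℕ} (h : (m + 1) + (n + 1) = N + 1) (f : sesq S.der m)
    (g g' : sesq S.der n) : cupSesq S h f (g + g') = cupSesq S h f g + cupSesq S h f g' := by
  refine Subtype.ext (MultilinearMap.ext fun a => ?_)
  simp [cupSesq, prodAt_apply, shiftMap_apply]

lemma cupSesq_smul_left {m n N : ℕ} (h : (m + 1) + (n + 1) = N + 1) (t : k) (f : sesq S.der m)
    (g : sesq S.der n) : cupSesq S h (t • f) g = t • cupSesq S h f g := by
  refine Subtype.ext (MultilinearMap.ext fun a => ?_)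
  simp [cupSesq, prodAt_apply, shiftMap_apply, LinearMap.map_smul_of_tower]

lemma cupSesq_smul_right {m n N : ℕ} (h : (m + 1) + (n + 1) = N + 1) (t : k) (f : sesq S.der m)
    (g : sesq S.der n) : cupSesq S h f (t • g) = t • cupSesq S h f g := by
  refine Subtype.ext (MultilinearMap.ext fun a => ?_)
  simp [cupSesq, prodAt_apply, shiftMap_apply, LinearMap.map_smul_of_tower]

end Products

universe u v

section Complex

variable {k : Type u} [Field k] {A : Type v} [AddCommGroup A] [Module k A]

/-- The space `Cⁿ(A, A)` of `n`-cochains of the Hochschild complex: `C⁰ = A / ∂A`, and, for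
`n ≥ 1`, `Cⁿ` is the space of conformal sesquilinear maps `A^{⊗n} → A[x₀, …, x_{n-2}]`. -/
def Cochain (der : A →ₗ[k] A) : ℕ → Type (max u v)
  | 0 => ZeroCochain der
  | n + 1 => sesq der n

instance (der : A →ₗ[k] A) : (n : ℕ) → AddCommGroup (Cochain der n)
  | 0 => inferInstanceAs (AddCommGroup (ZeroCochain der))
  | n + 1 => inferInstanceAs (AddCommGroup (sesq der n))

instance (der : A →ₗ[k] A) : (n : ℕ) → Module k (Cochain der n)
  | 0 => inferInstanceAs (Module k (ZeroCochain der))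
  | n + 1 => inferInstanceAs (Module k (sesq der n))

variable (S : AssocConformalAlgebra k A)

/-- `d₀(b)(a) = a_{-∂} b - b_0 a`. -/
def dZero : ZeroCochain S.der →ₗ[k] sesq S.der 0 :=
  cupRight S (m := 0) (N := 0) rfl (idSesq S.der) - cupLeft S (n := 0) (N := 0) rfl (idSesq S.der)

/-- The differential of a sesquilinear map in `n + 1` arguments:
`a₀_{λ₀} f(a₁, …, a_{n+1}) + ∑ᵢ (-1)^{i+1} f(a₀, …, a_i_{λ_i} a_{i+1}, …, a_{n+1})
+ (-1)^{n+2} f(a₀, …, a_n)_{λ₀ + ⋯ + λ_n} a_{n+1}`; the first term is `id ⊔ f`, the last one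
`f ⊔ id`, and the term number `i` of the sum is `f •ᵢ ρ`, where `ρ` is the `λ`-product. -/
def dSesq (n : ℕ) : sesq S.der n →ₗ[k] sesq S.der (n + 1) where
  toFun f := cupSesq S (by omega : (0 + 1) + (n + 1) = (n + 1) + 1) (idSesq S.der) f +
    ∑ i : Fin (n + 1), (-1 : k) ^ ((i : ℕ) + 1) •
      partialComp S.der (rfl : n + (1 + 1) = (n + 1) + 1) f (mulSesq S) i +
    (-1 : k) ^ (n + 2) • cupSesq S (by omega : (n + 1) + (0 + 1) = (n + 1) + 1) f (idSesq S.der)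
  map_add' f g := by
    simp only [cupSesq_add_left, cupSesq_add_right, partialComp_add_left, smul_add,
      Finset.sum_add_distrib]
    abel
  map_smul' t f := by
    simp only [cupSesq_smul_left, cupSesq_smul_right, partialComp_smul_left, smul_add,
      Finset.smul_sum, RingHom.id_apply, smul_comm t]

/-- The Hochschild differential `Cⁿ(A, A) → Cⁿ⁺¹(A, A)`. -/
def d : (n : ℕ) → Cochain S.der n →ₗ[k] Cochain S.der (n + 1)
  | 0 =>
    { toFun := dZero S
      map_add' := (dZero S).map_add
      map_smul' := (dZero S).map_smul }
  | n + 1 =>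
    { toFun := dSesq S n
      map_add' := (dSesq S n).map_add
      map_smul' := (dSesq S n).map_smul }

/-- The `n`-cocycles. -/
def cocycles (n : ℕ) : Submodule k (Cochain S.der n) := LinearMap.ker (d S n)

/-- The `n`-coboundaries. -/
def coboundaries : (n : ℕ) → Submodule k (Cochain S.der n)
  | 0 => ⊥
  | n + 1 => LinearMap.range (d S n)

/-- The Hochschild cohomology `HHⁿ(A)`: cocycles modulo coboundaries. -/
abbrev HH (n : ℕ) := cocycles S n ⧸ (coboundaries S n).submoduleOf (cocycles S n)

/-- The cup product `Cᵐ × Cⁿ → C^N`, `m + n = N`. -/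
def cup : {m n N : ℕ} → m + n = N → Cochain S.der m → Cochain S.der n → Cochain S.der N
  | 0, 0, 0, _, b, b' => cupZero S b b'
  | 0, _ + 1, _ + 1, h, b, g => cupLeft S h g b
  | _ + 1, 0, _ + 1, h, f, b => cupRight S h f b
  | _ + 1, _ + 1, _ + 1, h, f, g => cupSesq S h f g

/-- The pre-Lie product `f • g` on cochains, `Cᵐ × Cⁿ → C^N`, `m + n = N + 1`: it is
`∑ᵢ (-1)^{(n-1) i} f •ᵢ g`, the sum being over the slots `i = 0, …, m - 1` of `f`. If `g = b` is a
`0`-cochain, then `f •ᵢ b` is the insertion of `b` in the slot `i`; it is `0` if `f` is a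
`0`-cochain. -/
def circ : {m n N : ℕ} → m + n = N + 1 → Cochain S.der m → Cochain S.der n → Cochain S.der N
  | 0, _, _, _, _, _ => 0
  | m + 1, 0, 0, h, f, b =>
    match m, h, f with
    | 0, _, f => evalZero S.der f b
    | _ + 1, h, _ => absurd h (by omega)
  | m + 1, 0, _ + 1, h, f, b =>
    show sesq S.der _ from
      ∑ i : Fin (m + 1), (-1 : k) ^ (i : ℕ) • insertZero S.der (by omega) f i b
  | _ + 1, _ + 1, 0, h, _, _ => absurd h (by omega)
  | m + 1, n + 1, _ + 1, h, f, g =>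
    show sesq S.der _ from
      ∑ i : Fin (m + 1), (-1 : k) ^ (n * (i : ℕ)) • partialComp S.der (by omega) f g i

/-- The bracket `[f, g] = f • g - (-1)^{(m-1)(n-1)} g • f`, `Cᵐ × Cⁿ → C^N`, where `m + n = N + 1`.
(For `m = n = 0`, the bracket takes its values in degree `-1`, that is, it is zero.) -/
def bracket {m n N : ℕ} (h : m + n = N + 1) (f : Cochain S.der m) (g : Cochain S.der n) :
    Cochain S.der N :=
  circ S h f g -
    (((m : ℤ) - 1) * ((n : ℤ) - 1)).negOnePow • circ S ((add_comm n m).trans h) g f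

/-- The total Hochschild cohomology `⨁ₙ HHⁿ(A)`. -/
abbrev TotalHH := ⨁ n, HH S n

/-- The component of degree `i ∈ ℤ` of the total cohomology; it is zero for `i < 0`. -/
def TotalHH.degree : ℤ → Submodule k (TotalHH S)
  | Int.ofNat n => LinearMap.range (DirectSum.lof k ℕ (HH S) n)
  | Int.negSucc _ => ⊥

/-- The class in the total cohomology of an `n`-cocycle. -/
def TotalHH.mk {n : ℕ} (f : cocycles S n) : TotalHH S :=
  DirectSum.lof k ℕ (HH S) n (Submodule.Quotient.mk f)

end Complex

/-- A Gerstenhaber algebra `G = ⨁ᵢ 𝒢 i`, `i ∈ ℤ`: a graded commutative associative product together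
with a graded Lie bracket of degree `-1`, which satisfy the graded Leibniz rule. -/
structure IsGerstenhaberAlgebra {k G : Type*} [Field k] [AddCommGroup G] [Module k G]
    (𝒢 : ℤ → Submodule k G) (mul bracket : G →ₗ[k] G →ₗ[k] G) : Prop where
  isInternal : DirectSum.IsInternal 𝒢
  mul_mem : ∀ {i j : ℤ} {a b : G}, a ∈ 𝒢 i → b ∈ 𝒢 j → mul a b ∈ 𝒢 (i + j)
  mul_assoc : ∀ a b c : G, mul (mul a b) c = mul a (mul b c)
  mul_comm : ∀ {i j : ℤ} {a b : G}, a ∈ 𝒢 i → b ∈ 𝒢 j → mul a b = (i * j).negOnePow • mul b a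
  bracket_mem : ∀ {i j : ℤ} {a b : G}, a ∈ 𝒢 i → b ∈ 𝒢 j → bracket a b ∈ 𝒢 (i + j - 1)
  bracket_skew : ∀ {i j : ℤ} {a b : G}, a ∈ 𝒢 i → b ∈ 𝒢 j →
    bracket a b = -(((i - 1) * (j - 1)).negOnePow • bracket b a)
  jacobi : ∀ {i j l : ℤ} {a b c : G}, a ∈ 𝒢 i → b ∈ 𝒢 j → c ∈ 𝒢 l →
    bracket a (bracket b c) =
      bracket (bracket a b) c + ((i - 1) * (j - 1)).negOnePow • bracket b (bracket a c)
  leibniz : ∀ {i j l : ℤ} {a b c : G}, a ∈ 𝒢 i → b ∈ 𝒢 j → c ∈ 𝒢 l →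
    bracket (mul a b) c = mul (bracket a c) b + ((l - 1) * i).negOnePow • mul a (bracket b c)

end

end ConformalHochschild

/-!
# The Gerstenhaber algebra structure on the cohomology of an associative conformal algebra

For an associative algebra, every required identity follows from formal properties of the
insertions `f ∘ᵢ g` of multilinear maps into each other: insertions into different slots commute,
nested insertions compose, and the multiplication `μ` satisfies `μ ∘₀ μ = μ ∘₁ μ`. The pre-Lie
product `f • g` is the signed sum of the insertions, its antisymmetrization is the bracket, the
differential is `-[-, μ]`, and the cup product is `μ(f, g)`. The associator of `•` is graded
symmetric (`preLie_assoc`), whence the Jacobi identity (`gBracket_jacobi`); for `μ` it gives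
`d² = 0` (`gBracket_gBracket_mul`). The bracket with `μ` is a derivation of the cup product
(`gBracket_opCup`), and on cocycles the commutativity of the cup product and the Leibniz rule hold
up to the coboundaries of `f • g` (`gBracket_preLie`) and of the brace `h{f, g}`
(`gBracket_brace`). The last two use the compatibility of braces with the pre-Lie product
(`brace_preLie`, `preLie_brace`).

Conformal cochains are not multilinear maps on `A`, because they carry parameters which have to be
substituted under every insertion. They become multilinear maps on a larger module. Let `K` be a
commutative `k`-algebra, and let `EvSum` be the direct sum over `s ∈ K` of the quotients
`(K ⊗ A) / (∂ + s)`; an element of the summand `s` is said to have colour `s`. A cochain `f` with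
`n` arguments defines a `K`-multilinear operation on `EvSum` which takes generators `a₁, …, a_n` of
colours `γ₁, …, γ_n` to the class of the value of `f` at `λ_j = γ_j`, in the colour
`γ₁ + ⋯ + γ_n` (`sesqOper`, `toOper`). The sesquilinearity of `f` is what makes this well defined;
the last argument is no exception, since `∂` acts on the target as `-(γ₁ + ⋯ + γ_n)`, so that the
missing parameter `-∂ - λ₁ - ⋯ - λ_{n-1}` takes the value `γ_n`. An element of `A / ∂A` is a
constant of colour `0`, so cochains of degree `0` need no separate treatment. The parameter
substitutions become the rule that colours add up: conformal insertions, cup products, brackets and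
differentials turn into the plain ones (`sesqOper_partialComp`, `toOper_cup`, `toOper_bracket`,
`toOper_d`), and the conformal associativity of `A` into that of `μ` (`mulOper_assoc`). For
`K = k[X₀, X₁, …]`, nothing is lost (`toOper_injective`): in the value at `λ_j = X_j`, the variables
can be replaced by the parameters again.

Operations are functions of infinite sequences, so their arities do not enter the types. The arity
`m + n - 1` of a bracket is truncated for `m = n = 0`, but the bracket is zero then; signs and
degrees have to be compared for nonzero operations only (`neg_one_pow_smul_congr`, `IsRep.cast`).

The relation `IsRep n x ξ` between an operation `x` and the cohomology class `ξ` of its cocycle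
carries the identities from operations to cohomology (`isGerstenhaberAlgebra`).
-/

namespace ConformalHochschild

noncomputable section

universe u v

/-! ### Insertions of operations into each other -/

section Insertion

variable {L : Type*}

/-- The argument sequence `a₀, …, a_{i-1}, x, a_{i+n}, a_{i+n+1}, …`, in which the block of the `n`
entries `a_i, …, a_{i+n-1}` is replaced by the single entry `x`. For `n = 0`, the entry `x` is
inserted in front of `a_i`. -/
def insArgs (n i : ℕ) (x : L) (a : ℕ → L) (j : ℕ) : L :=
  if j < i then a j else if j = i then x else a (j + n - 1)

/-- The insertion `f ∘ᵢ g` of an operation `g` with `n` arguments into the slot `i` of `f`.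
Operations are functions of infinite sequences of arguments, so that their arities do not appear in
their types. -/
def ins (n : ℕ) (f : (ℕ → L) → L) (i : ℕ) (g : (ℕ → L) → L) : (ℕ → L) → L :=
  fun a => f (insArgs n i (g fun l => a (i + l)) a)

lemma ins_apply (n : ℕ) (f : (ℕ → L) → L) (i : ℕ) (g : (ℕ → L) → L) (a : ℕ → L) :
    ins n f i g a = f (insArgs n i (g fun l => a (i + l)) a) := rfl

lemma insArgs_of_lt {n i j : ℕ} (h : j < i) (x : L) (a : ℕ → L) : insArgs n i x a j = a j := by
  simp [insArgs, h]

lemma insArgs_self (n i : ℕ) (x : L) (a : ℕ → L) : insArgs n i x a i = x := by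
  simp [insArgs]

lemma insArgs_of_gt {n i j : ℕ} (h : i < j) (x : L) (a : ℕ → L) :
    insArgs n i x a j = a (j + n - 1) := by
  rw [insArgs, if_neg (by omega), if_neg (by omega)]

lemma insArgs_eq_update (n i : ℕ) (x y : L) (a : ℕ → L) :
    insArgs n i x a = Function.update (insArgs n i y a) i x := by
  funext j
  by_cases hj : j = i
  · subst hj; simp [insArgs]
  · simp [insArgs, hj]

lemma insArgs_update_of_lt {n i s : ℕ} (h : s < i) (x y : L) (a : ℕ → L) :
    insArgs n i x (Function.update a s y) = Function.update (insArgs n i x a) s y := by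
  funext j
  simp only [insArgs, Function.update_apply]
  split_ifs <;> first | rfl | omega

/-- An argument behind the block of `n` entries is shifted by `n - 1` places, since the block
shrinks to one entry. -/
lemma insArgs_update_of_ge {n i s : ℕ} (h : i + n ≤ s) (x y : L) (a : ℕ → L) :
    insArgs n i x (Function.update a s y) =
      Function.update (insArgs n i x a) (s + 1 - n) y := by
  funext j
  simp only [insArgs, Function.update_apply]
  split_ifs <;> first | rfl | omega

/-- Nested insertions: inserting `h` into one of the slots which `f ∘ᵢ g` has inherited from `g`
is inserting `h` into `g` first. -/
lemma ins_ins_seq {n p t : ℕ} (ht : t < n) (f g h : (ℕ → L) → L) (i : ℕ) :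
    ins p (ins n f i g) (i + t) h = ins (n + p - 1) f i (ins p g t h) := by
  funext a
  simp only [ins_apply]
  congr 1
  funext j
  rcases lt_trichotomy j i with hj | rfl | hj
  · rw [insArgs_of_lt hj, insArgs_of_lt hj, insArgs_of_lt (by omega)]
  · rw [insArgs_self, insArgs_self]
    congr 1
    funext l
    rcases lt_trichotomy l t with hl | rfl | hl
    · rw [insArgs_of_lt hl, insArgs_of_lt (by omega)]
    · rw [insArgs_self, insArgs_self]
      simp only [add_assoc]
    · rw [insArgs_of_gt hl, insArgs_of_gt (by omega)]
      congr 1; omega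
  · rw [insArgs_of_gt hj, insArgs_of_gt hj, insArgs_of_gt (by omega)]
    congr 1; omega

end Insertion

/-! ### Multilinear operations -/

section Operations

variable (K L : Type*) [CommRing K] [AddCommGroup L] [Module K L]

/-- The `K`-multilinear operations on `L` with `m` arguments: the functions of a sequence which
depend on its first `m` entries only, and are `K`-linear in each of these. -/
def Oper (m : ℕ) : Submodule K ((ℕ → L) → L) where
  carrier := {f | (∀ a b : ℕ → L, (∀ j < m, a j = b j) → f a = f b) ∧
    (∀ i < m, ∀ (a : ℕ → L) (x y : L),
      f (Function.update a i (x + y)) = f (Function.update a i x) + f (Function.update a i y)) ∧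
    ∀ i < m, ∀ (a : ℕ → L) (c : K) (x : L),
      f (Function.update a i (c • x)) = c • f (Function.update a i x)}
  zero_mem' := by simp
  add_mem' := by
    rintro f g ⟨h₁, h₂, h₃⟩ ⟨h₄, h₅, h₆⟩
    refine ⟨fun a b h => ?_, fun i hi a x y => ?_, fun i hi a c x => ?_⟩
    · simp only [Pi.add_apply, h₁ a b h, h₄ a b h]
    · simp only [Pi.add_apply, h₂ i hi, h₅ i hi]; abel
    · simp only [Pi.add_apply, h₃ i hi, h₆ i hi, smul_add]
  smul_mem' := by
    rintro t f ⟨h₁, h₂, h₃⟩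
    refine ⟨fun a b h => ?_, fun i hi a x y => ?_, fun i hi a c x => ?_⟩
    · simp only [Pi.smul_apply, h₁ a b h]
    · simp only [Pi.smul_apply, h₂ i hi, smul_add]
    · simp only [Pi.smul_apply, h₃ i hi, smul_comm c]

variable {K L}

lemma oper_congr {m : ℕ} {f : (ℕ → L) → L} (hf : f ∈ Oper K L m) {a b : ℕ → L}
    (h : ∀ j < m, a j = b j) : f a = f b := hf.1 a b h

lemma insArgs_add {m : ℕ} {f : (ℕ → L) → L} (hf : f ∈ Oper K L m) {i : ℕ} (hi : i < m)
    (n : ℕ) (x y : L) (a : ℕ → L) :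
    f (insArgs n i (x + y) a) = f (insArgs n i x a) + f (insArgs n i y a) := by
  rw [insArgs_eq_update n i (x + y) 0, insArgs_eq_update n i x 0, insArgs_eq_update n i y 0,
    hf.2.1 i hi]

lemma insArgs_smul {m : ℕ} {f : (ℕ → L) → L} (hf : f ∈ Oper K L m) {i : ℕ} (hi : i < m)
    (n : ℕ) (c : K) (x : L) (a : ℕ → L) :
    f (insArgs n i (c • x) a) = c • f (insArgs n i x a) := by
  rw [insArgs_eq_update n i (c • x) 0, insArgs_eq_update n i x 0, hf.2.2 i hi]

/-- The insertion into a slot of a multilinear operation, as an additive map. -/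
def insHom {m : ℕ} {f : (ℕ → L) → L} (hf : f ∈ Oper K L m) {i : ℕ} (hi : i < m) (n : ℕ) :
    ((ℕ → L) → L) →+ ((ℕ → L) → L) :=
  AddMonoidHom.mk' (ins n f i) fun g g' => funext fun a => by
    simp [ins_apply, insArgs_add hf hi]

lemma insHom_apply {m : ℕ} {f : (ℕ → L) → L} (hf : f ∈ Oper K L m) {i : ℕ} (hi : i < m) (n : ℕ)
    (g : (ℕ → L) → L) : insHom hf hi n g = ins n f i g := rfl

lemma ins_mem {m n : ℕ} {f g : (ℕ → L) → L} (hf : f ∈ Oper K L m) (hg : g ∈ Oper K L n) {i : ℕ}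
    (hi : i < m) : ins n f i g ∈ Oper K L (m + n - 1) := by
  have hlt : ∀ {s : ℕ}, s < i → ∀ (a : ℕ → L) (y : L),
      ins n f i g (Function.update a s y) =
        f (Function.update (insArgs n i (g fun l => a (i + l)) a) s y) := by
    intro s hs a y
    rw [ins_apply, insArgs_update_of_lt hs]
    congr 3
    refine congrArg g (funext fun l => ?_)
    rw [Function.update_of_ne (by omega)]
  have hge : ∀ {s : ℕ}, i + n ≤ s → ∀ (a : ℕ → L) (y : L),
      ins n f i g (Function.update a s y) =
        f (Function.update (insArgs n i (g fun l => a (i + l)) a) (s + 1 - n) y) := by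
    intro s hs a y
    rw [ins_apply, insArgs_update_of_ge hs]
    congr 3
    refine oper_congr hg fun l hl => ?_
    rw [Function.update_of_ne (by omega)]
  have hin : ∀ {t : ℕ}, t < n → ∀ (a : ℕ → L) (y : L),
      ins n f i g (Function.update a (i + t) y) =
        f (insArgs n i (g (Function.update (fun l => a (i + l)) t y)) a) := by
    intro t ht a y
    rw [ins_apply]
    congr 1
    funext j
    rcases lt_trichotomy j i with hj | rfl | hj
    · rw [insArgs_of_lt hj, insArgs_of_lt hj, Function.update_of_ne (by omega)]
    · rw [insArgs_self, insArgs_self]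
      congr 1
      funext l
      simp [Function.update_apply]
    · rw [insArgs_of_gt hj, insArgs_of_gt hj, Function.update_of_ne (by omega)]
  -- A slot of `f ∘ᵢ g` comes from `f` to the left of `i`, from `g`, or from `f` to the right of
  -- `i`.
  have hcases : ∀ s < m + n - 1, s < i ∨ (∃ t < n, s = i + t) ∨ (i + n ≤ s ∧ s + 1 - n < m) := by
    intro s hs
    rcases lt_or_ge s i with h | h
    · exact Or.inl h
    rcases lt_or_ge s (i + n) with h' | h'
    · exact Or.inr (Or.inl ⟨s - i, by omega, by omega⟩)
    · exact Or.inr (Or.inr ⟨h', by omega⟩)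
  refine ⟨fun a b h => ?_, fun s hs a x y => ?_, fun s hs a c x => ?_⟩
  · refine oper_congr hf fun j hj => ?_
    rcases lt_trichotomy j i with hj' | rfl | hj'
    · rw [insArgs_of_lt hj', insArgs_of_lt hj', h _ (by omega)]
    · rw [insArgs_self, insArgs_self]
      exact oper_congr hg fun l hl => h _ (by omega)
    · rw [insArgs_of_gt hj', insArgs_of_gt hj', h _ (by omega)]
  · rcases hcases s hs with h | ⟨t, ht, rfl⟩ | ⟨h, h'⟩
    · simp only [hlt h, hf.2.1 s (by omega)]
    · simp only [hin ht, hg.2.1 t ht, insArgs_add hf hi]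
    · simp only [hge h, hf.2.1 _ h']
  · rcases hcases s hs with h | ⟨t, ht, rfl⟩ | ⟨h, h'⟩
    · simp only [hlt h, hf.2.2 s (by omega)]
    · simp only [hin ht, hg.2.2 t ht, insArgs_smul hf hi]
    · simp only [hge h, hf.2.2 _ h']

/-- Insertions into different slots `j < i` of `f` commute; replacing the slot `j` by `p` slots
moves the slot `i` to `i + p - 1`. -/
lemma ins_ins_par {p : ℕ} {h : (ℕ → L) → L} (hh : h ∈ Oper K L p) {i j : ℕ} (hij : j < i)
    (n : ℕ) (f g : (ℕ → L) → L) :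
    ins p (ins n f i g) j h = ins n (ins p f j h) (i + p - 1) g := by
  funext a
  simp only [ins_apply]
  congr 1
  funext s
  rcases lt_trichotomy s i with hs | rfl | hs
  · rw [insArgs_of_lt hs]
    rcases lt_trichotomy s j with hs' | rfl | hs'
    · rw [insArgs_of_lt hs', insArgs_of_lt hs', insArgs_of_lt (by omega)]
    · rw [insArgs_self, insArgs_self]
      exact oper_congr hh fun l hl => by rw [insArgs_of_lt (by omega)]
    · rw [insArgs_of_gt hs', insArgs_of_gt hs', insArgs_of_lt (by omega)]
  · rw [insArgs_self, insArgs_of_gt hij, insArgs_self]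
    congr 1
    funext l
    rw [insArgs_of_gt (by omega)]
    congr 1; omega
  · rw [insArgs_of_gt hs, insArgs_of_gt (by omega), insArgs_of_gt (by omega),
      insArgs_of_gt (by omega)]
    congr 1; omega

/-- The form of `ins_ins_par` in which the first insertion takes place in the smaller slot. -/
lemma ins_ins_par' {n : ℕ} {g : (ℕ → L) → L} (hg : g ∈ Oper K L n) (p i t : ℕ)
    (f h : (ℕ → L) → L) :
    ins p (ins n f i g) (i + n + t) h = ins n (ins p f (i + 1 + t) h) i g := by
  rw [ins_ins_par hg (by omega : i < i + 1 + t)]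
  congr 1; omega

end Operations

/-! ### Signs and sums over pairs of slots -/

section Sums

/-- Equality of signs, reduced to an identity in `ZMod 2`, which is decidable once the variables
are generalized. -/
lemma neg_one_pow_congr {a b : ℕ} (h : (a : ZMod 2) = b) : (-1 : ℤ) ^ a = (-1) ^ b := by
  have := (ZMod.natCast_eq_natCast_iff' a b 2).1 h
  rw [neg_one_pow_eq_pow_mod_two, this, ← neg_one_pow_eq_pow_mod_two]

variable {M : Type*} [AddCommMonoid M]

lemma sum_range_split {N l q r : ℕ} (h : N = l + (q + r)) (F : ℕ → M) :
    ∑ i ∈ Finset.range N, F i = ∑ i ∈ Finset.range l, F i + ∑ t ∈ Finset.range q, F (l + t) +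
      ∑ t ∈ Finset.range r, F (l + q + t) := by
  rw [h, Finset.sum_range_add, Finset.sum_range_add]
  simp only [add_assoc]

/-- Two descriptions of the sum over the pairs `i < j` with `j < N`. -/
lemma sum_range_triangle (N : ℕ) (G : ℕ → ℕ → M) :
    ∑ i ∈ Finset.range N, ∑ t ∈ Finset.range (N - 1 - i), G i (i + 1 + t) =
      ∑ j ∈ Finset.range N, ∑ i ∈ Finset.range j, G i j := by
  induction N with
  | zero => simp
  | succ N ih =>
    rw [Finset.sum_range_succ (fun j => ∑ i ∈ Finset.range j, G i j), ← ih,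
      Finset.sum_range_succ, ← Finset.sum_add_distrib]
    simp only [add_tsub_cancel_right, tsub_self, Finset.range_zero, Finset.sum_empty, add_zero]
    refine Finset.sum_congr rfl fun i hi => ?_
    rw [Finset.mem_range] at hi
    rw [show N - i = N - 1 - i + 1 by omega, Finset.sum_range_succ]
    congr 2
    omega

/-- The sum over the pairs `i < j` with `j < l + q + r`, sorted by the position of `i` and `j`
relative to the block `l, …, l + q - 1`. -/
lemma sum_pairs_split {N l q r : ℕ} (h : N = l + (q + r)) (F : ℕ → ℕ → M) :
    ∑ j ∈ Finset.range N, ∑ i ∈ Finset.range j, F i j =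
      ∑ j ∈ Finset.range l, ∑ i ∈ Finset.range j, F i j +
      (∑ t ∈ Finset.range q, ∑ i ∈ Finset.range l, F i (l + t) +
        ∑ t ∈ Finset.range q, ∑ s ∈ Finset.range t, F (l + s) (l + t)) +
      (∑ t ∈ Finset.range r, ∑ i ∈ Finset.range l, F i (l + q + t) +
        ∑ t ∈ Finset.range r, ∑ s ∈ Finset.range q, F (l + s) (l + q + t) +
        ∑ t ∈ Finset.range r, ∑ s ∈ Finset.range t, F (l + q + s) (l + q + t)) := by
  rw [sum_range_split h]
  congr 1
  · congr 1
    rw [← Finset.sum_add_distrib]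
    exact Finset.sum_congr rfl fun t _ => Finset.sum_range_add _ _ _
  · rw [← Finset.sum_add_distrib, ← Finset.sum_add_distrib]
    exact Finset.sum_congr rfl fun t _ => by
      rw [Finset.sum_range_add, Finset.sum_range_add]

end Sums

/-! ### The pre-Lie product and the braces -/

section Braces

variable {K L : Type*} [CommRing K] [AddCommGroup L] [Module K L]

lemma ins_sum_left {ι : Type*} (s : Finset ι) (F : ι → (ℕ → L) → L) (n i : ℕ)
    (g : (ℕ → L) → L) : ins n (∑ x ∈ s, F x) i g = ∑ x ∈ s, ins n (F x) i g := by
  funext a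
  simp [ins_apply]

lemma ins_zsmul_left (c : ℤ) (f : (ℕ → L) → L) (n i : ℕ) (g : (ℕ → L) → L) :
    ins n (c • f) i g = c • ins n f i g := rfl

lemma ins_sum_right {m : ℕ} {f : (ℕ → L) → L} (hf : f ∈ Oper K L m) {i : ℕ} (hi : i < m) (n : ℕ)
    {ι : Type*} (s : Finset ι) (c : ι → ℤ) (F : ι → (ℕ → L) → L) :
    ins n f i (∑ x ∈ s, c x • F x) = ∑ x ∈ s, c x • ins n f i (F x) := by
  simp only [← insHom_apply hf hi, map_sum, map_zsmul]

/-- Gerstenhaber's pre-Lie product `f • g = ∑ᵢ (-1)^{(n-1) i} f ∘ᵢ g` of operations with `m` and `n`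
arguments. The exponent is written with `n + 1` in place of `n - 1`, which is correct for `n = 0`
too. -/
def preLie (m n : ℕ) (f g : (ℕ → L) → L) : (ℕ → L) → L :=
  ∑ i ∈ Finset.range m, (-1 : ℤ) ^ ((n + 1) * i) • ins n f i g

/-- The brace `f{g, h}`, the signed sum of all insertions of `g` and `h` into two slots `i < j` of
`f`, where `f`, `g` and `h` have `m`, `n` and `p` arguments. The insertion into the larger slot is
made first, so that the other slot keeps its number. -/
def brace (m n p : ℕ) (f g h : (ℕ → L) → L) : (ℕ → L) → L :=
  ∑ j ∈ Finset.range m, ∑ i ∈ Finset.range j,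
    (-1 : ℤ) ^ ((n + 1) * i + (p + 1) * (j + n + 1)) • ins n (ins p f j h) i g

/-- The failure of associativity of the pre-Lie product: what remains of `(f • g) • h` after removal
of the insertions of `h` into `g` are the insertions of `g` and `h` into different slots of `f`. -/
theorem preLie_assoc {m n p : ℕ} {f g h : (ℕ → L) → L} (hf : f ∈ Oper K L m)
    (hg : g ∈ Oper K L n) :
    preLie (m + n - 1) p (preLie m n f g) h = preLie m (n + p - 1) f (preLie n p g h) +
      (brace m n p f g h + (-1 : ℤ) ^ ((n + 1) * (p + 1)) • brace m p n f h g) := by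
  -- For fixed `i`, the slots `j` of `f ∘ᵢ g` lie to the left of `g`, in `g`, or to the right of
  -- `g`.
  have e : ∀ i ∈ Finset.range m, ∑ j ∈ Finset.range (m + n - 1),
      (-1 : ℤ) ^ ((p + 1) * j) • (-1 : ℤ) ^ ((n + 1) * i) • ins p (ins n f i g) j h =
      (-1 : ℤ) ^ ((n + p - 1 + 1) * i) • ins (n + p - 1) f i (preLie n p g h) +
      (∑ t ∈ Finset.range (m - 1 - i), (-1 : ℤ) ^ ((n + 1) * i + (p + 1) * (i + 1 + t + n + 1)) •
          ins n (ins p f (i + 1 + t) h) i g +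
        (-1 : ℤ) ^ ((n + 1) * (p + 1)) • ∑ j ∈ Finset.range i,
          (-1 : ℤ) ^ ((p + 1) * j + (n + 1) * (i + p + 1)) • ins p (ins n f i g) j h) := by
    intro i hi
    have hi' := Finset.mem_range.1 hi
    rw [sum_range_split (show m + n - 1 = i + (n + (m - 1 - i)) by omega), preLie,
      ins_sum_right hf hi', Finset.smul_sum, Finset.smul_sum]
    have e₁ : ∀ t ∈ Finset.range n, (-1 : ℤ) ^ ((p + 1) * (i + t)) • (-1 : ℤ) ^ ((n + 1) * i) •
        ins p (ins n f i g) (i + t) h = (-1 : ℤ) ^ ((n + p - 1 + 1) * i) •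
          (-1 : ℤ) ^ ((p + 1) * t) • ins (n + p - 1) f i (ins p g t h) := fun t ht => by
      rw [Finset.mem_range] at ht
      rw [ins_ins_seq ht, smul_smul, smul_smul, ← pow_add, ← pow_add,
        show n + p - 1 + 1 = n + p by omega]
      congr 1
      apply neg_one_pow_congr
      push_cast
      generalize (n : ZMod 2) = n, (p : ZMod 2) = p, (i : ZMod 2) = i, (t : ZMod 2) = t
      decide +revert
    have e₂ : ∀ t ∈ Finset.range (m - 1 - i), (-1 : ℤ) ^ ((p + 1) * (i + n + t)) •
        (-1 : ℤ) ^ ((n + 1) * i) • ins p (ins n f i g) (i + n + t) h =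
          (-1 : ℤ) ^ ((n + 1) * i + (p + 1) * (i + 1 + t + n + 1)) •
            ins n (ins p f (i + 1 + t) h) i g := fun t _ => by
      rw [ins_ins_par' hg, smul_smul, ← pow_add]
      congr 1
      apply neg_one_pow_congr
      push_cast
      generalize (n : ZMod 2) = n, (p : ZMod 2) = p, (i : ZMod 2) = i, (t : ZMod 2) = t
      decide +revert
    have e₃ : ∀ j ∈ Finset.range i, (-1 : ℤ) ^ ((p + 1) * j) • (-1 : ℤ) ^ ((n + 1) * i) •
        ins p (ins n f i g) j h = (-1 : ℤ) ^ ((n + 1) * (p + 1)) •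
          (-1 : ℤ) ^ ((p + 1) * j + (n + 1) * (i + p + 1)) • ins p (ins n f i g) j h :=
      fun j _ => by
        rw [smul_smul, smul_smul, ← pow_add, ← pow_add]
        congr 1
        apply neg_one_pow_congr
        push_cast
        generalize (n : ZMod 2) = n, (p : ZMod 2) = p, (i : ZMod 2) = i, (j : ZMod 2) = j
        decide +revert
    rw [Finset.sum_congr rfl e₁, Finset.sum_congr rfl e₂, Finset.sum_congr rfl e₃]
    abel
  rw [preLie, preLie, preLie, brace, brace]
  simp only [ins_sum_left, ins_zsmul_left, Finset.smul_sum]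
  rw [Finset.sum_comm, Finset.sum_congr rfl e, Finset.sum_add_distrib, Finset.sum_add_distrib,
    sum_range_triangle m fun i j => (-1 : ℤ) ^ ((n + 1) * i + (p + 1) * (j + n + 1)) •
      ins n (ins p f j h) i g]
  simp only [Finset.smul_sum]

/-- The signed sum of all insertions of `X`, `Y`, `Z` into three slots `u < v < w` of `h`. -/
def tripleBrace (p x y z : ℕ) (h X Y Z : (ℕ → L) → L) : (ℕ → L) → L :=
  ∑ w ∈ Finset.range p, ∑ v ∈ Finset.range w, ∑ u ∈ Finset.range v,
    (-1 : ℤ) ^ ((x + 1) * u + (y + 1) * (v + x + 1) + (z + 1) * (w + x + y)) •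
      ins x (ins y (ins z h w Z) v Y) u X

lemma smul_ins_congr {a b : ℕ} (hab : (a : ZMod 2) = b) {x y : (ℕ → L) → L} (hxy : x = y) :
    (-1 : ℤ) ^ a • x = (-1 : ℤ) ^ b • y := by rw [neg_one_pow_congr hab, hxy]

/-- `h{f, g} • M` is the sum of the terms where `M` is inserted into `g`, into `f`, and into a slot
of `h`. -/
theorem brace_preLie {p q m n : ℕ} {h M f g : (ℕ → L) → L} (hh : h ∈ Oper K L p)
    (hf : f ∈ Oper K L m) (hg : g ∈ Oper K L n) :
    preLie (p + m + n - 2) q (brace p m n h f g) M =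
      brace p m (n + q - 1) h f (preLie n q g M) +
      (-1 : ℤ) ^ ((q + 1) * (n + 1)) • brace p (m + q - 1) n h (preLie m q f M) g +
      (tripleBrace p m n q h f g M +
        (-1 : ℤ) ^ ((q + 1) * (n + 1)) • tripleBrace p m q n h f M g +
        (-1 : ℤ) ^ ((q + 1) * (m + n)) • tripleBrace p q m n h M f g) := by
  -- With `f` in slot `i` and `g` in slot `j`, the position of `M` is one of five: to the left of
  -- `f` (`e₁`), in `f` (`e₂`), between `f` and `g` (`e₃`), in `g` (`e₄`), to the right of `g`
  -- (`e₅`).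
  have key : ∀ j ∈ Finset.range p, ∀ i ∈ Finset.range j,
      ∑ r ∈ Finset.range (p + m + n - 2), (-1 : ℤ) ^ ((q + 1) * r) •
        (-1 : ℤ) ^ ((m + 1) * i + (n + 1) * (j + m + 1)) •
          ins q (ins m (ins n h j g) i f) r M =
      (-1 : ℤ) ^ ((m + 1) * i + (n + q - 1 + 1) * (j + m + 1)) •
          ins m (ins (n + q - 1) h j (preLie n q g M)) i f +
      (-1 : ℤ) ^ ((q + 1) * (n + 1)) •
          (-1 : ℤ) ^ ((m + q - 1 + 1) * i + (n + 1) * (j + (m + q - 1) + 1)) •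
          ins (m + q - 1) (ins n h j g) i (preLie m q f M) +
      (∑ t ∈ Finset.range (p - 1 - j),
          (-1 : ℤ) ^ ((m + 1) * i + (n + 1) * (j + m + 1) + (q + 1) * (j + 1 + t + m + n)) •
            ins m (ins n (ins q h (j + 1 + t) M) j g) i f +
        (-1 : ℤ) ^ ((q + 1) * (n + 1)) • ∑ t ∈ Finset.range (j - 1 - i),
          (-1 : ℤ) ^ ((m + 1) * i + (q + 1) * (i + 1 + t + m + 1) + (n + 1) * (j + m + q)) •
            ins m (ins q (ins n h j g) (i + 1 + t) M) i f +
        (-1 : ℤ) ^ ((q + 1) * (m + n)) • ∑ r ∈ Finset.range i,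
          (-1 : ℤ) ^ ((q + 1) * r + (m + 1) * (i + q + 1) + (n + 1) * (j + q + m)) •
            ins q (ins m (ins n h j g) i f) r M) := by
    intro j hj i hi
    rw [Finset.mem_range] at hi hj
    have hhg := ins_mem hh hg hj
    rw [sum_range_split (show p + m + n - 2 =
        i + (m + ((j - 1 - i) + (n + (p - 1 - j)))) by omega),
      sum_range_split (show (j - 1 - i) + (n + (p - 1 - j)) =
        (j - 1 - i) + (n + (p - 1 - j)) by rfl) (fun t => (-1 : ℤ) ^ ((q + 1) * (i + m + t)) •
        (-1 : ℤ) ^ ((m + 1) * i + (n + 1) * (j + m + 1)) •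
          ins q (ins m (ins n h j g) i f) (i + m + t) M),
      preLie, preLie, ins_sum_right hh hj, ins_sum_right hhg (by omega : i < p + n - 1)]
    simp only [ins_sum_left, ins_zsmul_left, Finset.smul_sum, smul_smul, ← pow_add]
    have e₁ : ∀ r ∈ Finset.range i,
        (-1 : ℤ) ^ ((q + 1) * r + ((m + 1) * i + (n + 1) * (j + m + 1))) •
          ins q (ins m (ins n h j g) i f) r M =
        (-1 : ℤ) ^ ((q + 1) * (m + n) +
          ((q + 1) * r + (m + 1) * (i + q + 1) + (n + 1) * (j + q + m))) •
            ins q (ins m (ins n h j g) i f) r M := fun r _ => by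
      refine smul_ins_congr ?_ rfl
      push_cast
      generalize (n : ZMod 2) = n, (m : ZMod 2) = m, (q : ZMod 2) = q, (i : ZMod 2) = i,
        (j : ZMod 2) = j, (r : ZMod 2) = r
      decide +revert
    have e₂ : ∀ t ∈ Finset.range m,
        (-1 : ℤ) ^ ((q + 1) * (i + t) + ((m + 1) * i + (n + 1) * (j + m + 1))) •
          ins q (ins m (ins n h j g) i f) (i + t) M =
        (-1 : ℤ) ^ ((q + 1) * (n + 1) +
            ((m + q - 1 + 1) * i + (n + 1) * (j + (m + q - 1) + 1) + (q + 1) * t)) •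
          ins (m + q - 1) (ins n h j g) i (ins q f t M) := fun t ht => by
      rw [Finset.mem_range] at ht
      refine smul_ins_congr ?_ (ins_ins_seq ht _ _ _ _)
      rw [show m + q - 1 + 1 = m + q by omega, show j + (m + q - 1) + 1 = j + m + q by omega]
      push_cast
      generalize (n : ZMod 2) = n, (m : ZMod 2) = m, (q : ZMod 2) = q, (i : ZMod 2) = i,
        (j : ZMod 2) = j, (t : ZMod 2) = t
      decide +revert
    have e₃ : ∀ t ∈ Finset.range (j - 1 - i),
        (-1 : ℤ) ^ ((q + 1) * (i + m + t) + ((m + 1) * i + (n + 1) * (j + m + 1))) •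
          ins q (ins m (ins n h j g) i f) (i + m + t) M =
        (-1 : ℤ) ^ ((q + 1) * (n + 1) +
            ((m + 1) * i + (q + 1) * (i + 1 + t + m + 1) + (n + 1) * (j + m + q))) •
          ins m (ins q (ins n h j g) (i + 1 + t) M) i f := fun t _ => by
      refine smul_ins_congr ?_ (ins_ins_par' hf _ _ _ _ _)
      push_cast
      generalize (n : ZMod 2) = n, (m : ZMod 2) = m, (q : ZMod 2) = q, (i : ZMod 2) = i,
        (j : ZMod 2) = j, (t : ZMod 2) = t
      decide +revert
    have e₄ : ∀ t ∈ Finset.range n,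
        (-1 : ℤ) ^ ((q + 1) * (i + m + (j - 1 - i + t)) +
            ((m + 1) * i + (n + 1) * (j + m + 1))) •
          ins q (ins m (ins n h j g) i f) (i + m + (j - 1 - i + t)) M =
        (-1 : ℤ) ^ ((m + 1) * i + (n + q - 1 + 1) * (j + m + 1) + (q + 1) * t) •
          ins m (ins (n + q - 1) h j (ins q g t M)) i f := fun t ht => by
      rw [Finset.mem_range] at ht
      refine smul_ins_congr ?_ ?_
      · rw [show n + q - 1 + 1 = n + q by omega]
        obtain ⟨d, rfl⟩ : ∃ d, j = i + 1 + d := ⟨j - 1 - i, by omega⟩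
        rw [show i + 1 + d - 1 - i = d by omega]
        push_cast
        generalize (n : ZMod 2) = n, (m : ZMod 2) = m, (q : ZMod 2) = q, (i : ZMod 2) = i,
          (d : ZMod 2) = d, (t : ZMod 2) = t
        decide +revert
      · rw [ins_ins_par' hf, show i + 1 + (j - 1 - i + t) = j + t by omega, ins_ins_seq ht]
    have e₅ : ∀ t ∈ Finset.range (p - 1 - j),
        (-1 : ℤ) ^ ((q + 1) * (i + m + (j - 1 - i + n + t)) +
            ((m + 1) * i + (n + 1) * (j + m + 1))) •
          ins q (ins m (ins n h j g) i f) (i + m + (j - 1 - i + n + t)) M =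
        (-1 : ℤ) ^ ((m + 1) * i + (n + 1) * (j + m + 1) + (q + 1) * (j + 1 + t + m + n)) •
          ins m (ins n (ins q h (j + 1 + t) M) j g) i f := fun t _ => by
      refine smul_ins_congr ?_ ?_
      · obtain ⟨d, rfl⟩ : ∃ d, j = i + 1 + d := ⟨j - 1 - i, by omega⟩
        rw [show i + 1 + d - 1 - i = d by omega]
        push_cast
        generalize (n : ZMod 2) = n, (m : ZMod 2) = m, (q : ZMod 2) = q, (i : ZMod 2) = i,
          (d : ZMod 2) = d, (t : ZMod 2) = t
        decide +revert
      · rw [ins_ins_par' hf, show i + 1 + (j - 1 - i + n + t) = j + n + t by omega,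
          ins_ins_par' hg]
    rw [Finset.sum_congr rfl e₁, Finset.sum_congr rfl e₂, Finset.sum_congr rfl e₃,
      Finset.sum_congr rfl e₄, Finset.sum_congr rfl e₅]
    have reorder : ∀ a b c d e : (ℕ → L) → L,
        a + b + (c + d + e) = d + b + (e + c + a) := fun a b c d e => by abel
    exact reorder _ _ _ _ _
  have t₁ : ∑ j ∈ Finset.range p, ∑ i ∈ Finset.range j, ∑ t ∈ Finset.range (p - 1 - j),
      (-1 : ℤ) ^ ((m + 1) * i + (n + 1) * (j + m + 1) + (q + 1) * (j + 1 + t + m + n)) •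
        ins m (ins n (ins q h (j + 1 + t) M) j g) i f = tripleBrace p m n q h f g M := by
    rw [tripleBrace, ← sum_range_triangle p fun v w => ∑ u ∈ Finset.range v,
      (-1 : ℤ) ^ ((m + 1) * u + (n + 1) * (v + m + 1) + (q + 1) * (w + m + n)) •
        ins m (ins n (ins q h w M) v g) u f]
    exact Finset.sum_congr rfl fun j _ => Finset.sum_comm
  have t₂ : ∑ j ∈ Finset.range p, ∑ i ∈ Finset.range j, ∑ t ∈ Finset.range (j - 1 - i),
      (-1 : ℤ) ^ ((m + 1) * i + (q + 1) * (i + 1 + t + m + 1) + (n + 1) * (j + m + q)) •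
        ins m (ins q (ins n h j g) (i + 1 + t) M) i f = tripleBrace p m q n h f M g :=
    Finset.sum_congr rfl fun j _ => sum_range_triangle j fun u v =>
      (-1 : ℤ) ^ ((m + 1) * u + (q + 1) * (v + m + 1) + (n + 1) * (j + m + q)) •
        ins m (ins q (ins n h j g) v M) u f
  rw [← t₁, ← t₂, preLie, brace]
  simp only [ins_sum_left, ins_zsmul_left, Finset.smul_sum]
  rw [Finset.sum_comm, brace, brace, tripleBrace]
  simp only [Finset.smul_sum, ← Finset.sum_add_distrib]
  refine Finset.sum_congr rfl fun j hj => ?_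
  rw [Finset.sum_comm]
  refine Finset.sum_congr rfl fun i hi => ?_
  rw [key j hj i hi]
  simp only [Finset.smul_sum]

/-- `(h • M){f, g}` is the sum of the terms where both, one or none of `f` and `g` are inserted into
`M`. -/
theorem preLie_brace {p q m n : ℕ} {h M f g : (ℕ → L) → L} (hh : h ∈ Oper K L p)
    (hM : M ∈ Oper K L q) (hg : g ∈ Oper K L n) :
    brace (p + q - 1) m n (preLie p q h M) f g =
      preLie p (q + m + n - 2) h (brace q m n M f g) +
      brace p (q + m - 1) n h (preLie q m M f) g +
      (-1 : ℤ) ^ ((m + 1) * (q + 1)) • brace p m (q + n - 1) h f (preLie q n M g) +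
      ((-1 : ℤ) ^ ((q + 1) * (m + n)) • tripleBrace p m n q h f g M +
        (-1 : ℤ) ^ ((q + 1) * (m + 1)) • tripleBrace p m q n h f M g +
        tripleBrace p q m n h M f g) := by
  -- With `M` in slot `l` of `h`, the slots `i < j` of `f` and `g` lie both to the left of `M`
  -- (`e₁`), on its left and in it (`e₂`), both in it (`e₃`), on both sides of it (`e₄`), in it
  -- and on its right (`e₅`), or both on its right (`e₆`).
  have key : ∀ l ∈ Finset.range p,
      ∑ j ∈ Finset.range (p + q - 1), ∑ i ∈ Finset.range j,
        (-1 : ℤ) ^ ((m + 1) * i + (n + 1) * (j + m + 1)) • (-1 : ℤ) ^ ((q + 1) * l) •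
          ins m (ins n (ins q h l M) j g) i f =
      (-1 : ℤ) ^ ((q + m + n - 2 + 1) * l) • ins (q + m + n - 2) h l (brace q m n M f g) +
      ∑ t ∈ Finset.range (p - 1 - l),
        (-1 : ℤ) ^ ((q + m - 1 + 1) * l + (n + 1) * (l + 1 + t + (q + m - 1) + 1)) •
          ins (q + m - 1) (ins n h (l + 1 + t) g) l (preLie q m M f) +
      (-1 : ℤ) ^ ((m + 1) * (q + 1)) • ∑ i ∈ Finset.range l,
        (-1 : ℤ) ^ ((m + 1) * i + (q + n - 1 + 1) * (l + m + 1)) •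
          ins m (ins (q + n - 1) h l (preLie q n M g)) i f +
      ((-1 : ℤ) ^ ((q + 1) * (m + n)) • ∑ v ∈ Finset.range l, ∑ u ∈ Finset.range v,
          (-1 : ℤ) ^ ((m + 1) * u + (n + 1) * (v + m + 1) + (q + 1) * (l + m + n)) •
            ins m (ins n (ins q h l M) v g) u f +
        (-1 : ℤ) ^ ((q + 1) * (m + 1)) • ∑ t ∈ Finset.range (p - 1 - l), ∑ u ∈ Finset.range l,
          (-1 : ℤ) ^ ((m + 1) * u + (q + 1) * (l + m + 1) + (n + 1) * (l + 1 + t + m + q)) •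
            ins m (ins q (ins n h (l + 1 + t) g) l M) u f +
        ∑ t ∈ Finset.range (p - 1 - l), ∑ s ∈ Finset.range t,
          (-1 : ℤ) ^ ((q + 1) * l + (m + 1) * (l + 1 + s + q + 1) +
              (n + 1) * (l + 1 + t + q + m)) •
            ins q (ins m (ins n h (l + 1 + t) g) (l + 1 + s) f) l M) := by
    intro l hl
    rw [Finset.mem_range] at hl
    rw [sum_pairs_split (show p + q - 1 = l + (q + (p - 1 - l)) by omega), brace, preLie, preLie]
    have hr : ∀ (G : ℕ → (ℕ → L) → L) (c c' : ℕ → ℤ),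
        ∑ t ∈ Finset.range (p - 1 - l), c' t • ins (q + m - 1) (ins n h (l + 1 + t) g) l
            (∑ s ∈ Finset.range q, c s • G s) =
          ∑ t ∈ Finset.range (p - 1 - l), c' t • ∑ s ∈ Finset.range q,
            c s • ins (q + m - 1) (ins n h (l + 1 + t) g) l (G s) :=
      fun G c c' => Finset.sum_congr rfl fun t ht => by
        rw [Finset.mem_range] at ht
        rw [ins_sum_right (ins_mem hh hg (by omega : l + 1 + t < p)) (by omega)]
    have hr' : ∀ G : ℕ → ℕ → (ℕ → L) → L, ∀ c : ℕ → ℕ → ℤ,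
        ins (q + m + n - 2) h l
            (∑ t ∈ Finset.range q, ∑ s ∈ Finset.range t, c t s • G t s) =
          ∑ t ∈ Finset.range q, ∑ s ∈ Finset.range t, c t s • ins (q + m + n - 2) h l (G t s) :=
      fun G c => by simp only [← insHom_apply hh hl, map_sum, map_zsmul]
    rw [hr', ins_sum_right hh hl, hr]
    simp only [ins_sum_left, ins_zsmul_left, Finset.smul_sum, smul_smul, ← pow_add]
    have e₁ : ∀ j ∈ Finset.range l, ∀ i ∈ Finset.range j,
        (-1 : ℤ) ^ ((m + 1) * i + (n + 1) * (j + m + 1) + (q + 1) * l) •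
          ins m (ins n (ins q h l M) j g) i f =
        (-1 : ℤ) ^ ((q + 1) * (m + n) +
            ((m + 1) * i + (n + 1) * (j + m + 1) + (q + 1) * (l + m + n))) •
          ins m (ins n (ins q h l M) j g) i f := fun j _ i _ => by
      refine smul_ins_congr ?_ rfl
      push_cast
      generalize (n : ZMod 2) = n, (m : ZMod 2) = m, (q : ZMod 2) = q, (i : ZMod 2) = i,
        (j : ZMod 2) = j, (l : ZMod 2) = l
      decide +revert
    have e₂ : ∀ t ∈ Finset.range q, ∀ i ∈ Finset.range l,
        (-1 : ℤ) ^ ((m + 1) * i + (n + 1) * (l + t + m + 1) + (q + 1) * l) •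
          ins m (ins n (ins q h l M) (l + t) g) i f =
        (-1 : ℤ) ^ ((m + 1) * (q + 1) + ((m + 1) * i + (q + n - 1 + 1) * (l + m + 1) +
            (n + 1) * t)) •
          ins m (ins (q + n - 1) h l (ins n M t g)) i f := fun t ht i _ => by
      rw [Finset.mem_range] at ht
      refine smul_ins_congr ?_ (by rw [ins_ins_seq ht])
      rw [show q + n - 1 + 1 = q + n by omega]
      push_cast
      generalize (n : ZMod 2) = n, (m : ZMod 2) = m, (q : ZMod 2) = q, (i : ZMod 2) = i,
        (t : ZMod 2) = t, (l : ZMod 2) = l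
      decide +revert
    have e₃ : ∀ t ∈ Finset.range q, ∀ s ∈ Finset.range t,
        (-1 : ℤ) ^ ((m + 1) * (l + s) + (n + 1) * (l + t + m + 1) + (q + 1) * l) •
          ins m (ins n (ins q h l M) (l + t) g) (l + s) f =
        (-1 : ℤ) ^ ((q + m + n - 2 + 1) * l + ((m + 1) * s + (n + 1) * (t + m + 1))) •
          ins (q + m + n - 2) h l (ins m (ins n M t g) s f) := fun t ht s hs => by
      rw [Finset.mem_range] at ht hs
      refine smul_ins_congr ?_ ?_
      · obtain ⟨d, rfl⟩ : ∃ d, q = d + 2 := ⟨q - 2, by omega⟩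
        rw [show d + 2 + m + n - 2 = d + m + n by omega]
        push_cast
        generalize (n : ZMod 2) = n, (m : ZMod 2) = m, (d : ZMod 2) = d, (s : ZMod 2) = s,
          (t : ZMod 2) = t, (l : ZMod 2) = l
        decide +revert
      · rw [ins_ins_seq ht, ins_ins_seq (by omega : s < q + n - 1)]
        congr 1; omega
    have e₄ : ∀ t ∈ Finset.range (p - 1 - l), ∀ i ∈ Finset.range l,
        (-1 : ℤ) ^ ((m + 1) * i + (n + 1) * (l + q + t + m + 1) + (q + 1) * l) •
          ins m (ins n (ins q h l M) (l + q + t) g) i f =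
        (-1 : ℤ) ^ ((q + 1) * (m + 1) +
            ((m + 1) * i + (q + 1) * (l + m + 1) + (n + 1) * (l + 1 + t + m + q))) •
          ins m (ins q (ins n h (l + 1 + t) g) l M) i f := fun t _ i _ => by
      refine smul_ins_congr ?_ (by rw [ins_ins_par' hM])
      push_cast
      generalize (n : ZMod 2) = n, (m : ZMod 2) = m, (q : ZMod 2) = q, (i : ZMod 2) = i,
        (t : ZMod 2) = t, (l : ZMod 2) = l
      decide +revert
    have e₅ : ∀ t ∈ Finset.range (p - 1 - l), ∀ s ∈ Finset.range q,
        (-1 : ℤ) ^ ((m + 1) * (l + s) + (n + 1) * (l + q + t + m + 1) + (q + 1) * l) •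
          ins m (ins n (ins q h l M) (l + q + t) g) (l + s) f =
        (-1 : ℤ) ^ ((q + m - 1 + 1) * l + (n + 1) * (l + 1 + t + (q + m - 1) + 1) +
            (m + 1) * s) •
          ins (q + m - 1) (ins n h (l + 1 + t) g) l (ins m M s f) := fun t _ s hs => by
      rw [Finset.mem_range] at hs
      refine smul_ins_congr ?_ (by rw [ins_ins_par' hM, ins_ins_seq hs])
      rw [show q + m - 1 + 1 = q + m by omega,
        show l + 1 + t + (q + m - 1) + 1 = l + 1 + t + (q + m) by omega]
      push_cast
      generalize (n : ZMod 2) = n, (m : ZMod 2) = m, (q : ZMod 2) = q, (s : ZMod 2) = s,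
        (t : ZMod 2) = t, (l : ZMod 2) = l
      decide +revert
    have e₆ : ∀ t ∈ Finset.range (p - 1 - l), ∀ s ∈ Finset.range t,
        (-1 : ℤ) ^ ((m + 1) * (l + q + s) + (n + 1) * (l + q + t + m + 1) + (q + 1) * l) •
          ins m (ins n (ins q h l M) (l + q + t) g) (l + q + s) f =
        (-1 : ℤ) ^ ((q + 1) * l + (m + 1) * (l + 1 + s + q + 1) +
            (n + 1) * (l + 1 + t + q + m)) •
          ins q (ins m (ins n h (l + 1 + t) g) (l + 1 + s) f) l M := fun t _ s _ => by
      refine smul_ins_congr ?_ (by rw [ins_ins_par' hM, ins_ins_par' hM])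
      push_cast
      generalize (n : ZMod 2) = n, (m : ZMod 2) = m, (q : ZMod 2) = q, (s : ZMod 2) = s,
        (t : ZMod 2) = t, (l : ZMod 2) = l
      decide +revert
    rw [Finset.sum_congr rfl fun j hj => Finset.sum_congr rfl (e₁ j hj),
      Finset.sum_congr rfl fun j hj => Finset.sum_congr rfl (e₂ j hj),
      Finset.sum_congr rfl fun j hj => Finset.sum_congr rfl (e₃ j hj),
      Finset.sum_congr rfl fun j hj => Finset.sum_congr rfl (e₄ j hj),
      Finset.sum_congr rfl fun j hj => Finset.sum_congr rfl (e₅ j hj),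
      Finset.sum_congr rfl fun j hj => Finset.sum_congr rfl (e₆ j hj),
      Finset.sum_comm (s := Finset.range q) (t := Finset.range l)]
    have reorder : ∀ a b c d e f : (ℕ → L) → L,
        a + (b + c) + (d + e + f) = c + e + b + (a + d + f) := fun a b c d e f => by abel
    exact reorder _ _ _ _ _ _
  have t₁ : ∑ l ∈ Finset.range p, ∑ t ∈ Finset.range (p - 1 - l), ∑ u ∈ Finset.range l,
      (-1 : ℤ) ^ ((m + 1) * u + (q + 1) * (l + m + 1) + (n + 1) * (l + 1 + t + m + q)) •
        ins m (ins q (ins n h (l + 1 + t) g) l M) u f = tripleBrace p m q n h f M g :=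
    sum_range_triangle p fun v w => ∑ u ∈ Finset.range v,
      (-1 : ℤ) ^ ((m + 1) * u + (q + 1) * (v + m + 1) + (n + 1) * (w + m + q)) •
        ins m (ins q (ins n h w g) v M) u f
  have t₂ : ∑ l ∈ Finset.range p, ∑ t ∈ Finset.range (p - 1 - l), ∑ s ∈ Finset.range t,
      (-1 : ℤ) ^ ((q + 1) * l + (m + 1) * (l + 1 + s + q + 1) + (n + 1) * (l + 1 + t + q + m)) •
        ins q (ins m (ins n h (l + 1 + t) g) (l + 1 + s) f) l M =
      tripleBrace p q m n h M f g := by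
    have := sum_range_triangle p fun l w => ∑ s ∈ Finset.range (w - 1 - l),
      (-1 : ℤ) ^ ((q + 1) * l + (m + 1) * (l + 1 + s + q + 1) + (n + 1) * (w + q + m)) •
        ins q (ins m (ins n h w g) (l + 1 + s) f) l M
    simp only [show ∀ l t : ℕ, l + 1 + t - 1 - l = t by omega] at this
    rw [this, tripleBrace]
    exact Finset.sum_congr rfl fun w _ => sum_range_triangle w fun u v =>
      (-1 : ℤ) ^ ((q + 1) * u + (m + 1) * (v + q + 1) + (n + 1) * (w + q + m)) •
        ins q (ins m (ins n h w g) v f) u M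
  have t₃ : ∑ l ∈ Finset.range p, ∑ t ∈ Finset.range (p - 1 - l),
      (-1 : ℤ) ^ ((q + m - 1 + 1) * l + (n + 1) * (l + 1 + t + (q + m - 1) + 1)) •
        ins (q + m - 1) (ins n h (l + 1 + t) g) l (preLie q m M f) =
      brace p (q + m - 1) n h (preLie q m M f) g :=
    sum_range_triangle p fun i j =>
      (-1 : ℤ) ^ ((q + m - 1 + 1) * i + (n + 1) * (j + (q + m - 1) + 1)) •
        ins (q + m - 1) (ins n h j g) i (preLie q m M f)
  have t₄ : brace (p + q - 1) m n (preLie p q h M) f g = ∑ l ∈ Finset.range p,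
      ∑ j ∈ Finset.range (p + q - 1), ∑ i ∈ Finset.range j,
        (-1 : ℤ) ^ ((m + 1) * i + (n + 1) * (j + m + 1)) • (-1 : ℤ) ^ ((q + 1) * l) •
          ins m (ins n (ins q h l M) j g) i f := by
    rw [brace, preLie]
    simp only [ins_sum_left, ins_zsmul_left, Finset.smul_sum]
    rw [Finset.sum_comm (s := Finset.range p)]
    exact Finset.sum_congr rfl fun j _ => Finset.sum_comm
  rw [t₄, Finset.sum_congr rfl key]
  simp only [Finset.sum_add_distrib, ← Finset.smul_sum, t₁, t₂, t₃]
  rfl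

end Braces

/-! ### The Gerstenhaber bracket and the Jacobi identity -/

section Bracket

variable {K L : Type*} [CommRing K] [AddCommGroup L] [Module K L]

/-- Signs have to agree only in front of a nonzero operation. The nonvanishing bounds the arities
from below, so that truncated differences such as `n + p - 1` have the right parity. -/
lemma neg_one_pow_smul_congr {a b : ℕ} {x : (ℕ → L) → L}
    (h : x ≠ 0 → (a : ZMod 2) = b) : (-1 : ℤ) ^ a • x = (-1 : ℤ) ^ b • x := by
  by_cases hx : x = 0
  · simp [hx]
  · rw [neg_one_pow_congr (h hx)]

lemma preLie_ne_zero {m n : ℕ} {f g : (ℕ → L) → L} (h : preLie m n f g ≠ 0) : 0 < m := by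
  rcases m with - | m
  · simp [preLie] at h
  · omega

lemma brace_ne_zero {m n p : ℕ} {f g h : (ℕ → L) → L} (hb : brace m n p f g h ≠ 0) : 2 ≤ m := by
  rcases m with - | - | m
  · simp [brace] at hb
  · simp [brace] at hb
  · omega

lemma preLie_sub_left (m n : ℕ) (f f' g : (ℕ → L) → L) :
    preLie m n (f - f') g = preLie m n f g - preLie m n f' g := by
  simp only [preLie, ← Finset.sum_sub_distrib, ← smul_sub]
  rfl

lemma preLie_zsmul_left (m n : ℕ) (c : ℤ) (f g : (ℕ → L) → L) :
    preLie m n (c • f) g = c • preLie m n f g := by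
  simp only [preLie, ins_zsmul_left, Finset.smul_sum, smul_comm c]

lemma preLie_zero_left (m n : ℕ) (g : (ℕ → L) → L) : preLie m n 0 g = 0 := by
  simpa using preLie_sub_left m n 0 0 g

lemma preLie_sub_right {m : ℕ} (n : ℕ) {f : (ℕ → L) → L} (hf : f ∈ Oper K L m)
    (g g' : (ℕ → L) → L) : preLie m n f (g - g') = preLie m n f g - preLie m n f g' := by
  simp only [preLie, ← Finset.sum_sub_distrib, ← smul_sub]
  exact Finset.sum_congr rfl fun i hi => by
    simp only [← insHom_apply hf (Finset.mem_range.1 hi), map_sub]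

lemma preLie_zsmul_right {m : ℕ} (n : ℕ) {f : (ℕ → L) → L} (hf : f ∈ Oper K L m) (c : ℤ)
    (g : (ℕ → L) → L) : preLie m n f (c • g) = c • preLie m n f g := by
  simp only [preLie, Finset.smul_sum, smul_comm c]
  exact Finset.sum_congr rfl fun i hi => by
    simp only [← insHom_apply hf (Finset.mem_range.1 hi), map_zsmul]

lemma preLie_zero_right {m : ℕ} (n : ℕ) {f : (ℕ → L) → L} (hf : f ∈ Oper K L m) :
    preLie m n f 0 = 0 := by
  simpa using preLie_sub_right n hf 0 0

lemma brace_zsmul_left (m n p : ℕ) (c : ℤ) (f g h : (ℕ → L) → L) :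
    brace m n p (c • f) g h = c • brace m n p f g h := by
  simp only [brace, ins_zsmul_left, Finset.smul_sum, smul_comm c]

lemma brace_zero_left (m n p : ℕ) (g h : (ℕ → L) → L) : brace m n p 0 g h = 0 := by
  simpa using brace_zsmul_left m n p 0 0 g h

lemma brace_sub_middle {m p : ℕ} (n : ℕ) {f h : (ℕ → L) → L} (hf : f ∈ Oper K L m)
    (hh : h ∈ Oper K L p) (g g' : (ℕ → L) → L) :
    brace m n p f (g - g') h = brace m n p f g h - brace m n p f g' h := by
  simp only [brace, ← Finset.sum_sub_distrib, ← smul_sub]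
  exact Finset.sum_congr rfl fun j hj => Finset.sum_congr rfl fun i hi => by
    rw [Finset.mem_range] at hi hj
    simp only [← insHom_apply (ins_mem hf hh hj) (by omega : i < m + p - 1), map_sub]

lemma brace_zsmul_middle {m p : ℕ} (n : ℕ) {f h : (ℕ → L) → L} (hf : f ∈ Oper K L m)
    (hh : h ∈ Oper K L p) (c : ℤ) (g : (ℕ → L) → L) :
    brace m n p f (c • g) h = c • brace m n p f g h := by
  simp only [brace, Finset.smul_sum, smul_comm c]
  exact Finset.sum_congr rfl fun j hj => Finset.sum_congr rfl fun i hi => by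
    rw [Finset.mem_range] at hi hj
    simp only [← insHom_apply (ins_mem hf hh hj) (by omega : i < m + p - 1), map_zsmul]

lemma brace_sub_right {m : ℕ} (n p : ℕ) {f : (ℕ → L) → L} (hf : f ∈ Oper K L m)
    (g h h' : (ℕ → L) → L) :
    brace m n p f g (h - h') = brace m n p f g h - brace m n p f g h' := by
  simp only [brace, ← Finset.sum_sub_distrib, ← smul_sub]
  exact Finset.sum_congr rfl fun j hj => Finset.sum_congr rfl fun i hi => by
    rw [Finset.mem_range] at hi hj
    simp only [← insHom_apply hf hj, map_sub]
    rfl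

lemma brace_zsmul_right {m : ℕ} (n p : ℕ) {f : (ℕ → L) → L} (hf : f ∈ Oper K L m) (c : ℤ)
    (g h : (ℕ → L) → L) : brace m n p f g (c • h) = c • brace m n p f g h := by
  simp only [brace, Finset.smul_sum, smul_comm c]
  exact Finset.sum_congr rfl fun j hj => Finset.sum_congr rfl fun i hi => by
    rw [Finset.mem_range] at hi hj
    simp only [← insHom_apply hf hj, map_zsmul]
    rfl

/-- The Gerstenhaber bracket `[f, g] = f • g - (-1)^{(m-1)(n-1)} g • f` of operations with `m` and
`n` arguments. -/
def gBracket (m n : ℕ) (f g : (ℕ → L) → L) : (ℕ → L) → L :=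
  preLie m n f g - (-1 : ℤ) ^ ((m + 1) * (n + 1)) • preLie n m g f

lemma gBracket_def (m n : ℕ) (f g : (ℕ → L) → L) : gBracket m n f g =
    preLie m n f g - (-1 : ℤ) ^ ((m + 1) * (n + 1)) • preLie n m g f := rfl

lemma gBracket_ne_zero {m n : ℕ} {f g : (ℕ → L) → L} (h : gBracket m n f g ≠ 0) : 0 < m + n := by
  by_contra h'
  obtain ⟨rfl, rfl⟩ : m = 0 ∧ n = 0 := by omega
  simp [gBracket, preLie] at h

lemma neg_one_pow_mul_self (a : ℕ) : (-1 : ℤ) ^ a * (-1) ^ a = 1 := by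
  rw [← mul_pow]; simp

lemma gBracket_skew (m n : ℕ) (f g : (ℕ → L) → L) :
    gBracket m n f g = -((-1 : ℤ) ^ ((m + 1) * (n + 1)) • gBracket n m g f) := by
  rw [gBracket, gBracket, smul_sub, smul_smul, mul_comm (n + 1), neg_one_pow_mul_self, one_smul,
    neg_sub]

lemma gBracket_zsmul_left {m n : ℕ} (c : ℤ) (f : (ℕ → L) → L) {g : (ℕ → L) → L}
    (hg : g ∈ Oper K L n) : gBracket m n (c • f) g = c • gBracket m n f g := by
  rw [gBracket, gBracket, preLie_zsmul_left, preLie_zsmul_right _ hg, smul_sub, smul_comm c]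

/-- The associator of the pre-Lie product is graded symmetric in its last two arguments. -/
lemma preLie_symm {m n p : ℕ} {f g h : (ℕ → L) → L} (hf : f ∈ Oper K L m)
    (hg : g ∈ Oper K L n) (hh : h ∈ Oper K L p) :
    preLie (m + n - 1) p (preLie m n f g) h - preLie m (n + p - 1) f (preLie n p g h) =
      (-1 : ℤ) ^ ((n + 1) * (p + 1)) • (preLie (m + p - 1) n (preLie m p f h) g -
        preLie m (n + p - 1) f (preLie p n h g)) := by
  have h₁ := preLie_assoc (h := h) hf hg (p := p)
  have h₂ := preLie_assoc (h := g) hf hh (p := n)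
  rw [add_comm p n] at h₂
  rw [h₁, h₂, mul_comm (p + 1)]
  simp only [smul_sub, smul_add, smul_smul, neg_one_pow_mul_self]
  module

/-- The graded Jacobi identity, from the symmetry of the associator of the pre-Lie product. -/
theorem gBracket_jacobi {m n p : ℕ} {f g h : (ℕ → L) → L} (hf : f ∈ Oper K L m)
    (hg : g ∈ Oper K L n) (hh : h ∈ Oper K L p) :
    gBracket m (n + p - 1) f (gBracket n p g h) =
      gBracket (m + n - 1) p (gBracket m n f g) h +
        (-1 : ℤ) ^ ((m + 1) * (n + 1)) • gBracket n (m + p - 1) g (gBracket m p f h) := by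
  -- The three associators in which `f`, `g` and `h`, respectively, receive the other two.
  have r₁ := preLie_symm hf hg hh
  have r₂ := preLie_symm hg hf hh
  have r₃ := preLie_symm hh hf hg
  rw [add_comm n m] at r₂
  rw [add_comm p m, add_comm p n] at r₃
  have sign : ∀ a b c d : ℕ, 0 < a + b → ((c + 1) * (a + b - 1 + 1) : ℕ) = (d : ZMod 2) →
      (((c + 1) * (a + 1) + (c + 1) * (b + 1) : ℕ) : ZMod 2) = d := fun a b c d h e => by
    rw [← e, show a + b - 1 + 1 = a + b by omega]
    push_cast
    generalize (a : ZMod 2) = a, (b : ZMod 2) = b, (c : ZMod 2) = c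
    decide +revert
  -- The truncated arity `n + p - 1` of `[g, h]` enters the sign of the outer bracket; it is wrong
  -- only for `n = p = 0`, where `[g, h] = 0`.
  have s₁ : (-1 : ℤ) ^ ((m + 1) * (n + p - 1 + 1)) • gBracket n p g h =
      (-1 : ℤ) ^ ((m + 1) * (n + 1) + (m + 1) * (p + 1)) • gBracket n p g h :=
    neg_one_pow_smul_congr fun hx => (sign _ _ _ _ (gBracket_ne_zero hx) rfl).symm
  have s₂ : (-1 : ℤ) ^ ((p + 1) * (m + n - 1 + 1)) • gBracket m n f g =
      (-1 : ℤ) ^ ((p + 1) * (m + 1) + (p + 1) * (n + 1)) • gBracket m n f g :=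
    neg_one_pow_smul_congr fun hx => (sign _ _ _ _ (gBracket_ne_zero hx) rfl).symm
  have s₃ : (-1 : ℤ) ^ ((n + 1) * (m + p - 1 + 1)) • gBracket m p f h =
      (-1 : ℤ) ^ ((n + 1) * (m + 1) + (n + 1) * (p + 1)) • gBracket m p f h :=
    neg_one_pow_smul_congr fun hx => (sign _ _ _ _ (gBracket_ne_zero hx) rfl).symm
  rw [gBracket_def m (n + p - 1), gBracket_def (m + n - 1) p, gBracket_def n (m + p - 1),
    ← preLie_zsmul_left, s₁, mul_comm (m + n - 1 + 1), ← preLie_zsmul_right _ hh, s₂,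
    ← preLie_zsmul_left, s₃]
  simp only [gBracket, preLie_zsmul_left, preLie_sub_left, preLie_sub_right _ hf,
    preLie_sub_right _ hg, preLie_sub_right _ hh, preLie_zsmul_right _ hf,
    preLie_zsmul_right _ hg, preLie_zsmul_right _ hh, pow_add, mul_comm (n + 1) (m + 1),
    mul_comm (p + 1) (m + 1), mul_comm (p + 1) (n + 1)] at r₁ r₂ r₃ ⊢
  have q := neg_one_pow_mul_self ((m + 1) * (n + 1))
  generalize (-1 : ℤ) ^ ((m + 1) * (n + 1)) = a at *
  generalize (-1 : ℤ) ^ ((m + 1) * (p + 1)) = b at *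
  generalize (-1 : ℤ) ^ ((n + 1) * (p + 1)) = c at *
  rw [sub_eq_iff_eq_add] at r₁ r₂ r₃
  rw [r₁, r₂, r₃]
  rcases mul_self_eq_one_iff.1 q with rfl | rfl <;> module

end Bracket

/-! ### The cup product and the differential of an associative operation -/

section Hochschild

variable {K L : Type*} [CommRing K] [AddCommGroup L] [Module K L]

/-- The cup product `μ(f(a₀, …, a_{m-1}), g(a_m, …))` of operations with respect to a binary
operation `μ`. -/
def opCup (μ : (ℕ → L) → L) (m n : ℕ) (f g : (ℕ → L) → L) : (ℕ → L) → L :=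
  ins m (ins n μ 1 g) 0 f

lemma opCup_apply {μ : (ℕ → L) → L} (hμ : μ ∈ Oper K L 2) (m n : ℕ) (f g : (ℕ → L) → L)
    (a : ℕ → L) :
    opCup μ m n f g a = μ (fun j => if j = 0 then f a else g fun l => a (m + l)) := by
  simp only [opCup, ins_apply, zero_add]
  refine oper_congr hμ fun j hj => ?_
  obtain rfl | rfl : j = 0 ∨ j = 1 := by omega
  · rw [insArgs_of_lt (by omega), insArgs_self, if_pos rfl]
  · rw [insArgs_self, if_neg (by omega)]
    congr 1
    funext l
    rw [insArgs_of_gt (by omega)]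
    congr 1; omega

lemma opCup_mem {μ : (ℕ → L) → L} (hμ : μ ∈ Oper K L 2) {m n : ℕ} {f g : (ℕ → L) → L}
    (hf : f ∈ Oper K L m) (hg : g ∈ Oper K L n) : opCup μ m n f g ∈ Oper K L (m + n) := by
  have := ins_mem (ins_mem hμ hg (by omega : 1 < 2)) hf (by omega : 0 < 2 + n - 1)
  rwa [show 2 + n - 1 + m - 1 = m + n by omega] at this

/-- A binary operation has only one pair of slots, so its brace is, up to sign, the cup product. -/
lemma brace_two (μ : (ℕ → L) → L) (m n : ℕ) (f g : (ℕ → L) → L) :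
    brace 2 m n μ f g = (-1 : ℤ) ^ (m * (n + 1)) • opCup μ m n f g := by
  simp only [brace, Finset.sum_range_succ, Finset.range_zero, Finset.sum_empty, zero_add, opCup]
  refine smul_ins_congr ?_ rfl
  push_cast
  generalize (n : ZMod 2) = n, (m : ZMod 2) = m
  decide +revert

lemma opCup_zsmul_left (μ : (ℕ → L) → L) {n : ℕ} (hμ : μ ∈ Oper K L 2) {g : (ℕ → L) → L}
    (hg : g ∈ Oper K L n) (m : ℕ) (c : ℤ) (f : (ℕ → L) → L) :
    opCup μ m n (c • f) g = c • opCup μ m n f g := by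
  simp only [opCup, ← insHom_apply (ins_mem hμ hg one_lt_two) (by omega : 0 < 2 + n - 1),
    map_zsmul]

lemma opCup_zsmul_right (μ : (ℕ → L) → L) (hμ : μ ∈ Oper K L 2) (m n : ℕ) (c : ℤ)
    (f g : (ℕ → L) → L) :
    opCup μ m n f (c • g) = c • opCup μ m n f g := by
  simp only [opCup, ← insHom_apply hμ one_lt_two n, map_zsmul]
  rfl

/-- The combination of `preLie_brace` and `brace_preLie` in which the triple insertions cancel. -/
theorem brace_deriv {p q m n : ℕ} {h M f g : (ℕ → L) → L} (hh : h ∈ Oper K L p)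
    (hM : M ∈ Oper K L q) (hf : f ∈ Oper K L m) (hg : g ∈ Oper K L n) :
    brace (p + q - 1) m n (preLie p q h M) f g -
        (-1 : ℤ) ^ ((q + 1) * (m + n)) • preLie (p + m + n - 2) q (brace p m n h f g) M =
      preLie p (q + m + n - 2) h (brace q m n M f g) +
      brace p (q + m - 1) n h (gBracket q m M f) g +
      (-1 : ℤ) ^ ((m + 1) * (q + 1)) • brace p m (q + n - 1) h f (gBracket q n M g) := by
  rw [preLie_brace hh hM hg, brace_preLie hh hf hg, gBracket, gBracket,
    brace_sub_middle _ hh hg, brace_zsmul_middle _ hh hg, brace_sub_right _ _ hh,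
    brace_zsmul_right _ _ hh, add_comm m q, add_comm n q]
  simp only [smul_add, smul_sub, smul_smul, ← pow_add]
  rw [neg_one_pow_congr (a := (q + 1) * (m + n) + (q + 1) * (n + 1)) (b := (q + 1) * (m + 1)),
    neg_one_pow_congr (a := (m + 1) * (q + 1) + (q + 1) * (n + 1)) (b := (q + 1) * (m + n)),
    neg_one_pow_congr (a := (q + 1) * (m + n) + (q + 1) * (m + n)) (b := 0)]
  · module
  all_goals
    push_cast
    generalize (n : ZMod 2) = n, (m : ZMod 2) = m, (q : ZMod 2) = q
    decide +revert

variable {μ : (ℕ → L) → L}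

lemma preLie_self_of_assoc (hassoc : ins 2 μ 0 μ = ins 2 μ 1 μ) : preLie 2 2 μ μ = 0 := by
  simp [preLie, Finset.sum_range_succ, hassoc]

/-- The Hochschild differential, up to sign, is the bracket with `μ`; it squares to zero. -/
theorem gBracket_gBracket_mul (hμ : μ ∈ Oper K L 2) (hassoc : ins 2 μ 0 μ = ins 2 μ 1 μ) {m : ℕ}
    {f : (ℕ → L) → L} (hf : f ∈ Oper K L m) :
    gBracket (m + 1) 2 (gBracket m 2 f μ) μ = 0 := by
  have h₁ := preLie_assoc (h := μ) (p := 2) hf hμ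
  have h₂ := preLie_assoc (h := μ) (p := 2) hμ hf
  have h₃ := preLie_assoc (h := f) (p := m) hμ hμ
  rw [preLie_self_of_assoc hassoc] at h₁ h₃
  rw [preLie_zero_right _ hf] at h₁
  rw [preLie_zero_left] at h₃
  simp only [show m + 2 - 1 = m + 1 by omega, show 2 + m - 1 = m + 1 by omega] at h₁ h₂ h₃
  rw [gBracket, gBracket, preLie_sub_left, preLie_zsmul_left, preLie_sub_right _ hμ,
    preLie_zsmul_right _ hμ, h₁, h₂]
  rw [eq_comm, add_eq_zero_iff_eq_neg] at h₃
  rw [h₃, mul_comm (2 + 1) (m + 1), neg_one_pow_congr (a := (m + 1) * (2 + 1)) (b := m + 1),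
    neg_one_pow_congr (a := (m + 1 + 1) * (2 + 1)) (b := m), pow_succ (-1 : ℤ) m]
  · rcases neg_one_pow_eq_or ℤ m with hm | hm <;> rw [hm] <;> module
  all_goals
    push_cast
    generalize (m : ZMod 2) = m
    decide +revert

/-- The bracket with `μ` is a derivation of the cup product. -/
theorem gBracket_opCup (hμ : μ ∈ Oper K L 2) (hassoc : ins 2 μ 0 μ = ins 2 μ 1 μ) {m n : ℕ}
    {f g : (ℕ → L) → L} (hf : f ∈ Oper K L m) (hg : g ∈ Oper K L n) :
    gBracket (m + n) 2 (opCup μ m n f g) μ = opCup μ (m + 1) n (gBracket m 2 f μ) g +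
      (-1 : ℤ) ^ m • opCup μ m (n + 1) f (gBracket n 2 g μ) := by
  have h := brace_deriv hμ hμ hf hg
  rw [preLie_self_of_assoc hassoc, brace_zero_left, gBracket_skew 2 m, gBracket_skew 2 n] at h
  simp only [show 2 + m - 1 = m + 1 by omega, show 2 + n - 1 = n + 1 by omega,
    show 2 + m + n - 2 = m + n by omega, brace_two, ← neg_smul, opCup_zsmul_left μ hμ hg,
    opCup_zsmul_right μ hμ, preLie_zsmul_left, preLie_zsmul_right _ hμ] at h
  rw [gBracket]
  rw [neg_one_pow_congr (a := (2 + 1) * (m + n)) (b := m + n),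
    neg_one_pow_congr (a := (2 + 1) * (m + 1)) (b := m + 1),
    neg_one_pow_congr (a := (m + 1) * (2 + 1)) (b := m + 1),
    neg_one_pow_congr (a := (2 + 1) * (n + 1)) (b := n + 1),
    neg_one_pow_congr (a := (m + 1) * (n + 1)) (b := m * n + m + n + 1),
    neg_one_pow_congr (a := m * (n + 1 + 1)) (b := m * n),
    neg_one_pow_congr (a := m * (n + 1)) (b := m * n + m)] at h
  · rw [neg_one_pow_congr (a := (m + n + 1) * (2 + 1)) (b := m + n + 1)]
    · simp only [pow_add, pow_one] at h ⊢
      rcases neg_one_pow_eq_or ℤ m with hm | hm <;> rcases neg_one_pow_eq_or ℤ n with hn | hn <;>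
      rcases neg_one_pow_eq_or ℤ (m * n) with hq | hq <;>
      · rw [hm, hn, hq] at h
        rw [hm, hn]
        first
          | linear_combination (norm := module) h
          | linear_combination (norm := module) -h
    · push_cast
      generalize (m : ZMod 2) = m, (n : ZMod 2) = n
      decide +revert
  all_goals
    push_cast
    generalize (m : ZMod 2) = m, (n : ZMod 2) = n
    decide +revert

/-- The pre-Lie product of two cocycles is a homotopy for the graded commutativity of the cup
product. As `f • μ = ±μ • f` and `g • μ = ±μ • g`, the claim reduces to the associator of `μ`, `f`
and `g`, which by `preLie_assoc` and `brace_two` is the sum of the two cup products. -/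
theorem gBracket_preLie (hμ : μ ∈ Oper K L 2) {m n : ℕ} {f g : (ℕ → L) → L}
    (hf : f ∈ Oper K L m) (hg : g ∈ Oper K L n) (hfμ : gBracket m 2 f μ = 0)
    (hgμ : gBracket n 2 g μ = 0) :
    gBracket (m + n - 1) 2 (preLie m n f g) μ = (-1 : ℤ) ^ (n * (m + 1)) •
      (opCup μ m n f g - (-1 : ℤ) ^ (m * n) • opCup μ n m g f) := by
  have h₁ := preLie_symm hf hg hμ
  have h₂ := preLie_assoc (h := g) (p := n) hμ hf
  rw [gBracket_def, sub_eq_zero] at hfμ hgμ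
  have s : (-1 : ℤ) ^ ((m + n - 1 + 1) * (2 + 1)) • preLie m n f g =
      (-1 : ℤ) ^ (m + n) • preLie m n f g := neg_one_pow_smul_congr fun hx => by
    rw [show m + n - 1 + 1 = m + n by have := preLie_ne_zero hx; omega]
    push_cast
    generalize (m : ZMod 2) = m, (n : ZMod 2) = n
    decide +revert
  rw [gBracket_def, ← preLie_zsmul_right _ hμ, s, preLie_zsmul_right _ hμ,
    sub_eq_iff_eq_add.1 h₁, hfμ, hgμ]
  simp only [show n + 2 - 1 = n + 1 by omega, show m + 2 - 1 = m + 1 by omega,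
    show 2 + m - 1 = m + 1 by omega] at h₂ ⊢
  rw [preLie_zsmul_left, h₂,
    preLie_zsmul_right _ hf, brace_two, brace_two]
  rw [neg_one_pow_congr (a := (n + 1) * (2 + 1)) (b := n + 1),
    neg_one_pow_congr (a := (m + 1) * (2 + 1)) (b := m + 1),
    neg_one_pow_congr (a := (m + 1) * (n + 1)) (b := m * n + m + n + 1),
    neg_one_pow_congr (a := m * (n + 1)) (b := m * n + m),
    neg_one_pow_congr (a := n * (m + 1)) (b := m * n + n)]
  · simp only [pow_add, pow_one]
    rcases neg_one_pow_eq_or ℤ m with hm | hm <;> rcases neg_one_pow_eq_or ℤ n with hn | hn <;>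
    rcases neg_one_pow_eq_or ℤ (m * n) with hq | hq <;> rw [hm, hn, hq] <;> module
  all_goals
    push_cast
    generalize (m : ZMod 2) = m, (n : ZMod 2) = n
    decide +revert

/-- For cocycles, the brace `h{f, g}` is a homotopy for the graded Leibniz rule: `brace_deriv`
computes both `(h • μ){f, g}` and `(μ • h){f, g}`, and these agree up to sign since `h` is a
cocycle. -/
theorem gBracket_brace (hμ : μ ∈ Oper K L 2) {m n p : ℕ} {f g h : (ℕ → L) → L}
    (hf : f ∈ Oper K L m) (hg : g ∈ Oper K L n) (hh : h ∈ Oper K L p)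
    (hfμ : gBracket m 2 f μ = 0) (hgμ : gBracket n 2 g μ = 0) (hhμ : gBracket p 2 h μ = 0) :
    gBracket (m + n) p (opCup μ m n f g) h =
      opCup μ (m + p - 1) n (gBracket m p f h) g +
      (-1 : ℤ) ^ (m * (p + 1)) • opCup μ m (n + p - 1) f (gBracket n p g h) +
      (-1 : ℤ) ^ ((m + n + 1) * (p + 1) + n + m * n) •
        gBracket (p + m + n - 2) 2 (brace p m n h f g) μ := by
  have h₁ := brace_deriv hh hμ hf hg
  have h₂ := brace_deriv hμ hh hf hg
  rw [gBracket_skew 2 m, gBracket_skew 2 n, hfμ, hgμ] at h₁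
  have z₁ : brace p (2 + m - 1) n h 0 g = 0 := by
    simpa using brace_sub_middle (2 + m - 1) hh hg 0 0
  have z₂ : brace p m (2 + n - 1) h f 0 = 0 := by
    simpa using brace_sub_right m (2 + n - 1) hh f 0 0
  rw [smul_zero, neg_zero, smul_zero, neg_zero, z₁, z₂, smul_zero, add_zero, add_zero] at h₁
  rw [gBracket_def, sub_eq_zero] at hhμ
  rw [gBracket_skew p m, gBracket_skew p n] at h₂
  simp only [hhμ, show 2 + m + n - 2 = m + n by omega, brace_zsmul_left, brace_two,
    ← neg_smul, opCup_zsmul_left μ hμ hg, opCup_zsmul_right μ hμ, preLie_zsmul_left,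
    preLie_zsmul_right _ hh, add_comm 2 p] at h₁ h₂
  -- As in `gBracket_jacobi`, the truncated arities are harmless because they are wrong only where
  -- the operations vanish.
  have s₁ : (-1 : ℤ) ^ ((p + m + n - 2 + 1) * (2 + 1)) • brace p m n h f g =
      (-1 : ℤ) ^ (p + m + n + 1) • brace p m n h f g := neg_one_pow_smul_congr fun hx => by
    have := brace_ne_zero hx
    obtain ⟨d, rfl⟩ : ∃ d, p = d + 2 := ⟨p - 2, by omega⟩
    rw [show d + 2 + m + n - 2 = d + m + n by omega]
    push_cast
    generalize (m : ZMod 2) = m, (n : ZMod 2) = n, (d : ZMod 2) = d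
    decide +revert
  have s₂ : (-1 : ℤ) ^ (m * (p + n - 1 + 1)) • gBracket n p g h =
      (-1 : ℤ) ^ (m * (p + n)) • gBracket n p g h := neg_one_pow_smul_congr fun hx => by
    have := gBracket_ne_zero hx
    rw [show p + n - 1 + 1 = p + n by omega]
  have s₃ : (-1 : ℤ) ^ ((p + m - 1) * (n + 1)) • gBracket m p f h =
      (-1 : ℤ) ^ ((p + m + 1) * (n + 1)) • gBracket m p f h := neg_one_pow_smul_congr fun hx => by
    have := gBracket_ne_zero hx
    obtain ⟨d, hd⟩ : ∃ d, p + m = d + 1 := ⟨p + m - 1, by omega⟩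
    rw [hd, show d + 1 - 1 = d by omega]
    push_cast
    generalize (n : ZMod 2) = n, (d : ZMod 2) = d
    decide +revert
  have t₂ := congrArg (opCup μ m (p + n - 1) f) s₂
  have t₃ := congrArg (fun x => opCup μ (p + m - 1) n x g) s₃
  simp only [opCup_zsmul_right μ hμ, opCup_zsmul_left μ hμ hg] at t₂ t₃
  rw [smul_comm ((-1 : ℤ) ^ (m * (p + n - 1 + 1))) (-(-1 : ℤ) ^ ((p + 1) * (n + 1))), t₂,
    smul_comm ((-1 : ℤ) ^ ((p + m - 1) * (n + 1))) (-(-1 : ℤ) ^ ((p + 1) * (m + 1))), t₃] at h₂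
  rw [gBracket_def (m + n), gBracket_def (p + m + n - 2), ← preLie_zsmul_right _ hμ, s₁,
    preLie_zsmul_right _ hμ, add_comm m p, add_comm n p]
  generalize opCup μ (p + m - 1) n (gBracket m p f h) g = x₁ at *
  generalize opCup μ m (p + n - 1) f (gBracket n p g h) = x₂ at *
  generalize preLie 2 (p + m + n - 2) μ (brace p m n h f g) = x₃ at *
  generalize preLie (p + m + n - 2) 2 (brace p m n h f g) μ = x₄ at *
  generalize preLie (m + n) p (opCup μ m n f g) h = x₅ at *
  generalize preLie p (m + n) h (opCup μ m n f g) = x₆ at *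
  generalize brace (p + 2 - 1) m n (preLie 2 p μ h) f g = x₇ at *
  rw [neg_one_pow_congr (a := (p + 1) * (2 + 1)) (b := p + 1),
    neg_one_pow_congr (a := (2 + 1) * (m + n)) (b := m + n),
    neg_one_pow_congr (a := m * (n + 1)) (b := m * n + m)] at h₁
  · rw [neg_one_pow_congr (a := (p + 1) * (m + n)) (b := m * p + n * p + m + n),
      neg_one_pow_congr (a := m * (n + 1)) (b := m * n + m),
      neg_one_pow_congr (a := (p + 1) * (m + 1)) (b := m * p + m + p + 1),
      neg_one_pow_congr (a := (p + m + 1) * (n + 1)) (b := n * p + m * n + n + p + m + 1),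
      neg_one_pow_congr (a := (m + 1) * (p + 1)) (b := m * p + m + p + 1),
      neg_one_pow_congr (a := (p + 1) * (n + 1)) (b := n * p + n + p + 1),
      neg_one_pow_congr (a := m * (p + n)) (b := m * p + m * n)] at h₂
    · rw [neg_one_pow_congr (a := (m + n + 1) * (p + 1)) (b := m * p + n * p + m + n + p + 1),
        neg_one_pow_congr (a := m * (p + 1)) (b := m * p + m),
        neg_one_pow_congr (a := (m + n + 1) * (p + 1) + n + m * n)
          (b := m * p + n * p + m * n + m + p + 1)]
      · simp only [pow_add, pow_one] at h₁ h₂ ⊢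
        have hm := neg_one_pow_eq_or ℤ m
        have hn := neg_one_pow_eq_or ℤ n
        have hp := neg_one_pow_eq_or ℤ p
        have hmn := neg_one_pow_eq_or ℤ (m * n)
        have hmp := neg_one_pow_eq_or ℤ (m * p)
        have hnp := neg_one_pow_eq_or ℤ (n * p)
        generalize (-1 : ℤ) ^ (m * n) = a₁ at *
        generalize (-1 : ℤ) ^ (m * p) = a₂ at *
        generalize (-1 : ℤ) ^ (n * p) = a₃ at *
        generalize (-1 : ℤ) ^ m = b₁ at *
        generalize (-1 : ℤ) ^ n = b₂ at *
        generalize (-1 : ℤ) ^ p = b₃ at *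
        -- Up to signs, the claim is the sum of `h₁` and `h₂`; the six signs may be treated as
        -- independent.
        clear * - h₁ h₂ hm hn hp hmn hmp hnp
        rcases hm with rfl | rfl <;> rcases hn with rfl | rfl <;> rcases hp with rfl | rfl <;>
        rcases hmn with rfl | rfl <;> rcases hmp with rfl | rfl <;>
        rcases hnp with rfl | rfl <;>
        · simp only [mul_one, mul_neg, neg_neg, one_smul, neg_smul] at h₁ h₂ ⊢
          rw [sub_eq_iff_eq_add] at h₁
          first
            | linear_combination (norm := abel1) h₁ + h₂
            | linear_combination (norm := abel1) h₁ - h₂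
            | linear_combination (norm := abel1) h₂ - h₁
            | linear_combination (norm := abel1) -h₁ - h₂
      all_goals
        push_cast
        generalize (m : ZMod 2) = m, (n : ZMod 2) = n, (p : ZMod 2) = p
        decide +revert
    all_goals
      push_cast
      generalize (m : ZMod 2) = m, (n : ZMod 2) = n, (p : ZMod 2) = p
      decide +revert
  all_goals
    push_cast
    generalize (m : ZMod 2) = m, (n : ZMod 2) = n, (p : ZMod 2) = p
    decide +revert

end Hochschild

/-! ### The direct sum of the evaluated modules -/

section EvSum

variable {k : Type*} [Field k] {A : Type*} [AddCommGroup A] [Module k A]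
  (K : Type*) [CommRing K] [Algebra k K] (der : A →ₗ[k] A)

/-- The operator `∂ + s` on `K ⊗ A`. -/
def twist (s : K) : K ⊗[k] A →ₗ[K] K ⊗[k] A := der.baseChange K + s • LinearMap.id

/-- The quotient of `K ⊗ A` in which `∂` becomes the multiplication by `-s`. -/
def EvFiber (s : K) := K ⊗[k] A ⧸ LinearMap.range (twist K der s)

instance (s : K) : AddCommGroup (EvFiber K der s) :=
  inferInstanceAs (AddCommGroup (K ⊗[k] A ⧸ LinearMap.range (twist K der s)))

instance (s : K) : Module K (EvFiber K der s) :=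
  inferInstanceAs (Module K (K ⊗[k] A ⧸ LinearMap.range (twist K der s)))

/-- The quotient map `K ⊗ A → (K ⊗ A) / (∂ + s)(K ⊗ A)`. -/
def EvFiber.mk (s : K) : K ⊗[k] A →ₗ[K] EvFiber K der s :=
  Submodule.mkQ (LinearMap.range (twist K der s))

variable {K} in
/-- The linear map induced on the quotient. -/
def EvFiber.lift {s : K} {N : Type*} [AddCommGroup N] [Module K N] (F : K ⊗[k] A →ₗ[K] N)
    (h : ∀ u, F (twist K der s u) = 0) : EvFiber K der s →ₗ[K] N :=
  Submodule.liftQ (LinearMap.range (twist K der s)) F (by rintro _ ⟨u, rfl⟩; exact h u)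

lemma EvFiber.lift_mk {s : K} {N : Type*} [AddCommGroup N] [Module K N] (F : K ⊗[k] A →ₗ[K] N)
    (h : ∀ u, F (twist K der s u) = 0) (u : K ⊗[k] A) :
    EvFiber.lift der F h (EvFiber.mk K der s u) = F u := rfl

variable [DecidableEq K]

/-- The direct sum of the quotients `(K ⊗ A) / (∂ + s)(K ⊗ A)` over all `s ∈ K`. -/
abbrev EvSum := ⨁ s : K, EvFiber K der s

variable {K}

/-- The class of an element of `K ⊗ A` in the summand of index `s`. -/
def evClass (s : K) : K ⊗[k] A →ₗ[K] EvSum K der :=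
  DirectSum.lof K K (EvFiber K der) s ∘ₗ EvFiber.mk K der s

/-- The class of `1 ⊗ a` in the summand of index `s`. -/
def gen (s : K) (a : A) : EvSum K der := evClass der s (1 ⊗ₜ a)

/-- On the summand of index `s`, the derivation `∂` acts as `-s`. -/
lemma evClass_baseChange (s : K) (u : K ⊗[k] A) :
    evClass der s (der.baseChange K u) = -(s • evClass der s u) := by
  rw [← add_eq_zero_iff_eq_neg, ← map_smul, ← map_add, evClass, LinearMap.comp_apply,
    show der.baseChange K u + s • u = twist K der s u by simp [twist],
    show EvFiber.mk K der s (twist K der s u) = 0 from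
      (Submodule.Quotient.mk_eq_zero _).2 ⟨u, rfl⟩, map_zero]

lemma evClass_tmul (s p : K) (a : A) : evClass der s (p ⊗ₜ a) = p • gen der s a := by
  rw [gen, ← map_smul, TensorProduct.smul_tmul', smul_eq_mul, mul_one]

lemma evSum_hom_ext {N : Type*} [AddCommGroup N] [Module K N] {F G : EvSum K der →ₗ[K] N}
    (h : ∀ s a, F (gen der s a) = G (gen der s a)) : F = G := by
  refine DirectSum.linearMap_ext K fun s => Submodule.linearMap_qext _ (LinearMap.ext fun u => ?_)
  change F (evClass der s u) = G (evClass der s u)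
  induction u using TensorProduct.induction_on with
  | zero => simp
  | add x y hx hy => simp only [map_add, hx, hy]
  | tmul p a => rw [evClass_tmul, map_smul, map_smul, h]

/-- The universal property of `EvSum`: a linear map is given by its values `ψ s a` on the
generators, subject to `ψ s (∂a) = -s ψ s a`. -/
lemma exists_evSum_hom {N : Type*} [AddCommGroup N] [Module K N] (ψ : K → A → N)
    (hadd : ∀ s a b, ψ s (a + b) = ψ s a + ψ s b)
    (hsmul : ∀ s (c : k) a, ψ s (c • a) = algebraMap k K c • ψ s a)
    (hder : ∀ s a, ψ s (der a) = -(s • ψ s a)) :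
    ∃ F : EvSum K der →ₗ[K] N, ∀ s a, F (gen der s a) = ψ s a := by
  let _ : Module k N := Module.compHom N (algebraMap k K)
  have : IsScalarTower k K N := ⟨fun c x y => by
    rw [Algebra.smul_def, mul_smul]
    rfl⟩
  let ψ' : K → A →ₗ[k] N := fun s =>
    { toFun := ψ s
      map_add' := hadd s
      map_smul' := hsmul s }
  refine ⟨DirectSum.toModule K K N fun s =>
    EvFiber.lift der ((ψ' s).liftBaseChange K) fun u => ?_, fun s a => ?_⟩
  · induction u using TensorProduct.induction_on with
    | zero => simp
    | add x y hx hy => simp only [map_add, hx, hy, add_zero]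
    | tmul p a =>
      simp only [twist, LinearMap.add_apply, LinearMap.smul_apply, LinearMap.id_apply,
        LinearMap.baseChange_tmul, map_add, map_smul, LinearMap.liftBaseChange_tmul]
      change p • ψ s (der a) + s • p • ψ s a = 0
      rw [hder, smul_neg, smul_comm, neg_add_cancel]
  · rw [gen, evClass, LinearMap.comp_apply, DirectSum.toModule_lof,
      EvFiber.lift_mk, LinearMap.liftBaseChange_tmul, one_smul]
    rfl

/-- A multilinear operation is determined by its values on the generators. -/
lemma oper_ext {m : ℕ} {F G : (ℕ → EvSum K der) → EvSum K der} (hF : F ∈ Oper K (EvSum K der) m)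
    (hG : G ∈ Oper K (EvSum K der) m)
    (h : ∀ (γ : ℕ → K) (a : ℕ → A),
      F (fun j => gen der (γ j) (a j)) = G (fun j => gen der (γ j) (a j))) : F = G := by
  -- Induction on the number `t` of leading arguments which are not yet known to be generators.
  have key : ∀ t ≤ m, ∀ b : ℕ → EvSum K der, (∀ j, t ≤ j → ∃ s a, b j = gen der s a) →
      F b = G b := by
    intro t
    induction t with
    | zero =>
      intro _ b hb
      choose γ a hγ using fun j => hb j (Nat.zero_le j)
      rw [funext hγ]
      exact h γ a
    | succ t ih =>
      intro ht b hb
      have := evSum_hom_ext der (F := (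
          { toFun := fun x => F (Function.update b t x)
            map_add' := fun x y => hF.2.1 t ht b x y
            map_smul' := fun c x => hF.2.2 t ht b c x } : EvSum K der →ₗ[K] EvSum K der))
        (G := { toFun := fun x => G (Function.update b t x)
                map_add' := fun x y => hG.2.1 t ht b x y
                map_smul' := fun c x => hG.2.2 t ht b c x }) fun s a =>
          ih (Nat.le_of_succ_le ht) _ fun j hj => by
            rcases eq_or_ne j t with rfl | hj'
            · exact ⟨s, a, by simp⟩
            · rw [Function.update_of_ne hj']
              exact hb j (by omega)
      simpa using LinearMap.congr_fun this (b t)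
  funext b
  have hb : ∀ j < m, b j = if j < m then b j else gen der 0 0 := fun j hj => by rw [if_pos hj]
  rw [oper_congr hF hb, oper_congr hG hb]
  exact key m le_rfl _ fun j hj => ⟨0, 0, by rw [if_neg (by omega)]⟩

/-- The sequence `x, a₀, a₁, …`. -/
def consSeq {X : Type*} (x : X) (a : ℕ → X) : ℕ → X
  | 0 => x
  | j + 1 => a j

lemma consSeq_update {X : Type*} (x y : X) (a : ℕ → X) (i : ℕ) :
    consSeq x (Function.update a i y) = Function.update (consSeq x a) (i + 1) y := by
  funext j
  cases j with
  | zero => simp [consSeq]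
  | succ j => simp [consSeq, Function.update_apply]

lemma consSeq_update_zero {X : Type*} (x y : X) (a : ℕ → X) :
    Function.update (consSeq x a) 0 y = consSeq y a := by
  funext j
  cases j with
  | zero => simp [consSeq]
  | succ j => simp [consSeq]

lemma update_succ_tail {X : Type*} (a : ℕ → X) (i : ℕ) (x : X) :
    (fun j => Function.update a (i + 1) x (j + 1)) =
      Function.update (fun j => a (j + 1)) i x := by
  funext j
  simp [Function.update_apply]

/-- The families of maps in `m` arguments `(γ_j, a_j) ∈ K × A` which are multilinear over `k` and
sesquilinear with respect to `∂`, the parameter of the argument `a_j` being `γ_j`. -/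
structure IsSesquiFamily (m : ℕ) (φ : (ℕ → K) → (ℕ → A) → EvSum K der) : Prop where
  congr : ∀ γ γ' a a', (∀ j < m, γ j = γ' j) → (∀ j < m, a j = a' j) → φ γ a = φ γ' a'
  add : ∀ i < m, ∀ γ a x y, φ γ (Function.update a i (x + y)) =
    φ γ (Function.update a i x) + φ γ (Function.update a i y)
  smul : ∀ i < m, ∀ γ a (c : k) x, φ γ (Function.update a i (c • x)) =
    algebraMap k K c • φ γ (Function.update a i x)
  der : ∀ i < m, ∀ γ a x, φ γ (Function.update a i (der x)) =
    -(γ i • φ γ (Function.update a i x))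

/-- A sesquilinear family extends to a multilinear operation on `EvSum`. The induction separates the
first argument: for fixed `(γ₀, a₀)`, the operation in the other arguments exists, and it depends on
`(γ₀, a₀)` as the universal property of `EvSum` requires, by `oper_ext`. -/
theorem IsSesquiFamily.exists_oper {m : ℕ} {φ : (ℕ → K) → (ℕ → A) → EvSum K der}
    (h : IsSesquiFamily der m φ) :
    ∃ F ∈ Oper K (EvSum K der) m, ∀ γ a, F (fun j => gen der (γ j) (a j)) = φ γ a := by
  induction m generalizing φ with
  | zero =>
    exact ⟨fun _ => φ 0 0, ⟨fun _ _ _ => rfl, fun i hi => absurd hi (by omega),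
      fun i hi => absurd hi (by omega)⟩,
      fun γ a => h.congr _ _ _ _ (fun j hj => absurd hj (by omega))
        fun j hj => absurd hj (by omega)⟩
  | succ m ih =>
    have hs : ∀ (s : K) (x : A),
        IsSesquiFamily der m fun γ a => φ (consSeq s γ) (consSeq x a) := fun s x =>
      { congr := fun γ γ' a a' hγ ha => h.congr _ _ _ _
          (fun j hj => by cases j with
            | zero => rfl
            | succ j => exact hγ j (by omega))
          (fun j hj => by cases j with
            | zero => rfl
            | succ j => exact ha j (by omega))
        add := fun i hi γ a y z => by
          simp only [consSeq_update, h.add (i + 1) (by omega)]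
        smul := fun i hi γ a c y => by
          simp only [consSeq_update, h.smul (i + 1) (by omega)]
        der := fun i hi γ a y => by
          simp only [consSeq_update, h.der (i + 1) (by omega)]
          rfl }
    choose Ψ hΨ hΨ' using fun s x => ih (hs s x)
    have hu : ∀ (γ : ℕ → K) (a : ℕ → A) s x y, φ (consSeq s γ) (consSeq y a) =
        φ (consSeq s γ) (Function.update (consSeq x a) 0 y) := fun γ a s x y => by
      rw [consSeq_update_zero]
    obtain ⟨F, hF⟩ := exists_evSum_hom der (N := Oper K (EvSum K der) m)
      (fun s x => ⟨Ψ s x, hΨ s x⟩)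
      (fun s x y => Subtype.ext (oper_ext der (hΨ _ _)
        ((Oper K (EvSum K der) m).add_mem (hΨ s x) (hΨ s y)) fun γ a => by
          change Ψ s (x + y) _ = Ψ s x _ + Ψ s y _
          rw [hΨ', hΨ', hΨ', hu γ a s 0 (x + y), h.add 0 (by omega), ← hu, ← hu]))
      (fun s c x => Subtype.ext (oper_ext der (hΨ _ _)
        ((Oper K (EvSum K der) m).smul_mem (algebraMap k K c) (hΨ s x)) fun γ a => by
          change Ψ s (c • x) _ = algebraMap k K c • Ψ s x _
          rw [hΨ', hΨ', hu γ a s 0 (c • x), h.smul 0 (by omega), ← hu]))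
      (fun s x => Subtype.ext (oper_ext der (hΨ _ _)
        ((Oper K (EvSum K der) m).neg_mem ((Oper K (EvSum K der) m).smul_mem s (hΨ s x)))
          fun γ a => by
            change Ψ s (der x) _ = -(s • Ψ s x _)
            rw [hΨ', hΨ', hu γ a s 0 (der x), h.der 0 (by omega),
              ← hu]
            rfl))
    refine ⟨fun b => (F (b 0)).1 fun j => b (j + 1), ⟨fun b b' hb => ?_, fun i hi b x y => ?_,
      fun i hi b c x => ?_⟩, fun γ a => ?_⟩
    · dsimp only
      rw [hb 0 (by omega)]
      exact oper_congr (F (b' 0)).2 fun j hj => hb (j + 1) (by omega)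
    · cases i with
      | zero => simp
      | succ i =>
        simp only [update_succ_tail, Function.update_of_ne (Nat.succ_ne_zero i).symm]
        exact (F (b 0)).2.2.1 i (by omega) _ x y
    · cases i with
      | zero => simp
      | succ i =>
        simp only [update_succ_tail, Function.update_of_ne (Nat.succ_ne_zero i).symm]
        exact (F (b 0)).2.2.2 i (by omega) _ c x
    · dsimp only
      rw [hF]
      have := hΨ' (γ 0) (a 0) (fun j => γ (j + 1)) fun j => a (j + 1)
      refine this.trans ?_
      congr 1
      · funext j; cases j <;> rfl
      · funext j; cases j <;> rfl

end EvSum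

/-! ### Evaluation of sesquilinear maps -/

section Evaluation

variable {k : Type*} [Field k] {A : Type*} [AddCommGroup A] [Module k A]
  {K : Type*} [CommRing K] [Algebra k K]

variable (A) in
/-- The evaluation `A[x₀, …, x_{N-1}] → K ⊗ A` at `x_j = γ_j`. -/
def evalAt (γ : ℕ → K) (N : ℕ) : LPoly k A N →ₗ[k] K ⊗[k] A :=
  LinearMap.rTensor A (MvPolynomial.aeval fun i : Fin N => γ i).toLinearMap

lemma evalAt_tmul (γ : ℕ → K) (N : ℕ) (p : MvPolynomial (Fin N) k) (a : A) :
    evalAt A γ N (p ⊗ₜ a) = (MvPolynomial.aeval (fun i : Fin N => γ i) p) ⊗ₜ a := rfl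

lemma evalAt_smul (γ : ℕ → K) (N : ℕ) (p : MvPolynomial (Fin N) k) (w : LPoly k A N) :
    evalAt A γ N (p • w) = MvPolynomial.aeval (fun i : Fin N => γ i) p • evalAt A γ N w := by
  induction w using TensorProduct.induction_on with
  | zero => simp
  | add x y hx hy => simp only [smul_add, map_add, hx, hy]
  | tmul q a => simp only [TensorProduct.smul_tmul', evalAt_tmul, smul_eq_mul, map_mul]

lemma evalAt_extDer (der : A →ₗ[k] A) (γ : ℕ → K) (N : ℕ) (w : LPoly k A N) :
    evalAt A γ N (extDer der N w) = der.baseChange K (evalAt A γ N w) := by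
  induction w using TensorProduct.induction_on with
  | zero => simp
  | add x y hx hy => simp only [map_add, hx, hy]
  | tmul q a => simp only [extDer_tmul, evalAt_tmul, LinearMap.baseChange_tmul]

/-- The value of a parameter at `x_j = γ_j` and `∂ = -s`. -/
def paramVal (γ : ℕ → K) (s : K) (N : ℕ) : Param k N →ₐ[k] K :=
  Polynomial.eval₂AlgHom (MvPolynomial.aeval fun i : Fin N => γ i) (-s) fun _ => Commute.all _ _

lemma paramVal_C (γ : ℕ → K) (s : K) (N : ℕ) (p : MvPolynomial (Fin N) k) :
    paramVal γ s N (Polynomial.C p) = MvPolynomial.aeval (fun i : Fin N => γ i) p := by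
  simp [paramVal]

lemma paramVal_X (γ : ℕ → K) (s : K) (N : ℕ) :
    paramVal γ s N (Polynomial.X : Param k N) = -s := by
  simp [paramVal]

lemma paramVal_lam_of_lt (γ : ℕ → K) (s : K) {N l : ℕ} (h : l < N) :
    paramVal γ s N (lam k N l) = γ l := by
  rw [lam_of_lt h, paramVal_C, MvPolynomial.aeval_X]

/-- If `∂` acts as minus the sum of all `γ_l`, the last parameter gets the value `γ_N`, as all the
others do. -/
lemma paramVal_lam {γ : ℕ → K} {s : K} {N : ℕ} (hs : ∑ l ∈ Finset.range (N + 1), γ l = s) {l : ℕ}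
    (hl : l ≤ N) : paramVal γ s N (lam k N l) = γ l := by
  rcases hl.lt_or_eq with h | rfl
  · exact paramVal_lam_of_lt γ s h
  · rw [lam, dif_neg (lt_irrefl _), map_sub, map_neg, map_sum, paramVal_X, ← hs,
      Finset.sum_range_succ, Finset.sum_range]
    simp only [paramVal_C, MvPolynomial.aeval_X]
    ring

variable (der : A →ₗ[k] A) [DecidableEq K]

/-- In the summand of index `s`, a polynomial in `∂` and the parameters acts by its value at
`∂ = -s` and `x_j = γ_j`. -/
lemma evClass_act (γ : ℕ → K) (s : K) (N : ℕ) (q : Param k N) (w : LPoly k A N) :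
    evClass der s (evalAt A γ N (act der N q w)) =
      paramVal γ s N q • evClass der s (evalAt A γ N w) := by
  induction q using Polynomial.induction_on generalizing w with
  | C p => rw [act_C, evalAt_smul, map_smul, paramVal_C]
  | add p q hp hq => rw [map_add, LinearMap.add_apply, map_add, map_add, hp, hq, map_add, add_smul]
  | monomial n p h =>
    rw [pow_succ, ← mul_assoc, act_mul, h, act_X, evalAt_extDer, evClass_baseChange,
      map_mul (paramVal γ s N) (Polynomial.C p * Polynomial.X ^ n), paramVal_X, mul_smul, neg_smul]

/-- Substitution of parameters into a polynomial means evaluation at their values. -/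
lemma evClass_substPoly (γ : ℕ → K) (s : K) {m N : ℕ} (r : Fin m → Param k N) {γ' : ℕ → K}
    (h : ∀ j : Fin m, γ' j = paramVal γ s N (r j)) (w : LPoly k A m) :
    evClass der s (evalAt A γ N (substPoly der r w)) = evClass der s (evalAt A γ' m w) := by
  induction w using TensorProduct.induction_on with
  | zero => simp
  | add x y hx hy => simp only [map_add, hx, hy]
  | tmul p a =>
    rw [subst_tmul, evClass_act, evalAt_tmul, evalAt_tmul, map_one, evClass_tmul, evClass_tmul,
      one_smul, MvPolynomial.comp_aeval_apply]
    simp only [h]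

/-- The family of values of a sesquilinear map. -/
lemma isSesquiFamily_sesq {m : ℕ} (f : sesq der m) :
    IsSesquiFamily der (m + 1) fun (γ : ℕ → K) a =>
      evClass der (∑ l ∈ Finset.range (m + 1), γ l) (evalAt A γ m (f.1 fun j => a j)) := by
  have hu : ∀ (i : ℕ) (hi : i < m + 1) (a : ℕ → A) (x : A),
      (fun j : Fin (m + 1) => Function.update a i x j) =
        Function.update (fun j : Fin (m + 1) => a j) ⟨i, hi⟩ x := fun i hi a x => by
    funext j
    simp [Function.update_apply, Fin.ext_iff]
  refine ⟨fun γ γ' a a' hγ ha => ?_, fun i hi γ a x y => ?_, fun i hi γ a c x => ?_,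
    fun i hi γ a x => ?_⟩
  · have e : evalAt A γ m = evalAt (k := k) A γ' m := by
      simp only [evalAt, fun i : Fin m => hγ i (by omega)]
    rw [e, Finset.sum_congr rfl fun l hl => hγ l (Finset.mem_range.1 hl)]
    congr 3
    exact funext fun j => ha j j.2
  · simp only [hu i hi, MultilinearMap.map_update_add, map_add]
  · rw [hu i hi, hu i hi, MultilinearMap.map_update_smul,
      (evalAt A γ m).map_smul, ← (evClass der _).map_smul, algebraMap_smul]
  · rw [hu i hi, (mem_sesq_iff der).1 f.2, map_neg, map_neg, evClass_act,
      paramVal_lam rfl (by omega : i ≤ m), hu i hi]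

/-- The multilinear operation on `EvSum` whose values on the generators are those of the
sesquilinear map `f`. -/
def sesqOper (K : Type*) [CommRing K] [Algebra k K] [DecidableEq K] {m : ℕ} (f : sesq der m) :
    (ℕ → EvSum K der) → EvSum K der :=
  (isSesquiFamily_sesq der f).exists_oper.choose

lemma sesqOper_mem {m : ℕ} (f : sesq der m) :
    sesqOper der K f ∈ Oper K (EvSum K der) (m + 1) :=
  (isSesquiFamily_sesq der f).exists_oper.choose_spec.1

/-- The operation is specified by its values on generators, and unique by `oper_ext`. -/
lemma sesqOper_gen {m : ℕ} (f : sesq der m) (γ : ℕ → K) (a : ℕ → A) :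
    sesqOper der K f (fun j => gen der (γ j) (a j)) =
      evClass der (∑ l ∈ Finset.range (m + 1), γ l) (evalAt A γ m (f.1 fun j => a j)) :=
  (isSesquiFamily_sesq der f).exists_oper.choose_spec.2 γ a

/-- Insertion of a value `w` into the slot `i` of `f`, evaluated: since all parameters of `f`,
the last one included, take values which add up to `s`, the value is that of the operation of `f`
at the class of `w`. -/
lemma evClass_insertAt {m N : ℕ} (f : sesq der m) (r : Fin m → Param k N) (i : Fin (m + 1))
    (e : Fin (m + 1) → A) (δ : ℕ → K) (s : K) {γ : ℕ → K} {a : ℕ → A}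
    (hγ : ∀ j : Fin m, γ j = paramVal δ s N (r j)) (hs : ∑ l ∈ Finset.range (m + 1), γ l = s)
    (ha : ∀ j : Fin (m + 1), a j = e j) (w : LPoly k A N) :
    evClass der s (evalAt A δ N (insertAt der f.1 r i e w)) =
      sesqOper der K f (Function.update (fun j => gen der (γ j) (a j)) i
        (evClass der (γ i) (evalAt A δ N w))) := by
  have hmem := sesqOper_mem (K := K) der f
  induction w using TensorProduct.induction_on with
  | zero =>
    have := hmem.2.2 i i.2 (fun j => gen der (γ j) (a j)) 0 0
    simp only [zero_smul] at this
    simp only [map_zero, this]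
  | add x y hx hy => simp only [map_add, hx, hy, hmem.2.1 i i.2]
  | tmul p c =>
    rw [insertAt_tmul, evalAt_smul, map_smul, evClass_substPoly der δ s r hγ, evalAt_tmul,
      evClass_tmul, hmem.2.2 i i.2]
    congr 1
    have e₁ : Function.update (fun j => gen der (γ j) (a j)) (i : ℕ) (gen der (γ i) c) =
        fun j => gen der (γ j) (Function.update a i c j) := by
      funext j
      rcases eq_or_ne j i with rfl | hj
      · simp
      · simp [hj]
    rw [e₁, sesqOper_gen, hs]
    congr 3
    funext j
    simp [Function.update_apply, Fin.ext_iff, ha]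

/-- The composition at the slot `i`, evaluated at generators. -/
lemma evClass_compAt {N m n' : ℕ} (h : m + n' = N + 1) (f : sesq der m) (i : Fin (m + 1))
    (G : MultilinearMap k (fun _ : Fin n' => A) (LPoly k A N)) (δ : ℕ → K) (a : ℕ → A) :
    evClass der (∑ l ∈ Finset.range (N + 1), δ l)
        (evalAt A δ N (compAt der h f.1 i G fun j => a j)) =
      sesqOper der K f (insArgs n' i (evClass der (∑ l ∈ Finset.range n', δ (i + l))
        (evalAt A δ N (G fun l => a (i + l)))) fun j => gen der (δ j) (a j)) := by
  obtain ⟨s, hs⟩ : ∃ s, ∑ l ∈ Finset.range (N + 1), δ l = s := ⟨_, rfl⟩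
  -- The parameter of the slot `i` takes the total colour of the inserted block, and every other
  -- parameter takes the colour of its argument.
  have hsum : ∀ j, j ≤ m → paramVal δ s N (blockParam k N i n' j) =
      if j < i then δ j else if j = i then ∑ l ∈ Finset.range n', δ (i + l)
        else δ (j + n' - 1) := fun j hj => by
    rw [blockParam]
    split_ifs with h₁ h₂
    · exact paramVal_lam hs (by omega)
    · rw [map_sum]
      exact Finset.sum_congr rfl fun l hl => paramVal_lam hs (by
        rw [Finset.mem_range] at hl; omega)
    · exact paramVal_lam hs (by omega)
  rw [compAt_apply, hs]
  refine (evClass_insertAt der f _ i (outerArgs h i fun j => a j) δ s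
    (γ := fun j => if j < i then δ j else if j = i then ∑ l ∈ Finset.range n', δ (i + l)
        else δ (j + n' - 1))
    (a := fun j => a (if j < i then j else j + n' - 1))
    (fun j => (hsum j (by omega)).symm) ?_ (fun j => rfl) _).trans ?_
  · rw [Finset.sum_congr rfl fun j hj => (hsum j (by
      rw [Finset.mem_range] at hj; omega)).symm, ← map_sum, sum_blockParam h, map_neg, paramVal_X,
      neg_neg]
  · refine oper_congr (sesqOper_mem der f) fun j hj => ?_
    rcases lt_trichotomy j i with hj' | rfl | hj'
    · rw [insArgs_of_lt hj', Function.update_of_ne (by omega), if_pos hj', if_pos hj']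
    · rw [insArgs_self, Function.update_self, if_neg (lt_irrefl _), if_pos rfl]
      rfl
    · rw [insArgs_of_gt hj', Function.update_of_ne (by omega), if_neg (by omega),
        if_neg (by omega), if_neg (by omega)]

/-- Moving the parameters of `g` to the block starting at `i` means evaluating `g` at the colours
of that block. -/
lemma evClass_shiftMap {n N i : ℕ} (h : i + n ≤ N) (g : sesq der n) (δ : ℕ → K) (a : ℕ → A) :
    evClass der (∑ l ∈ Finset.range (n + 1), δ (i + l))
        (evalAt A δ N (shiftMap der N i g.1 fun l => a (i + l))) =
      sesqOper der K g fun j => gen der (δ (i + j)) (a (i + j)) := by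
  rw [shiftMap_apply, evClass_substPoly der δ _ _ (γ' := fun l => δ (i + l))
    fun j => (paramVal_lam_of_lt δ _ (by omega)).symm]
  exact (sesqOper_gen der g (fun j => δ (i + j)) fun j => a (i + j)).symm

/-- The conformal insertion becomes the plain insertion of operations. -/
lemma sesqOper_partialComp {m n N : ℕ} (h : m + (n + 1) = N + 1) (f : sesq der m) (g : sesq der n)
    (i : Fin (m + 1)) :
    sesqOper der K (partialComp der h f g i) =
      ins (n + 1) (sesqOper der K f) i (sesqOper der K g) := by
  have hm := ins_mem (sesqOper_mem (K := K) der f) (sesqOper_mem der g) i.2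
  rw [show m + 1 + (n + 1) - 1 = N + 1 by omega] at hm
  refine oper_ext der (sesqOper_mem der _) hm fun δ a => ?_
  rw [sesqOper_gen]
  refine (evClass_compAt der h f i _ δ a).trans ?_
  rw [evClass_shiftMap der (by omega)]
  rfl

end Evaluation

/-! ### Bilinear maps from binary operations -/

section OperPair

variable {K L : Type*} [CommRing K] [AddCommGroup L] [Module K L]

/-- The bilinear map given by a bilinear operation. -/
def operPair {μ : (ℕ → L) → L} (hμ : μ ∈ Oper K L 2) : L →ₗ[K] L →ₗ[K] L :=
  have e₁ : ∀ x y : L, (fun j : ℕ => if j = 0 then x else y) =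
      Function.update (fun _ => y) 0 x := fun x y => by
    funext j
    simp [Function.update_apply]
  have e₂ : ∀ x y : L, μ (fun j : ℕ => if j = 0 then x else y) =
      μ (Function.update (fun _ => x) 1 y) := fun x y => oper_congr hμ fun j hj => by
    interval_cases j <;> simp
  LinearMap.mk₂ K (fun x y => μ fun j => if j = 0 then x else y)
    (fun x x' y => by simp only [e₁, hμ.2.1 0 (by omega)])
    (fun c x y => by simp only [e₁, hμ.2.2 0 (by omega)])
    (fun x y y' => by simp only [e₂, hμ.2.1 1 (by omega)])
    (fun c x y => by simp only [e₂, hμ.2.2 1 (by omega)])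

lemma operPair_apply {μ : (ℕ → L) → L} (hμ : μ ∈ Oper K L 2) (x y : L) :
    operPair hμ x y = μ fun j => if j = 0 then x else y := rfl

end OperPair

/-! ### The operations of insertions, constants and products -/

section SesqOper

variable {k : Type*} [Field k] {A : Type*} [AddCommGroup A] [Module k A]
  {K : Type*} [CommRing K] [Algebra k K] [DecidableEq K]

section Values

variable (der : A →ₗ[k] A)

lemma sesqOper_add {m : ℕ} (f g : sesq der m) :
    sesqOper der K (f + g) = sesqOper der K f + sesqOper der K g :=
  oper_ext der (sesqOper_mem der _)
    ((Oper K _ _).add_mem (sesqOper_mem der f) (sesqOper_mem der g)) fun γ a => by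
      rw [Pi.add_apply, sesqOper_gen, sesqOper_gen, sesqOper_gen, Submodule.coe_add,
        add_apply, map_add, map_add]

lemma sesqOper_smul {m : ℕ} (c : k) (f : sesq der m) :
    sesqOper der K (c • f) = algebraMap k K c • sesqOper der K f :=
  oper_ext der (sesqOper_mem der _)
    ((Oper K _ _).smul_mem (algebraMap k K c) (sesqOper_mem der f)) fun γ a => by
      rw [Pi.smul_apply, sesqOper_gen, sesqOper_gen, Submodule.coe_smul,
        smul_apply, (evalAt A γ m).map_smul, ← (evClass der _).map_smul,
        algebraMap_smul]

/-- The class in `EvSum` of an element of `A / ∂A`; it lies in the summand of index `0`. -/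
def zeroVal (K : Type*) [CommRing K] [Algebra k K] [DecidableEq K] :
    ZeroCochain der →ₛₗ[algebraMap k K] EvSum K der :=
  Submodule.liftQ (LinearMap.range ((extDer der 0).restrictScalars k))
    { toFun := fun b => evClass der 0 (evalAt A (0 : ℕ → K) 0 b)
      map_add' := fun b b' => by rw [map_add, map_add]
      map_smul' := fun c b => by
        rw [(evalAt A 0 0).map_smul, ← (evClass der _).map_smul, algebraMap_smul] }
    (by
      rintro _ ⟨b, rfl⟩
      rw [LinearMap.mem_ker]
      change evClass der 0 (evalAt A (0 : ℕ → K) 0 (extDer der 0 b)) = 0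
      rw [evalAt_extDer, evClass_baseChange, zero_smul, neg_zero])

lemma zeroVal_mk (b : LPoly k A 0) :
    zeroVal der K (Submodule.Quotient.mk b) = evClass der 0 (evalAt A (0 : ℕ → K) 0 b) := rfl

lemma evClass_constPoly (δ : ℕ → K) (N : ℕ) (b : LPoly k A 0) :
    evClass der 0 (evalAt A δ N (constPoly der N b)) =
      zeroVal der K (Submodule.Quotient.mk b) :=
  evClass_substPoly der δ 0 _ (fun j => j.elim0) b

lemma sesqOper_insertZero {m N : ℕ} (h : m + 0 = N + 1) (f : sesq der m) (i : Fin (m + 1))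
    (b : ZeroCochain der) :
    sesqOper der K (insertZero der h f i b) =
      ins 0 (sesqOper der K f) i fun _ => zeroVal der K b := by
  obtain ⟨b, rfl⟩ := Submodule.Quotient.mk_surjective _ b
  have hm := ins_mem (n := 0) (g := fun _ => zeroVal der K (Submodule.Quotient.mk b))
    (sesqOper_mem (K := K) der f) ⟨fun _ _ _ => rfl, fun i hi => absurd hi (by omega),
      fun i hi => absurd hi (by omega)⟩ i.2
  rw [show m + 1 + 0 - 1 = N + 1 by omega] at hm
  refine oper_ext der (sesqOper_mem der _) hm fun δ a => ?_
  rw [sesqOper_gen]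
  refine (evClass_compAt der h f i (MultilinearMap.constOfIsEmpty k _ (constPoly der N b))
    δ a).trans ?_
  rw [MultilinearMap.constOfIsEmpty_apply, Function.const_apply, Finset.sum_range_zero,
    evClass_constPoly]
  rfl

/-- The class of `f(b)` in `A / ∂A` for `f : A → A`, the case in which the insertion of a
`0`-cochain is again a `0`-cochain. -/
lemma zeroVal_evalZero (f : sesq der 0) (b : ZeroCochain der) :
    (fun _ => zeroVal der K (evalZero der f b)) =
      ins 0 (sesqOper der K f) 0 fun _ => zeroVal der K b := by
  obtain ⟨b, rfl⟩ := Submodule.Quotient.mk_surjective _ b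
  funext x
  refine (evClass_insertAt der f (fun l => l.elim0) 0 (fun _ => 0) 0 0 (γ := 0) (a := 0)
    (fun j => j.elim0) (by simp) (fun j => rfl) b).trans ?_
  refine oper_congr (sesqOper_mem der f) fun j hj => ?_
  obtain rfl : j = 0 := by omega
  rw [insArgs_self]
  simp [zeroVal_mk]

/-- The identity cochain, with respect to which the outer terms of the differential are cup
products, becomes the projection to the first argument. -/
lemma sesqOper_idSesq : sesqOper der K (idSesq der) = fun x => x 0 := by
  refine oper_ext der (sesqOper_mem der _) ⟨fun x y h => h 0 (by omega), fun i hi x y z => ?_,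
    fun i hi x c y => ?_⟩ fun γ a => ?_
  · obtain rfl : i = 0 := by omega
    simp
  · obtain rfl : i = 0 := by omega
    simp
  · rw [sesqOper_gen, show ∑ l ∈ Finset.range (0 + 1), γ l = γ 0 by simp]
    change evClass der (γ 0) (evalAt A γ 0 (1 ⊗ₜ a 0)) = _
    rw [evalAt_tmul, map_one]
    rfl

end Values

variable (S : AssocConformalAlgebra k A)

/-- The multiplication of `A`, extended to a bilinear operation on `EvSum`. -/
abbrev mulOper (K : Type*) [CommRing K] [Algebra k K] [DecidableEq K] :
    (ℕ → EvSum K S.der) → EvSum K S.der :=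
  sesqOper S.der K (mulSesq S)

lemma mulOper_mem : mulOper S K ∈ Oper K (EvSum K S.der) 2 := sesqOper_mem _ _

lemma mulOper_gen (s t : K) (a b : A) :
    mulOper S K (fun j => if j = 0 then gen S.der s a else gen S.der t b) =
      evClass S.der (s + t) (evalAt A (fun _ => s) 1 (S.mul a b)) := by
  have := sesqOper_gen S.der (mulSesq S) (fun j => if j = 0 then s else t)
    (fun j => if j = 0 then a else b)
  have e : evalAt A (fun j => if j = 0 then s else t) 1 = evalAt (k := k) A (fun _ => s) 1 := by
    simp [evalAt]
  rw [e, Finset.sum_range_succ, Finset.sum_range_one] at this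
  refine Eq.trans (congrArg _ (funext fun j => ?_)) this
  split_ifs <;> rfl

/-- The product `u_r v`, evaluated: the first factor acquires the colour `t` which is the value of
the parameter `r`. -/
lemma evClass_mulAt {N : ℕ} (r : Param k N) (δ : ℕ → K) {s t : K} (ht : paramVal δ s N r = t)
    (u v : LPoly k A N) :
    evClass S.der s (evalAt A δ N (S.mulAt r u v)) =
      mulOper S K fun j => if j = 0 then evClass S.der t (evalAt A δ N u)
        else evClass S.der (s - t) (evalAt A δ N v) := by
  rw [← operPair_apply (mulOper_mem S)]
  induction u using TensorProduct.induction_on with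
  | zero => simp
  | add x y hx hy => simp only [map_add, LinearMap.add_apply, hx, hy]
  | tmul p a =>
    induction v using TensorProduct.induction_on with
    | zero => simp
    | add x y hx hy => simp only [map_add, hx, hy]
    | tmul q b =>
      rw [ConformalAlgebra.mulAt_tmul, evalAt_smul, map_smul, map_mul, mul_smul,
        evClass_substPoly S.der δ s _ (γ' := fun _ => t) fun _ => ht.symm, evalAt_tmul,
        evalAt_tmul, evClass_tmul, evClass_tmul, map_smul, map_smul, LinearMap.smul_apply,
        operPair_apply, mulOper_gen, add_sub_cancel, smul_comm]

/-- Products of values, evaluated: the parameter of the product is the sum of the colours of the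
first `m` arguments, and the sum of the colours of the last `n` ones is left for the second
factor. -/
lemma evClass_prodAt {m n N : ℕ} (h : m + n = N + 1)
    (F : MultilinearMap k (fun _ : Fin m => A) (LPoly k A N))
    (G : MultilinearMap k (fun _ : Fin n => A) (LPoly k A N)) (δ : ℕ → K) (a : ℕ → A) :
    evClass S.der (∑ l ∈ Finset.range (N + 1), δ l)
        (evalAt A δ N (prodAt S h F G fun j => a j)) =
      mulOper S K fun j => if j = 0
        then evClass S.der (∑ l ∈ Finset.range m, δ l) (evalAt A δ N (F fun l => a l))
        else evClass S.der (∑ l ∈ Finset.range n, δ (m + l))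
          (evalAt A δ N (G fun l => a (m + l))) := by
  have ht : paramVal δ (∑ l ∈ Finset.range (N + 1), δ l) N (∑ l ∈ Finset.range m, lam k N l) =
      ∑ l ∈ Finset.range m, δ l := by
    rw [map_sum]
    exact Finset.sum_congr rfl fun l hl => paramVal_lam rfl (by
      rw [Finset.mem_range] at hl; omega)
  rw [prodAt_apply, evClass_mulAt S _ δ ht, show ∑ l ∈ Finset.range (N + 1), δ l -
    ∑ l ∈ Finset.range m, δ l = ∑ l ∈ Finset.range n, δ (m + l) by
      rw [← h, Finset.sum_range_add, add_sub_cancel_left]]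

lemma sesqOper_cupSesq {m n N : ℕ} (h : (m + 1) + (n + 1) = N + 1) (f : sesq S.der m)
    (g : sesq S.der n) :
    sesqOper S.der K (cupSesq S h f g) =
      opCup (mulOper S K) (m + 1) (n + 1) (sesqOper S.der K f) (sesqOper S.der K g) := by
  have hm := opCup_mem (mulOper_mem S) (sesqOper_mem (K := K) S.der f) (sesqOper_mem S.der g)
  rw [h] at hm
  refine oper_ext S.der (sesqOper_mem S.der _) hm fun δ a => ?_
  rw [sesqOper_gen, opCup_apply (mulOper_mem S)]
  refine (evClass_prodAt S h _ _ δ a).trans ?_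
  rw [evClass_shiftMap S.der (by omega)]
  have := evClass_shiftMap (N := N) (i := 0) S.der (by omega) f δ a
  simp only [zero_add] at this
  rw [this]

lemma const_mem_oper {K L : Type*} [CommRing K] [AddCommGroup L] [Module K L] (x : L) :
    (fun _ => x) ∈ Oper K L 0 :=
  ⟨fun _ _ _ => rfl, fun i hi => absurd hi (by omega), fun i hi => absurd hi (by omega)⟩

lemma sesqOper_cupRight {m N : ℕ} (h : (m + 1) + 0 = N + 1) (f : sesq S.der m)
    (b : ZeroCochain S.der) :
    sesqOper S.der K (cupRight S h f b) =
      opCup (mulOper S K) (m + 1) 0 (sesqOper S.der K f) fun _ => zeroVal S.der K b := by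
  have hm := opCup_mem (mulOper_mem S) (sesqOper_mem (K := K) S.der f)
    (const_mem_oper (zeroVal S.der K b))
  obtain rfl : m = N := by omega
  refine oper_ext S.der (sesqOper_mem S.der _) hm fun δ a => ?_
  obtain ⟨b, rfl⟩ := Submodule.Quotient.mk_surjective _ b
  rw [sesqOper_gen, opCup_apply (mulOper_mem S)]
  refine (evClass_prodAt S h (shiftMap S.der m 0 f)
    (MultilinearMap.constOfIsEmpty k _ (constPoly S.der m b)) δ a).trans ?_
  have := evClass_shiftMap (N := m) (i := 0) S.der (by omega) f δ a
  simp only [zero_add] at this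
  rw [this, MultilinearMap.constOfIsEmpty_apply, Function.const_apply, Finset.sum_range_zero,
    evClass_constPoly]

lemma sesqOper_cupLeft {n N : ℕ} (h : 0 + (n + 1) = N + 1) (g : sesq S.der n)
    (b : ZeroCochain S.der) :
    sesqOper S.der K (cupLeft S h g b) =
      opCup (mulOper S K) 0 (n + 1) (fun _ => zeroVal S.der K b) (sesqOper S.der K g) := by
  have hm := opCup_mem (mulOper_mem S) (const_mem_oper (zeroVal S.der K b))
    (sesqOper_mem (K := K) S.der g)
  rw [h] at hm
  refine oper_ext S.der (sesqOper_mem S.der _) hm fun δ a => ?_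
  obtain ⟨b, rfl⟩ := Submodule.Quotient.mk_surjective _ b
  rw [sesqOper_gen, opCup_apply (mulOper_mem S)]
  refine (evClass_prodAt S h (MultilinearMap.constOfIsEmpty k _ (constPoly S.der N b))
    (shiftMap S.der N 0 g) δ a).trans ?_
  rw [evClass_shiftMap S.der (by omega), MultilinearMap.constOfIsEmpty_apply, Function.const_apply,
    Finset.sum_range_zero, evClass_constPoly]

lemma zeroVal_cupZero (b b' : ZeroCochain S.der) :
    (fun _ => zeroVal S.der K (cupZero S b b')) =
      opCup (mulOper S K) 0 0 (fun _ => zeroVal S.der K b) fun _ => zeroVal S.der K b' := by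
  obtain ⟨b, rfl⟩ := Submodule.Quotient.mk_surjective _ b
  obtain ⟨b', rfl⟩ := Submodule.Quotient.mk_surjective _ b'
  funext x
  rw [opCup_apply (mulOper_mem S)]
  refine (evClass_mulAt S 0 (0 : ℕ → K) (map_zero _) b b').trans ?_
  rw [sub_zero]
  rfl

/-- Conformal associativity, evaluated at colours `γ₀`, `γ₁`, `γ₂`. -/
lemma mulOper_assoc : ins 2 (mulOper S K) 0 (mulOper S K) =
    ins 2 (mulOper S K) 1 (mulOper S K) := by
  refine oper_ext S.der (ins_mem (mulOper_mem S) (mulOper_mem S) (by omega))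
    (ins_mem (mulOper_mem S) (mulOper_mem S) (by omega)) fun γ a => ?_
  have h := congrArg (fun w => evClass S.der (γ 0 + γ 1 + γ 2) (evalAt A γ 2 w))
    (S.mul_assoc (a 0) (a 1) (a 2))
  rw [evClass_mulAt S _ γ (t := γ 0 + γ 1) (by simp [paramVal_C]),
    evClass_mulAt S _ γ (t := γ 0) (by simp [paramVal_C]),
    evClass_substPoly S.der γ _ _ (γ' := fun _ => γ 0) (by simp [paramVal_C]),
    evClass_substPoly S.der γ _ _ (γ' := fun _ => γ 1) (by simp [paramVal_C]),
    add_sub_cancel_left, add_assoc, add_sub_cancel_left, evalAt_tmul, evalAt_tmul, map_one,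
    ← mulOper_gen, ← mulOper_gen] at h
  refine Eq.trans ?_ (h.trans ?_)
  · refine oper_congr (mulOper_mem S) fun j hj => ?_
    interval_cases j
    · rw [insArgs_self, if_pos rfl]
      exact oper_congr (mulOper_mem S) fun j hj => by interval_cases j <;> rfl
    · rw [insArgs_of_gt (by omega)]
      rfl
  · refine oper_congr (mulOper_mem S) fun j hj => ?_
    interval_cases j
    · rw [insArgs_of_lt (by omega)]
      rfl
    · rw [insArgs_self, if_neg (by omega)]
      exact oper_congr (mulOper_mem S) fun j hj => by interval_cases j <;> rfl

end SesqOper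

/-! ### Recovering a cochain from its operation -/

section Retraction

variable {k : Type*} [Field k] {A : Type*} [AddCommGroup A] [Module k A] (der : A →ₗ[k] A)

/-- The substitution `k[X₀, X₁, …] ⊗ A → A[x₀, …, x_{N-1}]`, `X_j ↦ r_j`. -/
def substSeq {N : ℕ} (r : ℕ → Param k N) : MvPolynomial ℕ k ⊗[k] A →ₗ[k] LPoly k A N :=
  TensorProduct.lift (LinearMap.mk₂ k
    (fun p a => act der N (MvPolynomial.aeval r p) (1 ⊗ₜ[k] a))
    (fun p q a => by simp)
    (fun c p a => by
      rw [map_smul, show act der N (c • MvPolynomial.aeval r p) = c • act der N _ from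
        LinearMap.map_smul_of_tower (act der N).toLinearMap c _, LinearMap.smul_apply])
    (fun p a b => by simp [TensorProduct.tmul_add]) (fun c p a => by simp))

lemma substSeq_tmul {N : ℕ} (r : ℕ → Param k N) (p : MvPolynomial ℕ k) (a : A) :
    substSeq der r (p ⊗ₜ a) = act der N (MvPolynomial.aeval r p) (1 ⊗ₜ[k] a) := by
  simp [substSeq]

/-- The operator `∂ + s` becomes the multiplication by `∂ + s(r)`, so it becomes `0` if `s` is sent
to `-∂`. -/
lemma substSeq_twist {N : ℕ} (r : ℕ → Param k N) (s : MvPolynomial ℕ k)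
    (u : MvPolynomial ℕ k ⊗[k] A) :
    substSeq der r (twist _ der s u) =
      act der N (Polynomial.X + MvPolynomial.aeval r s) (substSeq der r u) := by
  induction u using TensorProduct.induction_on with
  | zero => simp
  | add x y hx hy => simp only [map_add, hx, hy]
  | tmul p a =>
    rw [twist, LinearMap.add_apply, LinearMap.baseChange_tmul, LinearMap.smul_apply,
      LinearMap.id_apply, TensorProduct.smul_tmul', map_add, substSeq_tmul, substSeq_tmul,
      substSeq_tmul, smul_eq_mul, map_mul, map_add, LinearMap.add_apply, ← act_mul,
      ← act_mul, mul_comm Polynomial.X, act_mul der N _ Polynomial.X, act_X, extDer_tmul,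
      act_mul]

/-- The substitution is a retraction of the evaluation at `γ` if it sends every `γ_i` back to the
parameter `x_i`. -/
lemma substSeq_evalAt {N : ℕ} (r : ℕ → Param k N) (γ : ℕ → MvPolynomial ℕ k)
    (h : ∀ i : Fin N, MvPolynomial.aeval r (γ i) = Polynomial.C (MvPolynomial.X i))
    (w : LPoly k A N) : substSeq der r (evalAt A γ N w) = w := by
  induction w using TensorProduct.induction_on with
  | zero => simp
  | add x y hx hy => simp only [map_add, hx, hy]
  | tmul p a =>
    have : MvPolynomial.aeval (fun i : Fin N => (Polynomial.C (MvPolynomial.X i) : Param k N)) p =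
        Polynomial.C p := by
      have := MvPolynomial.comp_aeval_apply
        (fun i : Fin N => (MvPolynomial.X i : MvPolynomial (Fin N) k))
        (Polynomial.CAlgHom (R := k) (A := MvPolynomial (Fin N) k)) p
      simpa using this.symm
    rw [evalAt_tmul, substSeq_tmul, MvPolynomial.comp_aeval_apply]
    simp only [h]
    rw [this, act_C, TensorProduct.smul_tmul', smul_eq_mul, mul_one]

/-- The kernel of `K ⊗ A → EvSum` in colour `s` is the image of `∂ + s`. -/
lemma exists_twist_of_evClass_eq_zero {K : Type*} [CommRing K] [Algebra k K] [DecidableEq K]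
    {s : K} {u : K ⊗[k] A} (h : evClass der s u = 0) : ∃ v, twist K der s v = u := by
  have h' : EvFiber.mk K der s u = 0 := DirectSum.of_injective s (by rw [map_zero]; exact h)
  exact (Submodule.Quotient.mk_eq_zero (LinearMap.range (twist K der s))).1 h'

variable [DecidableEq (MvPolynomial ℕ k)]

/-- A sesquilinear map is determined by its operation over the polynomial ring: the values
`X₀, X₁, …` of the parameters can be sent back to the parameters, `X_m` going to
`-∂ - x₀ - ⋯ - x_{m-1}`. -/
lemma sesqOper_eq_zero {m : ℕ} {f : sesq der m} (h : sesqOper der (MvPolynomial ℕ k) f = 0) :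
    f = 0 := by
  refine Subtype.ext (MultilinearMap.ext fun a => ?_)
  have := sesqOper_gen (K := MvPolynomial ℕ k) der f MvPolynomial.X
    fun j => if hj : j < m + 1 then a ⟨j, hj⟩ else 0
  simp only [Fin.is_lt, dif_pos, Fin.eta] at this
  rw [h] at this
  obtain ⟨v, hv⟩ := exists_twist_of_evClass_eq_zero der this.symm
  rw [← substSeq_evalAt der (lam k m) MvPolynomial.X (fun i => by
    rw [MvPolynomial.aeval_X, lam_of_lt i.2]) (f.1 a), ← hv, substSeq_twist, map_sum]
  simp only [MvPolynomial.aeval_X]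
  -- The colour `X₀ + ⋯ + X_m` goes to the sum of all parameters, which is `-∂`.
  rw [sum_lam, add_neg_cancel, map_zero]
  rfl

lemma zeroVal_eq_zero {b : ZeroCochain der} (h : zeroVal der (MvPolynomial ℕ k) b = 0) :
    b = 0 := by
  obtain ⟨b, rfl⟩ := Submodule.Quotient.mk_surjective _ b
  obtain ⟨v, hv⟩ := exists_twist_of_evClass_eq_zero der h
  refine (Submodule.Quotient.mk_eq_zero _).2 ⟨substSeq der (0 : ℕ → Param k 0) v, ?_⟩
  rw [← substSeq_evalAt der (0 : ℕ → Param k 0) 0 (fun i => i.elim0) b, ← hv, substSeq_twist,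
    map_zero, add_zero, act_X]
  rfl

end Retraction

/-! ### Cochains as multilinear operations -/

section ToOper

variable {k : Type u} [Field k] {A : Type v} [AddCommGroup A] [Module k A]

/-- The map `f ↦ sesqOper der K f`, bundled. -/
def sesqHom (der : A →ₗ[k] A) (K : Type*) [CommRing K] [Algebra k K] [DecidableEq K] (n : ℕ) :
    sesq der n →ₛₗ[algebraMap k K] (ℕ → EvSum K der) → EvSum K der :=
  { toFun := sesqOper der K
    map_add' := sesqOper_add der
    map_smul' := sesqOper_smul der }

lemma sesqHom_apply (der : A →ₗ[k] A) (K : Type*) [CommRing K] [Algebra k K] [DecidableEq K]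
    {n : ℕ} (f : sesq der n) : sesqHom der K n f = sesqOper der K f := rfl

/-- The multilinear operation on `EvSum` attached to a cochain; a `0`-cochain gives a constant. -/
def toOper (der : A →ₗ[k] A) (K : Type*) [CommRing K] [Algebra k K] [DecidableEq K] :
    (n : ℕ) → Cochain der n →ₛₗ[algebraMap k K] (ℕ → EvSum K der) → EvSum K der
  | 0 =>
    { toFun := fun b _ => zeroVal der K b
      map_add' := fun b b' => funext fun _ => (zeroVal der K).map_add b b'
      map_smul' := fun c b => funext fun _ => (zeroVal der K).map_smulₛₗ c b }
  | n + 1 =>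
    { toFun := sesqHom der K n
      map_add' := (sesqHom der K n).map_add
      map_smul' := (sesqHom der K n).map_smulₛₗ }

section Injectivity

variable (der : A →ₗ[k] A) (K : Type*) [CommRing K] [Algebra k K] [DecidableEq K]

lemma toOper_mem {n : ℕ} (f : Cochain der n) : toOper der K n f ∈ Oper K (EvSum K der) n := by
  cases n with
  | zero => exact const_mem_oper _
  | succ n => exact sesqOper_mem der _

/-- No information is lost over `k[X₀, X₁, …]`. One variable is needed for each argument, so
infinitely many serve all degrees at once. -/
lemma toOper_injective [DecidableEq (MvPolynomial ℕ k)] (n : ℕ) :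
    Function.Injective (toOper der (MvPolynomial ℕ k) n) := by
  rw [injective_iff_map_eq_zero]
  intro f hf
  cases n with
  | zero => exact zeroVal_eq_zero der (congrFun hf 0)
  | succ n => exact sesqOper_eq_zero der hf

end Injectivity

lemma neg_one_pow_smul_eq_zsmul {M : Type*} [AddCommGroup M] [Module k M] (e : ℕ) (x : M) :
    (-1 : k) ^ e • x = (-1 : ℤ) ^ e • x := by
  rcases neg_one_pow_eq_or ℤ e with h | h <;> rcases Nat.even_or_odd e with he | he <;>
    simp [he.neg_one_pow]

lemma negOnePow_smul_eq_zsmul {M : Type*} [AddCommGroup M] {z : ℤ} {e : ℕ}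
    (h : (z : ZMod 2) = e) (x : M) : z.negOnePow • x = (-1 : ℤ) ^ e • x := by
  rw [← Int.cast_natCast (R := ZMod 2), ← sub_eq_zero, ← Int.cast_sub,
    ZMod.intCast_zmod_eq_zero_iff_dvd] at h
  have : z.negOnePow = (-1 : ℤˣ) ^ e := by
    rw [(Int.negOnePow_eq_iff z e).2 (even_iff_two_dvd.2 h)]
    rfl
  rw [this, Units.smul_def]
  simp

variable (S : AssocConformalAlgebra k A) (K : Type*) [CommRing K] [Algebra k K] [DecidableEq K]

/-- The cup product in all degrees, `0`-cochains included, is the cup product of operations. -/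
lemma toOper_cup {m n N : ℕ} (h : m + n = N) (f : Cochain S.der m) (g : Cochain S.der n) :
    toOper S.der K N (cup S h f g) =
      opCup (mulOper S K) m n (toOper S.der K m f) (toOper S.der K n g) := by
  match m, n, N, h, f, g with
  | 0, 0, 0, _, b, b' => exact zeroVal_cupZero S b b'
  | 0, _ + 1, _ + 1, h, b, g => exact sesqOper_cupLeft S h g b
  | _ + 1, 0, _ + 1, h, f, b => exact sesqOper_cupRight S h f b
  | _ + 1, _ + 1, _ + 1, h, f, g => exact sesqOper_cupSesq S h f g

lemma sesqOper_sum_insertZero {m N : ℕ} (h : m + 0 = N + 1) (f : sesq S.der m)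
    (b : ZeroCochain S.der) :
    sesqOper S.der K (∑ i : Fin (m + 1), (-1 : k) ^ (i : ℕ) • insertZero S.der h f i b) =
      preLie (m + 1) 0 (sesqOper S.der K f) fun _ => zeroVal S.der K b := by
  rw [← sesqHom_apply, map_sum, preLie, Finset.sum_range]
  refine Finset.sum_congr rfl fun i _ => ?_
  rw [neg_one_pow_smul_eq_zsmul, map_zsmul, zero_add, one_mul, sesqHom_apply, sesqOper_insertZero]

lemma sesqOper_sum_partialComp {m n N : ℕ} (h : m + (n + 1) = N + 1) (f : sesq S.der m)
    (g : sesq S.der n) :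
    sesqOper S.der K
        (∑ i : Fin (m + 1), (-1 : k) ^ (n * (i : ℕ)) • partialComp S.der h f g i) =
      preLie (m + 1) (n + 1) (sesqOper S.der K f) (sesqOper S.der K g) := by
  rw [← sesqHom_apply, map_sum, preLie, Finset.sum_range]
  refine Finset.sum_congr rfl fun i _ => ?_
  rw [neg_one_pow_smul_eq_zsmul, map_zsmul, sesqHom_apply, sesqOper_partialComp]
  refine neg_one_pow_smul_congr fun _ => ?_
  push_cast
  generalize (n : ZMod 2) = n, (i.val : ZMod 2) = i
  decide +revert

/-- The sum `f • g` of insertions in all degrees is the pre-Lie product of operations. -/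
lemma toOper_circ {m n N : ℕ} (h : m + n = N + 1) (f : Cochain S.der m) (g : Cochain S.der n) :
    toOper S.der K N (circ S h f g) =
      preLie m n (toOper S.der K m f) (toOper S.der K n g) := by
  match m, n, N, h, f, g with
  | 0, _, _, _, _, _ =>
    rw [circ, map_zero, preLie, Finset.sum_range_zero]
  | 1, 0, 0, h, f, b =>
    rw [preLie, Finset.sum_range_one, mul_zero, pow_zero, one_smul]
    exact zeroVal_evalZero S.der f b
  | m + 2, 0, 0, h, f, b => exact absurd h (by omega)
  | m + 1, 0, N + 1, h, f, b => exact sesqOper_sum_insertZero S K _ f b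
  | m + 1, n + 1, 0, h, _, _ => exact absurd h (by omega)
  | m + 1, n + 1, N + 1, h, f, g => exact sesqOper_sum_partialComp S K _ f g

lemma toOper_bracket {m n N : ℕ} (h : m + n = N + 1) (f : Cochain S.der m)
    (g : Cochain S.der n) :
    toOper S.der K N (bracket S h f g) =
      gBracket m n (toOper S.der K m f) (toOper S.der K n g) := by
  rw [bracket, negOnePow_smul_eq_zsmul (e := (m + 1) * (n + 1)), map_sub, map_zsmul, toOper_circ,
    toOper_circ, gBracket]
  push_cast
  generalize (n : ZMod 2) = n, (m : ZMod 2) = m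
  decide +revert

lemma ins_proj {L : Type*} (F : (ℕ → L) → L) (i : ℕ) : ins 1 F i (fun a => a 0) = F := by
  funext a
  rw [ins_apply]
  congr 1
  funext j
  rcases lt_trichotomy j i with hj | rfl | hj
  · rw [insArgs_of_lt hj]
  · rw [insArgs_self]
    rfl
  · rw [insArgs_of_gt hj, Nat.add_sub_cancel]

lemma opCup_proj_left {L : Type*} (μ g : (ℕ → L) → L) (n : ℕ) :
    opCup μ 1 n (fun a => a 0) g = ins n μ 1 g := ins_proj _ _

lemma opCup_proj_right {L : Type*} (μ f : (ℕ → L) → L) (m : ℕ) :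
    opCup μ m 1 f (fun a => a 0) = ins m μ 0 f := by rw [opCup, ins_proj]

lemma preLie_two {L : Type*} [AddCommGroup L] (n : ℕ) (μ f : (ℕ → L) → L) :
    preLie 2 n μ f = ins n μ 0 f + (-1 : ℤ) ^ (n + 1) • ins n μ 1 f := by
  simp [preLie, Finset.sum_range_succ]

lemma sesqOper_dZero (b : ZeroCochain S.der) :
    sesqOper S.der K (dZero S b) = -gBracket 0 2 (fun _ => zeroVal S.der K b) (mulOper S K) := by
  rw [dZero, LinearMap.sub_apply, ← sesqHom_apply, map_sub, sesqHom_apply, sesqHom_apply,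
    sesqOper_cupRight, sesqOper_cupLeft, sesqOper_idSesq, zero_add, opCup_proj_left,
    opCup_proj_right, gBracket, preLie_two, preLie, Finset.sum_range_zero]
  module

lemma sesqOper_dSesq {n : ℕ} (f : sesq S.der n) :
    sesqOper S.der K (dSesq S n f) =
      -gBracket (n + 1) 2 (sesqOper S.der K f) (mulOper S K) := by
  have h : sesqOper S.der K (∑ i : Fin (n + 1), (-1 : k) ^ ((i : ℕ) + 1) •
      partialComp S.der (rfl : n + (1 + 1) = (n + 1) + 1) f (mulSesq S) i) =
      -preLie (n + 1) 2 (sesqOper S.der K f) (mulOper S K) := by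
    rw [← sesqOper_sum_partialComp S K (rfl : n + (1 + 1) = (n + 1) + 1), ← sesqHom_apply,
      ← sesqHom_apply, ← map_neg, ← Finset.sum_neg_distrib]
    simp only [pow_succ, one_mul, mul_neg, mul_one, neg_smul]
  rw [dSesq, LinearMap.coe_mk, AddHom.coe_mk, ← sesqHom_apply, map_add, map_add,
    neg_one_pow_smul_eq_zsmul, map_zsmul, sesqHom_apply, sesqHom_apply, sesqHom_apply,
    h, sesqOper_cupSesq, sesqOper_cupSesq, sesqOper_idSesq, zero_add, opCup_proj_left,
    opCup_proj_right, gBracket, preLie_two]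
  rcases neg_one_pow_eq_or ℤ n with hn | hn
  · simp only [pow_add, pow_mul, hn]
    module
  · simp only [pow_add, pow_mul, hn]
    module

/-- The Hochschild differential is, up to sign, the bracket with the multiplication. -/
lemma toOper_d (n : ℕ) (f : Cochain S.der n) :
    toOper S.der K (n + 1) (d S n f) = -gBracket n 2 (toOper S.der K n f) (mulOper S K) := by
  cases n with
  | zero => exact sesqOper_dZero S K f
  | succ n => exact sesqOper_dSesq S K f

end ToOper

/-! ### Linearity of the bracket and of the cup product -/

section Linearity

variable {K L : Type*} [CommRing K] [AddCommGroup L] [Module K L]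

lemma gBracket_add_left {m n : ℕ} (f f' : (ℕ → L) → L) {g : (ℕ → L) → L}
    (hg : g ∈ Oper K L n) : gBracket m n (f + f') g = gBracket m n f g + gBracket m n f' g := by
  have h₁ : preLie m n (f + f') g = preLie m n f g + preLie m n f' g := by
    simp only [preLie, ← Finset.sum_add_distrib, ← smul_add]
    rfl
  have h₂ : preLie n m g (f + f') = preLie n m g f + preLie n m g f' := by
    simp only [preLie, ← Finset.sum_add_distrib, ← smul_add]
    exact Finset.sum_congr rfl fun i hi => by
      simp only [← insHom_apply hg (Finset.mem_range.1 hi), map_add]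
  rw [gBracket, gBracket, gBracket, h₁, h₂, smul_add]
  abel

lemma gBracket_smul_left {m n : ℕ} (c : K) (f : (ℕ → L) → L) {g : (ℕ → L) → L}
    (hg : g ∈ Oper K L n) : gBracket m n (c • f) g = c • gBracket m n f g := by
  have h₁ : preLie m n (c • f) g = c • preLie m n f g := by
    simp only [preLie, Finset.smul_sum, smul_comm c]
    rfl
  have h₂ : preLie n m g (c • f) = c • preLie n m g f := by
    simp only [preLie, Finset.smul_sum, smul_comm c]
    refine Finset.sum_congr rfl fun i hi => congrArg _ (funext fun a => ?_)
    exact insArgs_smul hg (Finset.mem_range.1 hi) m c _ a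
  rw [gBracket, gBracket, h₁, h₂, smul_sub, smul_comm c]

lemma gBracket_add_right {m n : ℕ} {f : (ℕ → L) → L} (hf : f ∈ Oper K L m)
    (g g' : (ℕ → L) → L) : gBracket m n f (g + g') = gBracket m n f g + gBracket m n f g' := by
  rw [gBracket_skew, gBracket_add_left _ _ hf, smul_add, neg_add, ← gBracket_skew,
    ← gBracket_skew]

lemma gBracket_smul_right {m n : ℕ} {f : (ℕ → L) → L} (hf : f ∈ Oper K L m) (c : K)
    (g : (ℕ → L) → L) : gBracket m n f (c • g) = c • gBracket m n f g := by
  rw [gBracket_skew, gBracket_smul_left _ _ hf, smul_comm _ c, ← smul_neg, ← gBracket_skew]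

lemma gBracket_zero_left {m n : ℕ} {g : (ℕ → L) → L} (hg : g ∈ Oper K L n) :
    gBracket m n 0 g = 0 := by
  simpa using gBracket_smul_left (m := m) (0 : K) 0 hg

lemma gBracket_zero_right {m n : ℕ} {f : (ℕ → L) → L} (hf : f ∈ Oper K L m) :
    gBracket m n f 0 = 0 := by
  rw [gBracket_skew, gBracket_zero_left hf, smul_zero, neg_zero]

lemma ne_zero_of_gBracket_ne_zero_left {m n : ℕ} {f g : (ℕ → L) → L} (hg : g ∈ Oper K L n)
    (h : gBracket m n f g ≠ 0) : f ≠ 0 := by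
  rintro rfl
  exact h (gBracket_zero_left hg)

lemma ne_zero_of_gBracket_ne_zero_right {m n : ℕ} {f g : (ℕ → L) → L} (hf : f ∈ Oper K L m)
    (h : gBracket m n f g ≠ 0) : g ≠ 0 := by
  rintro rfl
  exact h (gBracket_zero_right hf)

variable {μ : (ℕ → L) → L}

lemma opCup_add_left (hμ : μ ∈ Oper K L 2) (m n : ℕ) (f f' g : (ℕ → L) → L) :
    opCup μ m n (f + f') g = opCup μ m n f g + opCup μ m n f' g := by
  funext a
  simp only [Pi.add_apply, opCup_apply hμ, ← operPair_apply hμ, map_add, LinearMap.add_apply]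

lemma opCup_add_right (hμ : μ ∈ Oper K L 2) (m n : ℕ) (f g g' : (ℕ → L) → L) :
    opCup μ m n f (g + g') = opCup μ m n f g + opCup μ m n f g' := by
  funext a
  simp only [Pi.add_apply, opCup_apply hμ, ← operPair_apply hμ, map_add]

lemma opCup_smul_left (hμ : μ ∈ Oper K L 2) (m n : ℕ) (c : K) (f g : (ℕ → L) → L) :
    opCup μ m n (c • f) g = c • opCup μ m n f g := by
  funext a
  simp only [Pi.smul_apply, opCup_apply hμ, ← operPair_apply hμ, map_smul, LinearMap.smul_apply]

lemma opCup_smul_right (hμ : μ ∈ Oper K L 2) (m n : ℕ) (c : K) (f g : (ℕ → L) → L) :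
    opCup μ m n f (c • g) = c • opCup μ m n f g := by
  funext a
  simp only [Pi.smul_apply, opCup_apply hμ, ← operPair_apply hμ, map_smul]

lemma opCup_zero_left (hμ : μ ∈ Oper K L 2) (m n : ℕ) (g : (ℕ → L) → L) : opCup μ m n 0 g = 0 := by
  simpa using opCup_smul_left hμ m n (0 : K) 0 g

lemma opCup_zero_right (hμ : μ ∈ Oper K L 2) (m n : ℕ) (f : (ℕ → L) → L) : opCup μ m n f 0 = 0 := by
  simpa using opCup_smul_right hμ m n (0 : K) f 0

/-- Associativity of the cup product. -/
lemma opCup_assoc (hμ : μ ∈ Oper K L 2) (hassoc : ins 2 μ 0 μ = ins 2 μ 1 μ) (m n p : ℕ)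
    (f g h : (ℕ → L) → L) :
    opCup μ (m + n) p (opCup μ m n f g) h = opCup μ m (n + p) f (opCup μ n p g h) := by
  funext a
  have e := congrFun hassoc fun j => if j = 0 then f a else if j = 1 then g fun l => a (m + l)
    else h fun l => a (m + n + l)
  simp only [opCup_apply hμ]
  refine Eq.trans ?_ (e.trans ?_)
  · refine oper_congr hμ fun j hj => ?_
    interval_cases j
    · rw [insArgs_self, if_pos rfl]
      exact oper_congr hμ fun j hj => by interval_cases j <;> rfl
    · rw [insArgs_of_gt (by omega)]
      rfl
  · refine oper_congr hμ fun j hj => ?_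
    interval_cases j
    · rw [insArgs_of_lt (by omega)]
      rfl
    · rw [insArgs_self, if_neg (by omega)]
      refine oper_congr hμ fun j hj => ?_
      interval_cases j
      · rfl
      · simp [add_assoc]

end Linearity

/-! ### Cocycles and coboundaries among the operations -/

section OperSubgroups

variable {k : Type u} [Field k] {A : Type v} [AddCommGroup A] [Module k A]
  [DecidableEq (MvPolynomial ℕ k)] (S : AssocConformalAlgebra k A)

/-- The operation attached to a cochain, over the polynomial ring in infinitely many variables. -/
abbrev cochainOper {n : ℕ} (f : Cochain S.der n) :
    (ℕ → EvSum (MvPolynomial ℕ k) S.der) → EvSum (MvPolynomial ℕ k) S.der :=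
  toOper S.der (MvPolynomial ℕ k) n f

/-- The operations of the `n`-cochains. -/
def cochainOpers (n : ℕ) :
    AddSubgroup ((ℕ → EvSum (MvPolynomial ℕ k) S.der) → EvSum (MvPolynomial ℕ k) S.der) :=
  (toOper S.der (MvPolynomial ℕ k) n).toAddMonoidHom.range

/-- The operations of the `n`-cocycles. -/
def cocycleOpers (n : ℕ) :
    AddSubgroup ((ℕ → EvSum (MvPolynomial ℕ k) S.der) → EvSum (MvPolynomial ℕ k) S.der) :=
  (cocycles S n).toAddSubgroup.map (toOper S.der (MvPolynomial ℕ k) n).toAddMonoidHom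

/-- The operations of the `n`-coboundaries. -/
def coboundaryOpers (n : ℕ) :
    AddSubgroup ((ℕ → EvSum (MvPolynomial ℕ k) S.der) → EvSum (MvPolynomial ℕ k) S.der) :=
  (coboundaries S n).toAddSubgroup.map (toOper S.der (MvPolynomial ℕ k) n).toAddMonoidHom

variable {S}

lemma mem_oper_of_mem_cochainOpers {n : ℕ} {x} (hx : x ∈ cochainOpers S n) :
    x ∈ Oper (MvPolynomial ℕ k) (EvSum (MvPolynomial ℕ k) S.der) n := by
  obtain ⟨f, rfl⟩ := hx
  exact toOper_mem _ _ f

/-- Cocycles are recognized among the operations of cochains by a bracket, without reference to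
the differential of cochains. -/
lemma mem_cocycleOpers_iff {n : ℕ} {x} : x ∈ cocycleOpers S n ↔
    x ∈ cochainOpers S n ∧ gBracket n 2 x (mulOper S (MvPolynomial ℕ k)) = 0 := by
  have h : ∀ f : Cochain S.der n, f ∈ cocycles S n ↔
      gBracket n 2 (cochainOper S f) (mulOper S (MvPolynomial ℕ k)) = 0 := fun f => by
    rw [cocycles, LinearMap.mem_ker, ← map_eq_zero_iff _ (toOper_injective S.der (n + 1)),
      toOper_d, neg_eq_zero]
  constructor
  · rintro ⟨f, hf, rfl⟩
    exact ⟨⟨f, rfl⟩, (h f).1 hf⟩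
  · rintro ⟨⟨f, rfl⟩, hf⟩
    exact ⟨f, (h f).2 hf, rfl⟩

lemma gBracket_mul_mem_coboundaryOpers {n : ℕ} {x} (hx : x ∈ cochainOpers S n) :
    gBracket n 2 x (mulOper S (MvPolynomial ℕ k)) ∈ coboundaryOpers S (n + 1) := by
  obtain ⟨f, rfl⟩ := hx
  refine neg_mem_iff.1 ⟨d S n f, ⟨f, rfl⟩, toOper_d S _ n f⟩

lemma eq_zero_of_mem_coboundaryOpers_zero {x} (hx : x ∈ coboundaryOpers S 0) : x = 0 := by
  obtain ⟨f, hf, rfl⟩ := hx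
  obtain rfl : f = 0 := hf
  exact map_zero _

lemma exists_of_mem_coboundaryOpers_succ {n : ℕ} {x} (hx : x ∈ coboundaryOpers S (n + 1)) :
    ∃ y ∈ cochainOpers S n, gBracket n 2 y (mulOper S (MvPolynomial ℕ k)) = x := by
  obtain ⟨_, ⟨f, rfl⟩, rfl⟩ := hx
  refine ⟨cochainOper S (-f), ⟨_, rfl⟩, ?_⟩
  have := toOper_d S (MvPolynomial ℕ k) n (-f)
  rw [map_neg, map_neg] at this
  exact neg_injective this.symm

lemma zsmul_mem_iff_of_pow {G : Type*} [AddCommGroup G] (H : AddSubgroup G) (e : ℕ) {x : G} :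
    (-1 : ℤ) ^ e • x ∈ H ↔ x ∈ H := by
  rcases neg_one_pow_eq_or ℤ e with h | h <;> simp [h]

/-- The operations of cochains are closed under insertions, hence under all operations which are
built from these. -/
lemma ins_mem_cochainOpers {m n i : ℕ} {x y} (hx : x ∈ cochainOpers S m)
    (hy : y ∈ cochainOpers S n) (hi : i < m) : ins n x i y ∈ cochainOpers S (m + n - 1) := by
  obtain ⟨f, rfl⟩ := hx
  obtain ⟨g, rfl⟩ := hy
  match m, n, f, g with
  | 1, 0, f, b =>
    obtain rfl : i = 0 := by omega
    exact ⟨evalZero S.der f b, zeroVal_evalZero S.der f b⟩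
  | m + 2, 0, f, b =>
    exact ⟨insertZero S.der (N := m) rfl f ⟨i, hi⟩ b, sesqOper_insertZero S.der rfl f ⟨i, hi⟩ b⟩
  | m + 1, n + 1, f, g =>
    rw [show m + 1 + (n + 1) - 1 = m + n + 1 by omega]
    exact ⟨partialComp S.der (by omega : m + (n + 1) = m + n + 1) f g ⟨i, hi⟩,
      sesqOper_partialComp S.der _ f g ⟨i, hi⟩⟩

lemma preLie_mem_cochainOpers {m n : ℕ} {x y} (hx : x ∈ cochainOpers S m)
    (hy : y ∈ cochainOpers S n) : preLie m n x y ∈ cochainOpers S (m + n - 1) :=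
  AddSubgroup.sum_mem _ fun _ hi =>
    AddSubgroup.zsmul_mem _ (ins_mem_cochainOpers hx hy (Finset.mem_range.1 hi)) _

lemma gBracket_mem_cochainOpers {m n : ℕ} {x y} (hx : x ∈ cochainOpers S m)
    (hy : y ∈ cochainOpers S n) : gBracket m n x y ∈ cochainOpers S (m + n - 1) :=
  AddSubgroup.sub_mem _ (preLie_mem_cochainOpers hx hy)
    (AddSubgroup.zsmul_mem _ (add_comm n m ▸ preLie_mem_cochainOpers hy hx) _)

lemma brace_mem_cochainOpers {m n p : ℕ} {x y z} (hx : x ∈ cochainOpers S m)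
    (hy : y ∈ cochainOpers S n) (hz : z ∈ cochainOpers S p) :
    brace m n p x y z ∈ cochainOpers S (m + n + p - 2) := by
  refine AddSubgroup.sum_mem _ fun j hj => AddSubgroup.sum_mem _ fun i hi =>
    AddSubgroup.zsmul_mem _ ?_ _
  rw [Finset.mem_range] at hi hj
  have := ins_mem_cochainOpers (ins_mem_cochainOpers hx hz hj) hy (by omega : i < m + p - 1)
  rwa [show m + p - 1 + n - 1 = m + n + p - 2 by omega] at this

lemma opCup_mem_cochainOpers {m n : ℕ} {x y} (hx : x ∈ cochainOpers S m)
    (hy : y ∈ cochainOpers S n) :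
    opCup (mulOper S (MvPolynomial ℕ k)) m n x y ∈ cochainOpers S (m + n) := by
  obtain ⟨f, rfl⟩ := hx
  obtain ⟨g, rfl⟩ := hy
  exact ⟨cup S rfl f g, toOper_cup S _ rfl f g⟩

lemma opCup_mem_cocycleOpers {m n : ℕ} {x y} (hx : x ∈ cocycleOpers S m)
    (hy : y ∈ cocycleOpers S n) :
    opCup (mulOper S (MvPolynomial ℕ k)) m n x y ∈ cocycleOpers S (m + n) := by
  rw [mem_cocycleOpers_iff] at *
  refine ⟨opCup_mem_cochainOpers hx.1 hy.1, ?_⟩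
  rw [gBracket_opCup (mulOper_mem S) (mulOper_assoc S) (mem_oper_of_mem_cochainOpers hx.1)
    (mem_oper_of_mem_cochainOpers hy.1), hx.2, hy.2, opCup_zero_left (mulOper_mem S),
    opCup_zero_right (mulOper_mem S), smul_zero, add_zero]

lemma opCup_mem_coboundaryOpers_left {m n : ℕ} {x y} (hx : x ∈ coboundaryOpers S m)
    (hy : y ∈ cocycleOpers S n) :
    opCup (mulOper S (MvPolynomial ℕ k)) m n x y ∈ coboundaryOpers S (m + n) := by
  rw [mem_cocycleOpers_iff] at hy
  cases m with
  | zero =>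
    rw [eq_zero_of_mem_coboundaryOpers_zero hx, opCup_zero_left (mulOper_mem S)]
    exact zero_mem _
  | succ m =>
    obtain ⟨w, hw, rfl⟩ := exists_of_mem_coboundaryOpers_succ hx
    have h := gBracket_mul_mem_coboundaryOpers (opCup_mem_cochainOpers hw hy.1)
    rw [gBracket_opCup (mulOper_mem S) (mulOper_assoc S) (mem_oper_of_mem_cochainOpers hw)
      (mem_oper_of_mem_cochainOpers hy.1), hy.2, opCup_zero_right (mulOper_mem S), smul_zero,
      add_zero, add_right_comm] at h
    exact h

lemma opCup_mem_coboundaryOpers_right {m n : ℕ} {x y} (hx : x ∈ cocycleOpers S m)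
    (hy : y ∈ coboundaryOpers S n) :
    opCup (mulOper S (MvPolynomial ℕ k)) m n x y ∈ coboundaryOpers S (m + n) := by
  rw [mem_cocycleOpers_iff] at hx
  cases n with
  | zero =>
    rw [eq_zero_of_mem_coboundaryOpers_zero hy, opCup_zero_right (mulOper_mem S)]
    exact zero_mem _
  | succ n =>
    obtain ⟨w, hw, rfl⟩ := exists_of_mem_coboundaryOpers_succ hy
    have h := gBracket_mul_mem_coboundaryOpers (opCup_mem_cochainOpers hx.1 hw)
    rwa [gBracket_opCup (mulOper_mem S) (mulOper_assoc S) (mem_oper_of_mem_cochainOpers hx.1)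
      (mem_oper_of_mem_cochainOpers hw), hx.2, opCup_zero_left (mulOper_mem S), zero_add,
      zsmul_mem_iff_of_pow] at h

/-- The Jacobi identity with the multiplication as third argument. -/
lemma gBracket_gBracket_mul_right {m n : ℕ} {x y} (hx : x ∈ cochainOpers S m)
    (hy : y ∈ cochainOpers S n) :
    gBracket m (n + 1) x (gBracket n 2 y (mulOper S (MvPolynomial ℕ k))) =
      gBracket (m + n - 1) 2 (gBracket m n x y) (mulOper S (MvPolynomial ℕ k)) +
        (-1 : ℤ) ^ ((m + 1) * (n + 1)) •
          gBracket n (m + 1) y (gBracket m 2 x (mulOper S (MvPolynomial ℕ k))) := by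
  have h := gBracket_jacobi (mem_oper_of_mem_cochainOpers hx) (mem_oper_of_mem_cochainOpers hy)
    (mulOper_mem S)
  rwa [show n + 2 - 1 = n + 1 by omega, show m + 2 - 1 = m + 1 by omega] at h

lemma gBracket_mem_cocycleOpers {m n : ℕ} {x y} (hx : x ∈ cocycleOpers S m)
    (hy : y ∈ cocycleOpers S n) : gBracket m n x y ∈ cocycleOpers S (m + n - 1) := by
  rw [mem_cocycleOpers_iff] at *
  refine ⟨gBracket_mem_cochainOpers hx.1 hy.1, ?_⟩
  have h := gBracket_gBracket_mul_right hx.1 hy.1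
  rw [hx.2, hy.2, gBracket_zero_right (mem_oper_of_mem_cochainOpers hx.1),
    gBracket_zero_right (mem_oper_of_mem_cochainOpers hy.1), smul_zero, add_zero] at h
  exact h.symm

lemma gBracket_mem_coboundaryOpers_right {m n : ℕ} {x y} (hx : x ∈ cocycleOpers S m)
    (hy : y ∈ coboundaryOpers S n) : gBracket m n x y ∈ coboundaryOpers S (m + n - 1) := by
  rw [mem_cocycleOpers_iff] at hx
  cases n with
  | zero =>
    rw [eq_zero_of_mem_coboundaryOpers_zero hy,
      gBracket_zero_right (mem_oper_of_mem_cochainOpers hx.1)]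
    exact zero_mem _
  | succ n =>
    obtain ⟨w, hw, rfl⟩ := exists_of_mem_coboundaryOpers_succ hy
    rw [gBracket_gBracket_mul_right hx.1 hw, hx.2,
      gBracket_zero_right (mem_oper_of_mem_cochainOpers hw), smul_zero, add_zero]
    by_cases h₀ : gBracket m n x w = 0
    · rw [h₀, gBracket_zero_left (mulOper_mem S)]
      exact zero_mem _
    -- A nonzero bracket has an arity which is not truncated.
    · have h := gBracket_mul_mem_coboundaryOpers (gBracket_mem_cochainOpers hx.1 hw)
      have hmn := gBracket_ne_zero h₀
      rwa [show m + n - 1 + 1 = m + (n + 1) - 1 by omega] at h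

lemma gBracket_mem_coboundaryOpers_left {m n : ℕ} {x y} (hx : x ∈ coboundaryOpers S m)
    (hy : y ∈ cocycleOpers S n) : gBracket m n x y ∈ coboundaryOpers S (m + n - 1) := by
  rw [gBracket_skew, neg_mem_iff, zsmul_mem_iff_of_pow, add_comm]
  exact gBracket_mem_coboundaryOpers_right hy hx

/-- The cup product is graded commutative up to coboundaries. -/
lemma opCup_comm_mem {m n : ℕ} {x y} (hx : x ∈ cocycleOpers S m) (hy : y ∈ cocycleOpers S n) :
    opCup (mulOper S (MvPolynomial ℕ k)) m n x y -
      (-1 : ℤ) ^ (m * n) • opCup (mulOper S (MvPolynomial ℕ k)) n m y x ∈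
        coboundaryOpers S (m + n) := by
  rw [mem_cocycleOpers_iff] at hx hy
  have h := gBracket_preLie (mulOper_mem S) (mem_oper_of_mem_cochainOpers hx.1)
    (mem_oper_of_mem_cochainOpers hy.1) hx.2 hy.2
  rw [← zsmul_mem_iff_of_pow _ (n * (m + 1)), ← h]
  by_cases h₀ : preLie m n x y = 0
  · rw [h₀, gBracket_zero_left (mulOper_mem S)]
    exact zero_mem _
  · have h := gBracket_mul_mem_coboundaryOpers (preLie_mem_cochainOpers hx.1 hy.1)
    have hmn := preLie_ne_zero h₀
    rwa [show m + n - 1 + 1 = m + n by omega] at h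

/-- The bracket is a derivation of the cup product up to coboundaries. -/
lemma gBracket_leibniz_mem {m n p : ℕ} {x y z} (hx : x ∈ cocycleOpers S m)
    (hy : y ∈ cocycleOpers S n) (hz : z ∈ cocycleOpers S p) :
    gBracket (m + n) p (opCup (mulOper S (MvPolynomial ℕ k)) m n x y) z -
      (opCup (mulOper S (MvPolynomial ℕ k)) (m + p - 1) n (gBracket m p x z) y +
        (-1 : ℤ) ^ (m * (p + 1)) •
          opCup (mulOper S (MvPolynomial ℕ k)) m (n + p - 1) x (gBracket n p y z)) ∈
      coboundaryOpers S (m + n + p - 1) := by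
  rw [mem_cocycleOpers_iff] at hx hy hz
  rw [gBracket_brace (mulOper_mem S) (mem_oper_of_mem_cochainOpers hx.1)
    (mem_oper_of_mem_cochainOpers hy.1) (mem_oper_of_mem_cochainOpers hz.1) hx.2 hy.2 hz.2,
    add_sub_cancel_left, zsmul_mem_iff_of_pow]
  by_cases h₀ : brace p m n z x y = 0
  · rw [h₀, gBracket_zero_left (mulOper_mem S)]
    exact zero_mem _
  · have h := gBracket_mul_mem_coboundaryOpers (brace_mem_cochainOpers hz.1 hx.1 hy.1)
    have hp := brace_ne_zero h₀
    rwa [show p + m + n - 2 + 1 = m + n + p - 1 by omega] at h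

/-- The differential squares to zero, since this holds for the bracket with an associative
operation. -/
lemma d_d (n : ℕ) (f : Cochain S.der n) : d S (n + 1) (d S n f) = 0 := by
  refine toOper_injective S.der (n + 2) ?_
  rw [toOper_d, toOper_d, map_zero, ← neg_one_zsmul (gBracket n 2 _ _),
    gBracket_zsmul_left _ _ (mulOper_mem S),
    gBracket_gBracket_mul (mulOper_mem S) (mulOper_assoc S) (toOper_mem _ _ f), smul_zero, neg_zero]

end OperSubgroups

/-! ### Bilinear maps on direct sums of quotients -/

section Quotients

variable {k T : Type*} [Field k] {M : ℕ → Type*} [∀ n, AddCommGroup (M n)] [∀ n, Module k (M n)]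
  [AddCommGroup T] [Module k T]

lemma exists_lift_of_quotients (P : ∀ n, Submodule k (M n)) (B : ∀ n, M n →ₗ[k] T)
    (h : ∀ n, ∀ x ∈ P n, B n x = 0) :
    ∃ b : (⨁ n, M n ⧸ P n) →ₗ[k] T,
      ∀ n (x : M n), b (DirectSum.lof k ℕ (fun n => M n ⧸ P n) n (Submodule.Quotient.mk x)) =
        B n x := by
  refine ⟨DirectSum.toModule k ℕ T fun n => Submodule.liftQ (P n) (B n) fun x hx =>
    LinearMap.mem_ker.2 (h n x hx), fun n x => ?_⟩
  rw [DirectSum.toModule_lof]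
  rfl

/-- Bilinear maps on the components which vanish if one argument lies in `P` induce a bilinear map
on the direct sum of the quotients. -/
lemma exists_lift₂_of_quotients (P : ∀ n, Submodule k (M n))
    (B : ∀ m n, M m →ₗ[k] M n →ₗ[k] T)
    (hl : ∀ m n (x : M m) (y : M n), x ∈ P m → B m n x y = 0)
    (hr : ∀ m n (x : M m) (y : M n), y ∈ P n → B m n x y = 0) :
    ∃ b : (⨁ n, M n ⧸ P n) →ₗ[k] (⨁ n, M n ⧸ P n) →ₗ[k] T,
      ∀ m n (x : M m) (y : M n),
        b (DirectSum.lof k ℕ (fun n => M n ⧸ P n) m (Submodule.Quotient.mk x))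
          (DirectSum.lof k ℕ (fun n => M n ⧸ P n) n (Submodule.Quotient.mk y)) = B m n x y := by
  choose B₁ h₁ using fun m => exists_lift_of_quotients P (fun n => (B m n).flip)
    fun n y hy => LinearMap.ext fun x => hr m n x y hy
  obtain ⟨b, hb⟩ := exists_lift_of_quotients P (fun m => (B₁ m).flip) fun m x hx =>
    DirectSum.linearMap_ext k fun n => Submodule.linearMap_qext _ (LinearMap.ext fun y =>
      (congrArg (fun F => F x) (h₁ m n y)).trans (hl m n x y hx))
  refine ⟨b, fun m n x y => ?_⟩
  rw [hb, LinearMap.flip_apply, h₁, LinearMap.flip_apply]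

end Quotients

/-! ### The Gerstenhaber algebra of cohomology classes -/

section TotalCohomology

variable {k : Type u} [Field k] {A : Type v} [AddCommGroup A] [Module k A]
  (S : AssocConformalAlgebra k A)

/-- The map which sends a cocycle to its class in the total cohomology. -/
def TotalHH.mkHom (n : ℕ) : cocycles S n →ₗ[k] TotalHH S :=
  DirectSum.lof k ℕ (HH S) n ∘ₗ Submodule.mkQ ((coboundaries S n).submoduleOf (cocycles S n))

lemma TotalHH.mk_eq_zero {n : ℕ} {f : cocycles S n} (h : f.1 ∈ coboundaries S n) :
    mk S f = 0 := by
  have : (Submodule.Quotient.mk f : HH S n) = 0 := (Submodule.Quotient.mk_eq_zero _).2 h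
  rw [mk, this, map_zero]

/-- Every class is a sum of classes of cocycles. -/
lemma TotalHH.induction {p : TotalHH S → Prop} (h₀ : p 0) (h₁ : ∀ n (f : cocycles S n), p (mk S f))
    (h₂ : ∀ a b, p a → p b → p (a + b)) (a : TotalHH S) : p a := by
  induction a using DirectSum.induction_on with
  | zero => exact h₀
  | add a b ha hb => exact h₂ a b ha hb
  | of n x =>
    obtain ⟨f, rfl⟩ := Submodule.Quotient.mk_surjective _ x
    exact h₁ n f

lemma TotalHH.mk_mem_degree {n : ℕ} {i : ℤ} (h : i = n) (f : cocycles S n) :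
    mk S f ∈ degree S i := by
  subst h
  exact ⟨Submodule.Quotient.mk f, rfl⟩

lemma TotalHH.exists_of_mem_degree {i : ℤ} {a : TotalHH S} (h : a ∈ degree S i) :
    a = 0 ∨ ∃ n : ℕ, i = n ∧ ∃ f : cocycles S n, a = mk S f := by
  cases i with
  | ofNat n =>
    obtain ⟨x, rfl⟩ := h
    obtain ⟨f, rfl⟩ := Submodule.Quotient.mk_surjective _ x
    exact Or.inr ⟨n, rfl, f, rfl⟩
  | negSucc n => exact Or.inl h

/-- The inclusion of the component of degree `n`. -/
def TotalHH.degreeMap (n : ℕ) : HH S n →ₗ[k] degree S (Int.ofNat n) :=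
  LinearMap.codRestrict _ (DirectSum.lof k ℕ (HH S) n) fun x => ⟨x, rfl⟩

/-- The grading of the total cohomology by `ℤ`, with zero components in negative degrees, is a
direct sum decomposition. -/
lemma TotalHH.isInternal_degree : DirectSum.IsInternal (TotalHH.degree S) := by
  let D : TotalHH S →ₗ[k] ⨁ i, degree S i := DirectSum.toModule k ℕ _ fun n =>
    DirectSum.lof k ℤ (fun i => degree S i) (Int.ofNat n) ∘ₗ degreeMap S n
  have hD : ∀ (n : ℕ) (x : HH S n), D (DirectSum.lof k ℕ (HH S) n x) =
      DirectSum.lof k ℤ (fun i => degree S i) (Int.ofNat n) (degreeMap S n x) := fun n x => by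
    simp only [D, DirectSum.toModule_lof]
    rfl
  have := DirectSum.Decomposition.ofLinearMap (degree S) D
    (DirectSum.linearMap_ext k fun n => LinearMap.ext fun x => by
      simp only [LinearMap.comp_apply, LinearMap.id_apply]
      rw [hD, DirectSum.coeLinearMap_lof]
      rfl)
    (DirectSum.linearMap_ext k fun i => LinearMap.ext fun x => by
      simp only [LinearMap.comp_apply, LinearMap.id_apply, DirectSum.coeLinearMap_lof]
      cases i with
      | ofNat n =>
        obtain ⟨_, x, rfl⟩ := x
        rw [hD]
        rfl
      | negSucc n =>
        obtain ⟨x, hx⟩ := x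
        obtain rfl : x = 0 := hx
        rw [map_zero]
        exact (map_zero _).symm)
  exact DirectSum.Decomposition.isInternal _

/-- A bilinear operation on cocycles which maps pairs with a coboundary to zero induces a bilinear
operation on the total cohomology. -/
lemma TotalHH.exists_lift₂ (B : ∀ m n, cocycles S m →ₗ[k] cocycles S n →ₗ[k] TotalHH S)
    (hl : ∀ m n (f : cocycles S m) (g : cocycles S n), f.1 ∈ coboundaries S m → B m n f g = 0)
    (hr : ∀ m n (f : cocycles S m) (g : cocycles S n), g.1 ∈ coboundaries S n → B m n f g = 0) :
    ∃ b : TotalHH S →ₗ[k] TotalHH S →ₗ[k] TotalHH S,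
      ∀ m n (f : cocycles S m) (g : cocycles S n), b (mk S f) (mk S g) = B m n f g := by
  have := @exists_lift₂_of_quotients k (TotalHH S) _ (fun n => cocycles S n) _ _ _ _
    (fun n => (coboundaries S n).submoduleOf (cocycles S n)) B
    (fun m n f g hf => hl m n f g hf) (fun m n f g hg => hr m n f g hg)
  exact this

variable [DecidableEq (MvPolynomial ℕ k)]

/-- The class `ξ` is represented by an `n`-cocycle with the operation `x`. -/
def IsRep (n : ℕ) (x : (ℕ → EvSum (MvPolynomial ℕ k) S.der) → EvSum (MvPolynomial ℕ k) S.der)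
    (ξ : TotalHH S) : Prop :=
  ∃ f : cocycles S n, cochainOper S f.1 = x ∧ TotalHH.mk S f = ξ

variable {S}

lemma IsRep.mem {n : ℕ} {x} {ξ : TotalHH S} (h : IsRep S n x ξ) : x ∈ cocycleOpers S n := by
  obtain ⟨f, rfl, rfl⟩ := h
  exact ⟨f.1, f.2, rfl⟩

lemma isRep_mk {n : ℕ} (f : cocycles S n) : IsRep S n (cochainOper S f.1) (TotalHH.mk S f) :=
  ⟨f, rfl, rfl⟩

lemma IsRep.sub {n : ℕ} {x y} {ξ η : TotalHH S} (hx : IsRep S n x ξ) (hy : IsRep S n y η) :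
    IsRep S n (x - y) (ξ - η) := by
  obtain ⟨f, rfl, rfl⟩ := hx
  obtain ⟨g, rfl, rfl⟩ := hy
  exact ⟨f - g, map_sub _ _ _, map_sub (TotalHH.mkHom S n) f g⟩

lemma IsRep.add {n : ℕ} {x y} {ξ η : TotalHH S} (hx : IsRep S n x ξ) (hy : IsRep S n y η) :
    IsRep S n (x + y) (ξ + η) := by
  obtain ⟨f, rfl, rfl⟩ := hx
  obtain ⟨g, rfl, rfl⟩ := hy
  exact ⟨f + g, map_add _ _ _, map_add (TotalHH.mkHom S n) f g⟩

lemma IsRep.zsmul {n : ℕ} {x} {ξ : TotalHH S} (hx : IsRep S n x ξ) (c : ℤ) :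
    IsRep S n (c • x) (c • ξ) := by
  obtain ⟨f, rfl, rfl⟩ := hx
  exact ⟨c • f, map_zsmul (toOper S.der (MvPolynomial ℕ k) n) c f.1,
    map_zsmul (TotalHH.mkHom S n) c f⟩

lemma IsRep.neg {n : ℕ} {x} {ξ : TotalHH S} (hx : IsRep S n x ξ) : IsRep S n (-x) (-ξ) := by
  obtain ⟨f, rfl, rfl⟩ := hx
  exact ⟨-f, map_neg _ _, map_neg (TotalHH.mkHom S n) f⟩

/-- A class vanishes if its operation is that of a coboundary; here the injectivity of `toOper` is
used. -/
lemma IsRep.eq_zero {n : ℕ} {x} {ξ : TotalHH S} (hx : IsRep S n x ξ)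
    (h : x ∈ coboundaryOpers S n) : ξ = 0 := by
  obtain ⟨f, rfl, rfl⟩ := hx
  obtain ⟨g, hg, hfg⟩ := h
  refine TotalHH.mk_eq_zero S ?_
  rwa [← toOper_injective S.der n hfg]

lemma IsRep.eq {n : ℕ} {x y} {ξ η : TotalHH S} (hx : IsRep S n x ξ) (hy : IsRep S n y η)
    (h : x - y ∈ coboundaryOpers S n) : ξ = η := sub_eq_zero.1 ((hx.sub hy).eq_zero h)

/-- The operation determines the class. -/
lemma IsRep.unique {n : ℕ} {x} {ξ η : TotalHH S} (hx : IsRep S n x ξ) (hy : IsRep S n x η) :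
    ξ = η := hx.eq hy (by rw [sub_self]; exact zero_mem _)

/-- A vanishing operation represents the zero class in every degree. -/
lemma IsRep.cast {m n : ℕ} {x} {ξ : TotalHH S} (hx : IsRep S m x ξ) (h : x ≠ 0 → m = n) :
    IsRep S n x ξ := by
  by_cases h₀ : x = 0
  · subst h₀
    rw [hx.eq_zero (zero_mem _)]
    exact ⟨0, map_zero _, map_zero (TotalHH.mkHom S n)⟩
  · rwa [← h h₀]

lemma IsRep.mem_degree {n : ℕ} {x} {ξ : TotalHH S} (hx : IsRep S n x ξ) {i : ℤ} (h : i = n) :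
    ξ ∈ TotalHH.degree S i := by
  obtain ⟨f, -, rfl⟩ := hx
  exact TotalHH.mk_mem_degree S h f

lemma exists_isRep_of_mem_degree {i : ℤ} {a : TotalHH S} (h : a ∈ TotalHH.degree S i) :
    a = 0 ∨ ∃ n : ℕ, i = n ∧ ∃ x, IsRep S n x a := by
  obtain h | ⟨n, hn, f, rfl⟩ := TotalHH.exists_of_mem_degree S h
  · exact Or.inl h
  · exact Or.inr ⟨n, hn, _, isRep_mk f⟩

/-- A bilinear operation on the operations of cochains, which preserves cocycles and coboundaries,
induces a bilinear operation on the total cohomology. -/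
lemma exists_bilinear_of_opers (e : ℕ → ℕ → ℕ)
    (c : ℕ → ℕ → ((ℕ → EvSum (MvPolynomial ℕ k) S.der) → EvSum (MvPolynomial ℕ k) S.der) →
      ((ℕ → EvSum (MvPolynomial ℕ k) S.der) → EvSum (MvPolynomial ℕ k) S.der) →
      (ℕ → EvSum (MvPolynomial ℕ k) S.der) → EvSum (MvPolynomial ℕ k) S.der)
    (add_left : ∀ m n x x', ∀ y ∈ cocycleOpers S n, c m n (x + x') y = c m n x y + c m n x' y)
    (smul_left : ∀ m n (t : MvPolynomial ℕ k) x, ∀ y ∈ cocycleOpers S n,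
      c m n (t • x) y = t • c m n x y)
    (add_right : ∀ m n, ∀ x ∈ cocycleOpers S m, ∀ y y', c m n x (y + y') = c m n x y + c m n x y')
    (smul_right : ∀ m n (t : MvPolynomial ℕ k), ∀ x ∈ cocycleOpers S m, ∀ y,
      c m n x (t • y) = t • c m n x y)
    (mem : ∀ m n, ∀ x ∈ cocycleOpers S m, ∀ y ∈ cocycleOpers S n,
      c m n x y ∈ cocycleOpers S (e m n))
    (mem_left : ∀ m n, ∀ x ∈ coboundaryOpers S m, ∀ y ∈ cocycleOpers S n,
      c m n x y ∈ coboundaryOpers S (e m n))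
    (mem_right : ∀ m n, ∀ x ∈ cocycleOpers S m, ∀ y ∈ coboundaryOpers S n,
      c m n x y ∈ coboundaryOpers S (e m n)) :
    ∃ b : TotalHH S →ₗ[k] TotalHH S →ₗ[k] TotalHH S, ∀ m n x y ξ η, IsRep S m x ξ →
      IsRep S n y η → IsRep S (e m n) (c m n x y) (b ξ η) := by
  have hz : ∀ {n} (f : cocycles S n), cochainOper S f.1 ∈ cocycleOpers S n :=
    fun f => ⟨f.1, f.2, rfl⟩
  have hinj : ∀ {n} {f g : cocycles S n}, cochainOper S f.1 = cochainOper S g.1 → f = g :=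
    fun h => Subtype.ext (toOper_injective S.der _ h)
  have hadd : ∀ {n} (f g : cocycles S n),
      cochainOper S (f + g).1 = cochainOper S f.1 + cochainOper S g.1 := fun f g => map_add _ _ _
  have hsmul : ∀ {n} (t : k) (f : cocycles S n),
      cochainOper S (t • f).1 = algebraMap k (MvPolynomial ℕ k) t • cochainOper S f.1 :=
    fun t f => (toOper S.der (MvPolynomial ℕ k) _).map_smulₛₗ t f.1
  -- Since `toOper` is injective, the cocycle `w` with the operation `c m n x y` depends
  -- bilinearly on the cocycles of `x` and `y`.
  have hex : ∀ m n (f : cocycles S m) (g : cocycles S n), ∃ w : cocycles S (e m n),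
      cochainOper S w.1 = c m n (cochainOper S f.1) (cochainOper S g.1) := fun m n f g => by
    obtain ⟨w, hw, hw'⟩ := mem m n _ (hz f) _ (hz g)
    exact ⟨⟨w, hw⟩, hw'⟩
  choose w hw using hex
  obtain ⟨b, hb⟩ := TotalHH.exists_lift₂ S
    (fun m n => (LinearMap.mk₂ k (w m n)
      (fun f f' g => hinj (by
        rw [hadd, hw, hw, hw, hadd, add_left _ _ _ _ _ (hz g)]))
      (fun t f g => hinj (by
        rw [hsmul, hw, hw, hsmul, smul_left _ _ _ _ _ (hz g)]))
      (fun f g g' => hinj (by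
        rw [hadd, hw, hw, hw, hadd, add_right _ _ _ (hz f)]))
      (fun t f g => hinj (by
        rw [hsmul, hw, hw, hsmul, smul_right _ _ _ _ (hz f)]))).compr₂ (TotalHH.mkHom S (e m n)))
    (fun m n f g hf => (isRep_mk (w m n f g)).eq_zero (by
      rw [hw]; exact mem_left m n _ ⟨f.1, hf, rfl⟩ _ (hz g)))
    (fun m n f g hg => (isRep_mk (w m n f g)).eq_zero (by
      rw [hw]; exact mem_right m n _ (hz f) _ ⟨g.1, hg, rfl⟩))
  refine ⟨b, ?_⟩
  rintro m n _ _ _ _ ⟨f, rfl, rfl⟩ ⟨g, rfl, rfl⟩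
  exact ⟨w m n f g, hw m n f g, (hb m n f g).symm⟩

variable (S)

lemma exists_cup : ∃ b : TotalHH S →ₗ[k] TotalHH S →ₗ[k] TotalHH S, ∀ m n x y ξ η,
    IsRep S m x ξ → IsRep S n y η →
      IsRep S (m + n) (opCup (mulOper S (MvPolynomial ℕ k)) m n x y) (b ξ η) :=
  exists_bilinear_of_opers (fun m n => m + n) (opCup (mulOper S (MvPolynomial ℕ k)))
    (fun m n x x' y _ => opCup_add_left (mulOper_mem S) m n x x' y)
    (fun m n t x y _ => opCup_smul_left (mulOper_mem S) m n t x y)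
    (fun m n x _ y y' => opCup_add_right (mulOper_mem S) m n x y y')
    (fun m n t x _ y => opCup_smul_right (mulOper_mem S) m n t x y)
    (fun _ _ _ hx _ hy => opCup_mem_cocycleOpers hx hy)
    (fun _ _ _ hx _ hy => opCup_mem_coboundaryOpers_left hx hy)
    (fun _ _ _ hx _ hy => opCup_mem_coboundaryOpers_right hx hy)

lemma exists_bracket : ∃ b : TotalHH S →ₗ[k] TotalHH S →ₗ[k] TotalHH S, ∀ m n x y ξ η,
    IsRep S m x ξ → IsRep S n y η → IsRep S (m + n - 1) (gBracket m n x y) (b ξ η) := by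
  have ho : ∀ {n x}, x ∈ cocycleOpers S n →
      x ∈ Oper (MvPolynomial ℕ k) (EvSum (MvPolynomial ℕ k) S.der) n := fun hx =>
    mem_oper_of_mem_cochainOpers (mem_cocycleOpers_iff.1 hx).1
  exact exists_bilinear_of_opers (fun m n => m + n - 1) gBracket
    (fun m n x x' y hy => gBracket_add_left x x' (ho hy))
    (fun m n t x y hy => gBracket_smul_left t x (ho hy))
    (fun m n x hx y y' => gBracket_add_right (ho hx) y y')
    (fun m n t x hx y => gBracket_smul_right (ho hx) t y)
    (fun _ _ _ hx _ hy => gBracket_mem_cocycleOpers hx hy)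
    (fun _ _ _ hx _ hy => gBracket_mem_coboundaryOpers_left hx hy)
    (fun _ _ _ hx _ hy => gBracket_mem_coboundaryOpers_right hx hy)

variable {S}

/-- Any two bilinear operations on the total cohomology which are represented by the cup product
and the bracket of operations satisfy the axioms of a Gerstenhaber algebra. -/
theorem isGerstenhaberAlgebra {cupHH bracketHH : TotalHH S →ₗ[k] TotalHH S →ₗ[k] TotalHH S}
    (hc : ∀ m n x y ξ η, IsRep S m x ξ → IsRep S n y η →
      IsRep S (m + n) (opCup (mulOper S (MvPolynomial ℕ k)) m n x y) (cupHH ξ η))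
    (hb : ∀ m n x y ξ η, IsRep S m x ξ → IsRep S n y η →
      IsRep S (m + n - 1) (gBracket m n x y) (bracketHH ξ η)) :
    IsGerstenhaberAlgebra (k := k) (G := TotalHH S) (TotalHH.degree S) cupHH bracketHH := by
  have ho : ∀ {n x} {ξ : TotalHH S}, IsRep S n x ξ →
      x ∈ Oper (MvPolynomial ℕ k) (EvSum (MvPolynomial ℕ k) S.der) n := fun hx =>
    mem_oper_of_mem_cochainOpers (mem_cocycleOpers_iff.1 hx.mem).1
  refine
    { isInternal := TotalHH.isInternal_degree S
      mul_mem := fun {i j a b} ha hb' => ?_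
      mul_assoc := fun a b c => ?_
      mul_comm := fun {i j a b} ha hb' => ?_
      bracket_mem := fun {i j a b} ha hb' => ?_
      bracket_skew := fun {i j a b} ha hb' => ?_
      jacobi := fun {i j l a b c} ha hb' hc' => ?_
      leibniz := fun {i j l a b c} ha hb' hc' => ?_ }
  · obtain rfl | ⟨m, rfl, x, hx⟩ := exists_isRep_of_mem_degree ha
    · simp
    obtain rfl | ⟨n, rfl, y, hy⟩ := exists_isRep_of_mem_degree hb'
    · simp
    exact (hc m n x y a b hx hy).mem_degree (by push_cast; rfl)
  · induction a using TotalHH.induction with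
    | h₀ => simp
    | h₂ a a' h h' => simp only [map_add, LinearMap.add_apply, h, h']
    | h₁ m f =>
    induction b using TotalHH.induction with
    | h₀ => simp
    | h₂ b b' h h' => simp only [map_add, LinearMap.add_apply, h, h']
    | h₁ n g =>
    induction c using TotalHH.induction with
    | h₀ => simp
    | h₂ c c' h h' => simp only [map_add, h, h']
    | h₁ p h =>
    have e₁ := hc _ _ _ _ _ _ (hc _ _ _ _ _ _ (isRep_mk f) (isRep_mk g)) (isRep_mk h)
    have e₂ := hc _ _ _ _ _ _ (isRep_mk f) (hc _ _ _ _ _ _ (isRep_mk g) (isRep_mk h))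
    rw [opCup_assoc (mulOper_mem S) (mulOper_assoc S), add_assoc] at e₁
    exact e₁.unique e₂
  · obtain rfl | ⟨m, rfl, x, hx⟩ := exists_isRep_of_mem_degree ha
    · simp
    obtain rfl | ⟨n, rfl, y, hy⟩ := exists_isRep_of_mem_degree hb'
    · simp
    rw [negOnePow_smul_eq_zsmul (e := m * n) (by push_cast; rfl)]
    have h := (hc n m y x b a hy hx).zsmul ((-1) ^ (m * n))
    rw [add_comm n m] at h
    exact (hc m n x y a b hx hy).eq h (opCup_comm_mem hx.mem hy.mem)
  · obtain rfl | ⟨m, rfl, x, hx⟩ := exists_isRep_of_mem_degree ha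
    · simp
    obtain rfl | ⟨n, rfl, y, hy⟩ := exists_isRep_of_mem_degree hb'
    · simp
    have h := hb m n x y a b hx hy
    by_cases h₀ : gBracket m n x y = 0
    · rw [h.eq_zero (h₀ ▸ zero_mem _)]
      exact zero_mem _
    · have := gBracket_ne_zero h₀
      exact h.mem_degree (by omega)
  · obtain rfl | ⟨m, rfl, x, hx⟩ := exists_isRep_of_mem_degree ha
    · simp
    obtain rfl | ⟨n, rfl, y, hy⟩ := exists_isRep_of_mem_degree hb'
    · simp
    rw [negOnePow_smul_eq_zsmul (e := (m + 1) * (n + 1)) (by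
      push_cast
      generalize (n : ZMod 2) = n, (m : ZMod 2) = m
      decide +revert)]
    have h := ((hb n m y x b a hy hx).zsmul ((-1) ^ ((m + 1) * (n + 1)))).neg
    rw [add_comm n m] at h
    rw [← gBracket_skew] at h
    exact (hb m n x y a b hx hy).unique h
  · obtain rfl | ⟨m, rfl, x, hx⟩ := exists_isRep_of_mem_degree ha
    · simp
    obtain rfl | ⟨n, rfl, y, hy⟩ := exists_isRep_of_mem_degree hb'
    · simp
    obtain rfl | ⟨p, rfl, z, hz'⟩ := exists_isRep_of_mem_degree hc'
    · simp
    rw [negOnePow_smul_eq_zsmul (e := (m + 1) * (n + 1)) (by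
      push_cast
      generalize (n : ZMod 2) = n, (m : ZMod 2) = m
      decide +revert)]
    have h := gBracket_jacobi (ho hx) (ho hy) (ho hz')
    have h₁ := hb _ _ _ _ _ _ hx (hb _ _ _ _ _ _ hy hz')
    have h₂ := hb _ _ _ _ _ _ (hb _ _ _ _ _ _ hx hy) hz'
    have h₃ := hb _ _ _ _ _ _ hy (hb _ _ _ _ _ _ hx hz')
    -- The three terms are brought to the common degree `m + n + p - 2`; where an inner arity is
    -- truncated, the term is zero, and a zero operation represents zero in any degree.
    replace h₁ := h₁.cast (n := m + n + p - 2) fun hne => by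
      have := gBracket_ne_zero hne
      have := gBracket_ne_zero (ne_zero_of_gBracket_ne_zero_right (ho hx) hne)
      omega
    replace h₂ := h₂.cast (n := m + n + p - 2) fun hne => by
      have := gBracket_ne_zero hne
      have := gBracket_ne_zero (ne_zero_of_gBracket_ne_zero_left (ho hz') hne)
      omega
    replace h₃ := h₃.cast (n := m + n + p - 2) fun hne => by
      have := gBracket_ne_zero hne
      have := gBracket_ne_zero (ne_zero_of_gBracket_ne_zero_right (ho hy) hne)
      omega
    rw [h] at h₁
    exact h₁.unique (h₂.add (h₃.zsmul _))
  · obtain rfl | ⟨m, rfl, x, hx⟩ := exists_isRep_of_mem_degree ha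
    · simp
    obtain rfl | ⟨n, rfl, y, hy⟩ := exists_isRep_of_mem_degree hb'
    · simp
    obtain rfl | ⟨p, rfl, z, hz'⟩ := exists_isRep_of_mem_degree hc'
    · simp
    rw [negOnePow_smul_eq_zsmul (e := m * (p + 1)) (by
      push_cast
      generalize (p : ZMod 2) = p, (m : ZMod 2) = m
      decide +revert)]
    have h := gBracket_leibniz_mem hx.mem hy.mem hz'.mem
    have h₁ := hb _ _ _ _ _ _ (hc _ _ _ _ _ _ hx hy) hz'
    have h₂ := hc _ _ _ _ _ _ (hb _ _ _ _ _ _ hx hz') hy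
    have h₃ := hc _ _ _ _ _ _ hx (hb _ _ _ _ _ _ hy hz')
    -- The degrees `(m + p - 1) + n` and `m + (n + p - 1)` equal `m + n + p - 1` unless the
    -- bracket in the term vanishes.
    replace h₂ := h₂.cast (n := m + n + p - 1) fun hne => by
      have : gBracket m p x z ≠ 0 := fun h₀ => hne (by
        rw [h₀, opCup_zero_left (mulOper_mem S)])
      have := gBracket_ne_zero this
      omega
    replace h₃ := h₃.cast (n := m + n + p - 1) fun hne => by
      have : gBracket n p y z ≠ 0 := fun h₀ => hne (by
        rw [h₀, opCup_zero_right (mulOper_mem S)])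
      have := gBracket_ne_zero this
      omega
    exact h₁.eq (h₂.add (h₃.zsmul _)) h

end TotalCohomology

end

end ConformalHochschild

open ConformalHochschild in
theorem theorem5p4 {k : Type*} [Field k] [IsAlgClosed k] [CharZero k] {A : Type*} [AddCommGroup A]
    [Module k A] (S : AssocConformalAlgebra k A) :
    (∀ (n : ℕ) (f : Cochain S.der n), d S (n + 1) (d S n f) = 0) ∧
    ∃ cupHH bracketHH : TotalHH S →ₗ[k] TotalHH S →ₗ[k] TotalHH S,
      (∀ {m n N : ℕ} (h : m + n = N) (f : cocycles S m) (g : cocycles S n),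
        ∃ hc : cup S h f.1 g.1 ∈ cocycles S N,
          cupHH (TotalHH.mk S f) (TotalHH.mk S g) = TotalHH.mk S ⟨cup S h f.1 g.1, hc⟩) ∧
      (∀ {m n N : ℕ} (h : m + n = N + 1) (f : cocycles S m) (g : cocycles S n),
        ∃ hb : bracket S h f.1 g.1 ∈ cocycles S N,
          bracketHH (TotalHH.mk S f) (TotalHH.mk S g) =
            TotalHH.mk S ⟨bracket S h f.1 g.1, hb⟩) ∧
      (∀ f g : cocycles S 0, bracketHH (TotalHH.mk S f) (TotalHH.mk S g) = 0) ∧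
      IsGerstenhaberAlgebra (k := k) (G := TotalHH S) (TotalHH.degree S) cupHH bracketHH := by
  classical
  obtain ⟨cupHH, hc⟩ := exists_cup S
  obtain ⟨bracketHH, hb⟩ := exists_bracket S
  refine ⟨d_d, cupHH, bracketHH, fun {m n N} h f g => ?_, fun {m n N} h f g => ?_, fun f g => ?_,
    isGerstenhaberAlgebra hc hb⟩
  · subst h
    obtain ⟨w, hw, hw'⟩ := hc m n _ _ _ _ (isRep_mk f) (isRep_mk g)
    rw [← toOper_cup S _ rfl] at hw
    have e : w.1 = cup S rfl f.1 g.1 := toOper_injective S.der _ hw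
    exact ⟨e ▸ w.2, hw'.symm.trans (congrArg _ (Subtype.ext e))⟩
  · obtain rfl : N = m + n - 1 := by omega
    obtain ⟨w, hw, hw'⟩ := hb m n _ _ _ _ (isRep_mk f) (isRep_mk g)
    rw [← toOper_bracket S _ h] at hw
    have e : w.1 = bracket S h f.1 g.1 := toOper_injective S.der _ hw
    exact ⟨e ▸ w.2, hw'.symm.trans (congrArg _ (Subtype.ext e))⟩
  · refine (hb 0 0 _ _ _ _ (isRep_mk f) (isRep_mk g)).eq_zero ?_
    rw [show gBracket 0 0 (cochainOper S f.1) (cochainOper S g.1) = 0 by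
      simp [gBracket, preLie]]
    exact zero_mem _
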